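/- Let $\log$ denote the base-2 logarithm. A \emph{hierarchy} on a finite vertex set $V$ is a partition $\mathcal{C}$ of $V$ into nonempty parts together with a rooted tree whose node set is $\mathcal{C}$. For parts $\gamma,\gamma'$ write $\gamma\preceq\gamma'$ (resp. $\gamma\prec\gamma'$) if $\gamma$ is a descendant (resp. strict descendant) of $\gamma'$ in the tree, and for a hierarchy $\mathcal{H}$ let $V(\mathcal{H}_\gamma)=\bigcup_{\gamma'\preceq\gamma}\gamma'$. Consider, for a connected $n$-vertex graph $G=(V,E)$, the following properties of a hierarchy: 1. it has height at most $\log n$, i.e. every chain of parts from a part up to the root has at most $\max(1,\log n)$ members (the maximum matters only for $n=1$); 2. (no lateral edges) if $\{u,v\}\in E$ and $\gamma_u,\gamma_v$ are the parts containing $u,v$, then $\gamma_u\prec\gamma_v$ or $\gamma_v\preceq\gamma_u$; 3. for every part $\gamma$ the subgraph of $G$ induced by $V(\mathcal{H}_\gamma)$ is connected, and for every child $\gamma'$ of $\gamma$ there is an edge of $G$ between $\gamma$ and $V(\mathcal{H}_{\gamma'})$; 4. each part is spanned by a Steiner tree in $G$ of maximum degree at most 4, which may have Steiner points outside the part. A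 hierarchy with properties 1--4 is called a Duan--Pettie hierarchy of $G$. \textbf{Theorem 5.} There is an absolute constant $C>0$ such that every connected $n$-vertex graph $G=(V,E)$ has a Duan--Pettie hierarchy $\mathcal{H}^0$ for which the following holds. For every integer $f\ge 0$ there is a partition $(S_1,\ldots,S_{f+1})$ of $V$ (parts may be empty) such that for every $F\subseteq V$ with $|F|\le f$ there is an $i$ with $S_i\cap F=\emptyset$. Moreover, for each $S\in\{S_1,\ldots,S_{f+1}\}$ there is a hierarchy $\mathcal{H}=\mathcal{H}(S)$ on a partition $\mathcal{K}(S)$ of $V$ such that: (1) $\mathcal{H}$ is a coarsening of $\mathcal{H}^0$, that is, it is obtained from $\mathcal{H}^0$ by contracting pairwise disjoint connected subtrees of $\mathcal{H}^0$ and uniting the parts in each of them; and $\mathcal{H}$ has properties 1--3. (2) Each $K\in\mathcal{K}(S)$ has a spanning tree $T(K)$ in $G[K]$ in which every vertex of $K\setminus S$ has degree at most $3\log n$ (the vertices of $S$ may have arbitrarily large degree). (3) For $K\in\mathcal{K}(S)$ let $N(\mathcal{H}_K)$ be the set of vertices in $V\setminus V(\mathcal{H}_K)$ adjacent to some vertex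 of $V(\mathcal{H}_K)$. If $v\in N(\mathcal{H}_K)$ and $v\in K_v\in\mathcal{K}(S)$, then $K\prec K_v$. Moreover, $|N(\mathcal{H}_K)|\le C f\log n$. -/

import Mathlib

universe u

/-- A hierarchy on `V`: a partition of `V` into nonempty parts, indexed by the type `Node`
(the part of a vertex `v` is `comp v`), together with a rooted tree on the set of parts,
given by its root and its parent function (the root is its own parent by convention). -/
structure Hierarchy (V : Type u) where
  Node : Type u
  comp : V → Node
  comp_surjective : Function.Surjective comp
  root : Node
  parent : Node → Node
  parent_root : parent root = root
  reaches_root : ∀ x, ∃ k : ℕ, parent^[k] x = root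

namespace Hierarchy

variable {V : Type u}

/-- The part of the partition that belongs to the node `x`. -/
def part (H : Hierarchy V) (x : H.Node) : Set V := {v | H.comp v = x}

/-- `x ≼ y`: the node `x` is a descendant of `y`, or equal to `y`. -/
def Le (H : Hierarchy V) (x y : H.Node) : Prop := ∃ k : ℕ, H.parent^[k] x = y

/-- `x ≺ y`: the node `x` is a strict descendant of `y`. -/
def Lt (H : Hierarchy V) (x y : H.Node) : Prop := H.Le x y ∧ x ≠ y

/-- `y` is a child of `x` in the rooted tree. -/
def IsChild (H : Hierarchy V) (y x : H.Node) : Prop := y ≠ H.root ∧ H.parent y = x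

/-- The union of all the parts in the subhierarchy rooted at `x`. -/
def sub (H : Hierarchy V) (x : H.Node) : Set V := {v | H.Le (H.comp v) x}

/-- The hierarchy tree, as an undirected graph on the nodes. -/
def tree (H : Hierarchy V) : SimpleGraph H.Node :=
  SimpleGraph.fromRel (fun x y => H.parent x = y)

/-- The vertices outside the subhierarchy rooted at `x` that have a neighbor inside it. -/
def outerNbrs (H : Hierarchy V) (G : SimpleGraph V) (x : H.Node) : Set V :=
  {v | v ∉ H.sub x ∧ ∃ w ∈ H.sub x, G.Adj w v}

/-- `H` is a coarsening of `H₀`: it arises by contracting pairwise disjoint connected subtrees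
of the tree `H₀` and taking the union of the parts in each of them. Here `q` sends each old node
to the new node that absorbs it. -/
def IsCoarsening (H H₀ : Hierarchy V) : Prop :=
  ∃ q : H₀.Node → H.Node,
    (∀ v, H.comp v = q (H₀.comp v)) ∧
    q H₀.root = H.root ∧
    (∀ x, q (H₀.parent x) ≠ q x → H.parent (q x) = q (H₀.parent x)) ∧
    (∀ y, (H₀.tree.induce {x | q x = y}).Connected)

/-- The structural properties of a hierarchy with respect to a graph `G` on `V`, `|V| = n`. -/
structure IsRespectful [Fintype V] (H : Hierarchy V) (G : SimpleGraph V) : Prop where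
  /-- There are at most `log₂ n` levels: the chain of nodes from `x` up to the root has at most
  `log₂ n` members (`k + 1` of them if it has `k` edges). The maximum with `1` only matters
  for a one-vertex graph, whose hierarchy has one node. -/
  height : ∀ x, ∃ k : ℕ, H.parent^[k] x = H.root ∧
    (k : ℝ) + 1 ≤ max 1 (Real.logb 2 (Fintype.card V))
  /-- There are no lateral edges. -/
  no_lateral : ∀ u v, G.Adj u v →
    H.Lt (H.comp u) (H.comp v) ∨ H.Le (H.comp v) (H.comp u)
  /-- Every subhierarchy induces a connected subgraph. -/
  connected : ∀ x, (G.induce (H.sub x)).Connected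
  /-- Every part has an edge to the subhierarchy of each of its children. -/
  child_edge : ∀ y x, H.IsChild y x → ∃ u ∈ H.part x, ∃ v ∈ H.sub y, G.Adj u v

/-- A Duan-Pettie low-degree hierarchy of `G`: besides the structural properties, each part is
spanned by a Steiner tree in `G` of maximum degree at most `4` (with Steiner points anywhere). -/
structure IsDuanPettie [Fintype V] (H : Hierarchy V) (G : SimpleGraph V) : Prop
    extends H.IsRespectful G where
  steiner : ∀ x, ∃ T : G.Subgraph, T.coe.IsTree ∧ H.part x ⊆ T.verts ∧
    ∀ v ∈ T.verts, (T.neighborSet v).ncard ≤ 4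

end Hierarchy

/-!
Three ingredients carry the proof.

**Blocking sets.** `SimpleGraph.exists_blocker` is a form of the theorem of Fürer and Raghavachari
on spanning trees of small degree: for a set `U` of terminals and a number `k ≥ 3` there is a set
`B` such that `G - B` separates at least `(k - 2) |B| + 2` terminals from each other (unless `B`
is empty), while the terminals inside one component of `G - B` are joined by a Steiner tree of
degree at most `k`, and the degree can even be made less than `k` at any one vertex of that tree.
The proof takes a tree `T` and a set `M` on which `T` is *loose*, meaning that it can be rewired
inside `M` to have degree at most `k` there and less than `k` at one prescribed vertex per
component of `T[M]`. When the excess degree off `M` is least, no path of `G` off `T` joins two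
components of `T[M]`: such a path closes a cycle, and either an edge at a vertex of too large a
degree on the cycle can be left out, or the whole cycle can be added to `M`, because any one of
its edges can be left out (`SimpleGraph.IsLoose.ear`). The bound on `|B|` is then the degree sum
of a tree.

**The hierarchy.** Blocking `V` with `k = 4`, then blocking the blocking set, and so on, ends
after `p` steps with `2 ^ p ≤ n` unless `p = 1`, as the blocking sets shrink by more than a half.
Rank a vertex by the last of these sets that contains it. The lower set of `v` is the component of
`v` among the vertices that do not rank above `v`, and the lower sets form a hierarchy without
lateral edges, for any rank function (`SimpleGraph.rankHierarchy`). The flexible set `A v` of the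
Steiner tree through `v` shows that the parts have Steiner trees of degree `4`.

**Merging parts.** For a colour class `S`, a part is merged with its parent as soon as an edge to
`S`, a flexible set, or the route of a higher merged part would otherwise stick out of its lower
set; it is then given a route of its own, a path inside its lower set from its flexible set to
such an exit. The result is the hierarchy of another rank function (`SimpleGraph.contractRank`).
As no edge from a lower set of the new hierarchy ends in `S` outside, a colouring with `f + 1`
colours that uses all colours on every outer neighbourhood with more than `6 f log n` elements
makes the outer neighbourhoods small; a union bound finds one (`exists_colouring`). Removing a set
`X` disjoint from `S` from a new part leaves at most `3 p |X| + 1` components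
(`SimpleGraph.IsRouting.card_le`): at each rank, `X` either hits flexible sets, and each of these
falls into at most three pieces per vertex of `X`, or a component can be recovered from the vertex
of `X` through which a route leaves it. So the blocking set of a new part with respect to `k = 3 p
+ 2` is empty, and the part has a spanning tree of degree at most `3 p + 2` off `S`.
-/

namespace SimpleGraph

variable {V : Type u}

/-! ### Graphs restricted to a vertex set, and their degrees -/

/-- The subgraph of `G` on the same vertex type that keeps the edges with both ends in `s`. -/
def within (G : SimpleGraph V) (s : Set V) : SimpleGraph V where
  Adj a b := G.Adj a b ∧ a ∈ s ∧ b ∈ s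
  symm := ⟨fun _ _ h => ⟨h.1.symm, h.2.2, h.2.1⟩⟩
  loopless := ⟨fun _ h => h.1.ne rfl⟩

/-- The degree of a vertex, as the cardinality of its neighbourhood. -/
noncomputable def deg (G : SimpleGraph V) (v : V) : ℕ := (G.neighborSet v).ncard

theorem within_adj {G : SimpleGraph V} {s : Set V} {a b : V} :
    (G.within s).Adj a b ↔ G.Adj a b ∧ a ∈ s ∧ b ∈ s := Iff.rfl

theorem Adj.reachable_within {G : SimpleGraph V} {s : Set V} {a b : V} (h : G.Adj a b) (ha : a ∈ s)
    (hb : b ∈ s) : (G.within s).Reachable a b :=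
  Adj.reachable (show (G.within s).Adj a b from ⟨h, ha, hb⟩)

theorem within_le (G : SimpleGraph V) (s : Set V) : G.within s ≤ G := fun _ _ h => h.1

theorem within_mono {G H : SimpleGraph V} {s t : Set V} (h : G ≤ H) (hst : s ⊆ t) :
    G.within s ≤ H.within t := fun _ _ hab => ⟨h hab.1, hst hab.2.1, hst hab.2.2⟩

/-- A relation that is reflexive and transitive and contains adjacency contains reachability. -/
theorem Reachable.induction_on' {G : SimpleGraph V} {r : V → V → Prop} (hrefl : ∀ a, r a a)
    (htrans : ∀ a b c, r a b → r b c → r a c) (hadj : ∀ a b, G.Adj a b → r a b) {a b : V}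
    (h : G.Reachable a b) : r a b := by
  obtain ⟨p⟩ := h
  induction p with
  | nil => exact hrefl _
  | cons h p ih => exact htrans _ _ _ (hadj _ _ h) ih

theorem Reachable.of_adj {G H : SimpleGraph V} (hadj : ∀ a b, G.Adj a b → H.Reachable a b) {a b : V}
    (h : G.Reachable a b) : H.Reachable a b :=
  h.induction_on' (fun _ => Reachable.rfl) (fun _ _ _ => Reachable.trans) hadj

/-- A set that is closed under adjacency is closed under reachability. -/
theorem Reachable.mem_of_closed {G : SimpleGraph V} {s : Set V}
    (hs : ∀ a b, G.Adj a b → a ∈ s → b ∈ s) {a b : V} (h : G.Reachable a b) (ha : a ∈ s) : b ∈ s :=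
  h.induction_on' (r := fun a b => a ∈ s → b ∈ s) (fun _ => id)
    (fun _ _ _ h₁ h₂ h => h₂ (h₁ h)) hs ha

theorem Reachable.mem_within {G : SimpleGraph V} {s : Set V} {a b : V}
    (h : (G.within s).Reachable a b) (ha : a ∈ s) : b ∈ s :=
  h.mem_of_closed (s := s) (fun _ _ (h : (G.within s).Adj _ _) _ => h.2.2) ha

/-- A path that starts in a set closed under adjacency runs inside this set. -/
theorem Reachable.within_of_closed {G : SimpleGraph V} {s : Set V}
    (hs : ∀ a b, G.Adj a b → a ∈ s → b ∈ s) {a b : V} (h : G.Reachable a b) (ha : a ∈ s) :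
    (G.within s).Reachable a b := by
  have := h.induction_on' (r := fun a b => a ∈ s → b ∈ s ∧ (G.within s).Reachable a b)
    (fun _ h => ⟨h, Reachable.rfl⟩)
    (fun _ _ _ h₁ h₂ h => ⟨(h₂ (h₁ h).1).1, (h₁ h).2.trans (h₂ (h₁ h).1).2⟩)
    (fun a b hab ha => ⟨hs a b hab ha, Adj.reachable ⟨hab, ha, hs a b hab ha⟩⟩)
  exact (this ha).2

theorem Walk.reachable_of_adj {G H : SimpleGraph V} {a b : V} (p : G.Walk a b)
    (hadj : ∀ x y, s(x, y) ∈ p.edges → H.Reachable x y) : H.Reachable a b := by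
  induction p with
  | nil => exact Reachable.rfl
  | cons h p ih =>
    refine (hadj _ _ (by simp)).trans (ih fun x y hxy => hadj x y ?_)
    simp [hxy]

theorem deg_mono [Finite V] {G H : SimpleGraph V} (h : G ≤ H) (v : V) : G.deg v ≤ H.deg v :=
  Set.ncard_le_ncard (fun _ hw => h hw) (Set.toFinite _)

theorem deg_sup_le (G H : SimpleGraph V) (v : V) : (G ⊔ H).deg v ≤ G.deg v + H.deg v := by
  have : (G ⊔ H).neighborSet v = G.neighborSet v ∪ H.neighborSet v := by
    ext; simp
  rw [deg, this]
  exact Set.ncard_union_le _ _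

theorem deg_eq_zero {G : SimpleGraph V} {v : V} (h : ∀ w, ¬ G.Adj v w) : G.deg v = 0 := by
  have : G.neighborSet v = ∅ := by ext w; simp [h w]
  rw [deg, this, Set.ncard_empty]

theorem deg_lt_of_le [Finite V] {G H : SimpleGraph V} (h : G ≤ H) {v w : V} (hH : H.Adj v w)
    (hG : ¬ G.Adj v w) : G.deg v < H.deg v :=
  Set.ncard_lt_ncard ⟨fun _ hw => h hw, fun hh => hG (hh hH)⟩ (Set.toFinite _)

/-- The edges of a walk, as a graph on all vertices. -/
def Walk.trace {G : SimpleGraph V} {a b : V} (p : G.Walk a b) : SimpleGraph V :=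
  p.toSubgraph.spanningCoe

section trace

variable {G : SimpleGraph V} {a b : V} (p : G.Walk a b)

theorem Walk.trace_adj {x y : V} : p.trace.Adj x y ↔ s(x, y) ∈ p.edges := by
  simp [Walk.trace, Walk.adj_toSubgraph_iff_mem_edges]

theorem Walk.trace_le : p.trace ≤ G := fun _ _ h => p.adj_of_mem_edges ((p.trace_adj).1 h)

theorem Walk.mem_support_of_trace_adj {x y : V} (h : p.trace.Adj x y) : x ∈ p.support :=
  p.fst_mem_support_of_mem_edges ((p.trace_adj).1 h)

theorem Walk.trace_reachable {x : V} (hx : x ∈ p.support) : p.trace.Reachable x b := by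
  induction p generalizing x with
  | nil => simp at hx; subst hx; exact Reachable.rfl
  | @cons u v w h p ih =>
    have hle : p.trace ≤ (Walk.cons h p).trace := fun x y hxy => by
      rw [Walk.trace_adj] at *; simp [hxy]
    have hadj : (Walk.cons h p).trace.Adj u v := by rw [Walk.trace_adj]; simp
    rcases List.mem_cons.1 (by simpa using hx) with rfl | hx
    · exact hadj.reachable.trans ((ih p.start_mem_support).mono hle)
    · exact (ih hx).mono hle

open Classical in
theorem Walk.deg_trace_le {p : G.Walk a b} (hp : p.IsPath) (x : V) :
    p.trace.deg x ≤ if x = a ∨ x = b then 1 else 2 := by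
  have hset : p.trace.neighborSet x = p.toSubgraph.neighborSet x := rfl
  rw [deg, hset]
  by_cases hx : x ∈ p.support
  swap
  · have : p.toSubgraph.neighborSet x = ∅ := by
      ext y
      simp only [Subgraph.mem_neighborSet, Set.mem_empty_iff_false, iff_false]
      exact fun h => hx ((Walk.mem_verts_toSubgraph p).1 (p.toSubgraph.edge_vert h))
    rw [this, Set.ncard_empty]; exact Nat.zero_le _
  by_cases hn : p.Nil
  · cases p with
    | nil =>
      have : (Walk.nil : G.Walk a a).toSubgraph.neighborSet x = ∅ := by
        ext y; simp
      rw [this, Set.ncard_empty]; exact Nat.zero_le _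
    | cons h p => simp at hn
  split_ifs with h
  · rcases h with rfl | rfl
    · rw [hp.neighborSet_toSubgraph_startpoint hn, Set.ncard_singleton]
    · rw [hp.neighborSet_toSubgraph_endpoint hn, Set.ncard_singleton]
  · push Not at h
    obtain ⟨n, hn', hl⟩ := Walk.mem_support_iff_exists_getVert.1 hx
    subst hn'
    rw [hp.ncard_neighborSet_toSubgraph_internal_eq_two]
    · rintro rfl; simp at h
    · rcases hl.lt_or_eq with h' | rfl
      · exact h'
      · simp at h

/-- Hanging a path onto an acyclic graph at the end of the path keeps it acyclic. -/
theorem Walk.isAcyclic_sup_trace {p : G.Walk a b} (hp : p.IsPath) {T : SimpleGraph V} {W : Set V}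
    (hT : T.IsAcyclic) (hW : ∀ x y, T.Adj x y → x ∈ W) (hpW : ∀ x ∈ p.support, x ∈ W → x = b) :
    (T ⊔ p.trace).IsAcyclic := by
  induction p with
  | nil =>
    refine hT.anti ?_
    refine sup_le le_rfl fun x y h => ?_
    rw [Walk.trace_adj] at h; simp at h
  | @cons u v w h p ih =>
    rw [Walk.cons_isPath_iff] at hp
    have ih := ih hp.1 fun x hx hxW => hpW x (by simp [hx]) hxW
    have huw : u ≠ w := fun e => hp.2 (e ▸ p.end_mem_support)
    have huW : u ∉ W := fun hu => huw (hpW u (by simp) hu)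
    have hiso : ∀ y, ¬ (T ⊔ p.trace).Adj u y := by
      rintro y (hy | hy)
      · exact huW (hW _ _ hy)
      · exact hp.2 (p.mem_support_of_trace_adj hy)
    have hnr : ¬ (T ⊔ p.trace).Reachable u v := fun hr => by
      have := hr.mem_of_closed (s := {u}) (fun a b hab ha => by
        rw [Set.mem_singleton_iff] at ha; subst ha; exact absurd hab (hiso b)) rfl
      exact h.ne this.symm
    refine (ih.sup_edge_of_not_reachable hnr).anti ?_
    refine sup_le (le_sup_left.trans le_sup_left) fun x y hxy => ?_
    rw [Walk.trace_adj, Walk.edges_cons, List.mem_cons] at hxy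
    rcases hxy with hxy | hxy
    · refine Or.inr ?_
      rw [edge_adj]
      have : x ≠ y := by 
        rintro rfl
        rcases Sym2.eq_iff.1 hxy with ⟨h1, h2⟩ | ⟨h1, h2⟩
        · exact h.ne (h1.symm.trans h2)
        · exact h.ne (h2.symm.trans h1)
      simp at hxy
      rcases hxy with ⟨rfl, rfl⟩ | ⟨rfl, rfl⟩ <;> simp [this]
    · exact Or.inl (Or.inr ((p.trace_adj).2 hxy))

end trace

/-- `R` meets every connected component of `G` at most once. -/
def Scattered (G : SimpleGraph V) (R : Set V) : Prop :=
  ∀ a ∈ R, ∀ b ∈ R, G.Reachable a b → a = b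

theorem Scattered.anti {G H : SimpleGraph V} {R Q : Set V} (h : H.Scattered R) (hGH : G ≤ H)
    (hQ : Q ⊆ R) : G.Scattered Q :=
  fun a ha b hb hab => h a (hQ ha) b (hQ hb) (hab.mono hGH)

/-! ### Reachability inside a vertex set and induced subgraphs -/

theorem reachable_induce_iff {G : SimpleGraph V} {s : Set V} {a b : V} (ha : a ∈ s) (hb : b ∈ s) :
    (G.induce s).Reachable ⟨a, ha⟩ ⟨b, hb⟩ ↔ (G.within s).Reachable a b := by
  constructor
  · intro h
    exact h.map (⟨Subtype.val, fun {x y} hxy => ⟨hxy, x.2, y.2⟩⟩ : G.induce s →g G.within s)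
  · intro h
    have := h.induction_on'
      (r := fun a b => ∀ ha : a ∈ s, ∃ hb : b ∈ s, (G.induce s).Reachable ⟨a, ha⟩ ⟨b, hb⟩)
      (fun _ ha => ⟨ha, Reachable.rfl⟩)
      (fun _ _ _ h₁ h₂ ha => by
        obtain ⟨hb, h₁⟩ := h₁ ha
        obtain ⟨hc, h₂⟩ := h₂ hb
        exact ⟨hc, h₁.trans h₂⟩)
      (fun a b (hab : (G.within s).Adj a b) ha => ⟨hab.2.2, Adj.reachable (by simpa using hab.1)⟩)
    exact (this ha).2

theorem connected_induce_iff_within {G : SimpleGraph V} {s : Set V} :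
    (G.induce s).Connected ↔ s.Nonempty ∧ ∀ a ∈ s, ∀ b ∈ s, (G.within s).Reachable a b := by
  constructor
  · intro h
    obtain ⟨x⟩ := h.nonempty
    exact ⟨⟨x, x.2⟩, fun a ha b hb => (reachable_induce_iff ha hb).1 (h.preconnected _ _)⟩
  · rintro ⟨⟨x, hx⟩, h⟩
    have : Nonempty s := ⟨⟨x, hx⟩⟩
    exact Connected.mk fun a b => (reachable_induce_iff a.2 b.2).2 (h a a.2 b b.2)

theorem within_univ (G : SimpleGraph V) : G.within Set.univ = G := by
  ext a b; simp [within_adj]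

theorem within_within (G : SimpleGraph V) (s t : Set V) :
    (G.within s).within t = G.within (s ∩ t) := by
  ext a b; simp only [within_adj, Set.mem_inter_iff]; tauto

/-! ### Degree sums of trees -/

theorem deg_induce {T : SimpleGraph V} {c : Set V} (v : c) :
    (T.induce c).deg v = (T.within c).deg v := by
  have : (T.within c).neighborSet v = Subtype.val '' (T.induce c).neighborSet v := by
    ext x
    simp only [mem_neighborSet, within_adj, Set.mem_image, Subtype.exists, comap_adj,
      Function.Embedding.subtype_apply, exists_and_right, exists_eq_right]
    exact ⟨fun h => ⟨h.2.2, h.1⟩, fun ⟨h, h'⟩ => ⟨h', v.2, h⟩⟩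
  rw [deg, deg, this, Set.ncard_image_of_injective _ Subtype.val_injective]

theorem sum_deg [Fintype V] (G : SimpleGraph V) : ∑ v, G.deg v = 2 * Nat.card G.edgeSet := by
  classical
  rw [Nat.card_eq_fintype_card, ← edgeFinset_card, ← sum_degrees_eq_twice_card_edges]
  refine Finset.sum_congr rfl fun v _ => ?_
  rw [deg, ← card_neighborSet_eq_degree, ← Nat.card_eq_fintype_card, Nat.card_coe_set_eq]

theorem sum_deg_within (T : SimpleGraph V) (c : Finset V) :
    ∑ v ∈ c, (T.within c).deg v = 2 * Nat.card (T.induce (c : Set V)).edgeSet := by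
  have := sum_deg (T.induce (c : Set V))
  rw [← this, ← Finset.sum_coe_sort]
  exact Finset.sum_congr rfl fun v _ => (deg_induce (c := (c : Set V)) v).symm

theorem two_mul_card_le_sum_deg {T : SimpleGraph V} {c : Finset V} (hc : c.Nonempty)
    (h : ∀ a ∈ c, ∀ b ∈ c, (T.within c).Reachable a b) :
    2 * c.card ≤ ∑ v ∈ c, (T.within c).deg v + 2 := by
  have hconn : (T.induce (c : Set V)).Connected := connected_induce_iff_within.2 ⟨by simpa using hc, h⟩
  have := hconn.card_vert_le_card_edgeSet_add_one
  rw [sum_deg_within]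
  rw [Nat.card_coe_set_eq, Set.ncard_coe_finset] at this
  omega

theorem sum_deg_add_two_le {T : SimpleGraph V} {W : Finset V} (hW : W.Nonempty)
    (hT : ∀ a b, T.Adj a b → a ∈ W) (hac : T.IsAcyclic) (hc : ∀ a ∈ W, ∀ b ∈ W, T.Reachable a b) :
    ∑ v ∈ W, T.deg v + 2 ≤ 2 * W.card := by
  classical
  have hTW : T.within W = T := by
    ext a b
    exact ⟨fun h => h.1, fun h => ⟨h, hT _ _ h, hT _ _ h.symm⟩⟩
  have hconn : (T.induce (W : Set V)).Connected :=
    connected_induce_iff_within.2 ⟨by simpa using hW, by rw [hTW]; exact hc⟩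
  have htree : (T.induce (W : Set V)).IsTree := ⟨hconn, hac.induce _⟩
  have h1 := htree.card_edgeFinset
  have h2 := sum_deg_within T W
  rw [hTW] at h2
  rw [h2, Nat.card_eq_fintype_card, ← edgeFinset_card]
  simp only [Finset.coe_sort_coe, Fintype.card_coe] at h1
  omega

theorem sum_deg_within_add_card_le [Finite V] {T : SimpleGraph V} {c : Finset V} {E : Finset (V × V)}
    (hE : ∀ e ∈ E, e.1 ∈ c ∧ e.2 ∉ c ∧ T.Adj e.1 e.2) :
    ∑ v ∈ c, (T.within c).deg v + E.card ≤ ∑ v ∈ c, T.deg v := by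
  classical
  rw [Finset.card_eq_sum_card_fiberwise (f := Prod.fst) (t := c) fun e he => (hE e he).1,
    ← Finset.sum_add_distrib]
  refine Finset.sum_le_sum fun v _ => ?_
  have hmem : ∀ x, x ∈ (E.filter fun e => e.1 = v).image Prod.snd ↔ (v, x) ∈ E := fun x => by
    simp only [Finset.mem_image, Finset.mem_filter, Prod.exists, exists_eq_right]
  have himg : (E.filter fun e => e.1 = v).card
      = (((E.filter fun e => e.1 = v).image Prod.snd : Finset V) : Set V).ncard := by
    rw [Set.ncard_coe_finset, Finset.card_image_of_injOn]
    rintro ⟨a, b⟩ ha ⟨a', b'⟩ ha' h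
    rw [Finset.mem_coe, Finset.mem_filter] at ha ha'
    exact Prod.ext (ha.2.trans ha'.2.symm) h
  rw [himg, deg, deg, ← Set.ncard_union_eq _ (Set.toFinite _) (Set.toFinite _)]
  · refine Set.ncard_le_ncard ?_ (Set.toFinite _)
    rintro x (hx | hx)
    · exact hx.1
    · exact (hE _ ((hmem x).1 hx)).2.2
  · rw [Set.disjoint_left]
    intro x hx hx'
    exact (hE _ ((hmem x).1 hx')).2.1 hx.2.2

/-- The pieces into which a set `B` of vertices of degree at least `k` cuts a tree: if every piece
that misses the terminals `U` has two edges to `B`, then more than `(k - 2) |B|` pieces contain a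
terminal. -/
theorem exists_scattered_of_tree [Fintype V] {T : SimpleGraph V} {W M U : Set V} {k : ℕ}
    (hT : ∀ a b, T.Adj a b → a ∈ W) (hac : T.IsAcyclic) (hconn : ∀ a ∈ W, ∀ b ∈ W, T.Reachable a b)
    (hMW : M ⊆ W) (hB : (W \ M).Nonempty) (hk : ∀ b ∈ W \ M, k ≤ T.deg b) (h2k : 2 ≤ k)
    (hprune : ∀ x ∈ M, (∀ u ∈ U ∩ M, ¬ (T.within M).Reachable x u) → ∃ z b z' b',
      (T.within M).Reachable x z ∧ (T.within M).Reachable x z' ∧ b ∉ M ∧ b' ∉ M ∧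
      T.Adj z b ∧ T.Adj z' b' ∧ (z, b) ≠ (z', b')) :
    ∃ R : Finset V, (R : Set V) ⊆ U ∩ M ∧ (T.within M).Scattered R ∧
      (k - 2) * (W \ M).ncard + 2 ≤ R.card := by
  classical
  have : Nonempty V := ⟨hB.some⟩
  let κ : V → (T.within M).ConnectedComponent := (T.within M).connectedComponentMk
  let Mf : Finset V := M.toFinset
  let Bf : Finset V := (W \ M).toFinset
  have hMf : ∀ x, x ∈ Mf ↔ x ∈ M := fun x => Set.mem_toFinset
  have hBf : ∀ x, x ∈ Bf ↔ x ∈ W \ M := fun x => Set.mem_toFinset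
  let 𝒞 := Mf.image κ
  let 𝒰 := (U ∩ M).toFinset.image κ
  have h𝒰 : 𝒰 ⊆ 𝒞 := Finset.image_subset_image fun x hx => by
    rw [hMf]; rw [Set.mem_toFinset] at hx; exact hx.2
  -- a system of representatives
  have hrep : ∀ c ∈ 𝒰, ∃ u ∈ U ∩ M, κ u = c := fun c hc => by
    obtain ⟨u, hu, rfl⟩ := Finset.mem_image.1 hc
    exact ⟨u, Set.mem_toFinset.1 hu, rfl⟩
  choose! r hrU hrκ using hrep
  refine ⟨𝒰.image r, ?_, ?_, ?_⟩
  · intro x hx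
    obtain ⟨c, hc, rfl⟩ := Finset.mem_image.1 (Finset.mem_coe.1 hx)
    exact hrU c hc
  · intro a ha b hb hab
    obtain ⟨c, hc, rfl⟩ := Finset.mem_image.1 (Finset.mem_coe.1 ha)
    obtain ⟨d, hd, rfl⟩ := Finset.mem_image.1 (Finset.mem_coe.1 hb)
    have : κ (r c) = κ (r d) := ConnectedComponent.eq.2 hab
    rw [hrκ c hc, hrκ d hd] at this
    rw [this]
  have hcard : (𝒰.image r).card = 𝒰.card :=
    Finset.card_image_of_injOn fun c hc d hd h => by
      have := congrArg κ h
      rwa [hrκ c hc, hrκ d hd] at this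
  rw [hcard, Set.ncard_eq_toFinset_card']
  change (k - 2) * Bf.card + 2 ≤ _
  -- the degree sum over one piece
  have hpiece : ∀ c ∈ 𝒞, 2 * (Mf.filter fun v => κ v = c).card + (if c ∈ 𝒰 then 0 else 1) ≤
      ∑ v ∈ Mf.filter (fun v => κ v = c), T.deg v + 1 := by
    intro c hc
    obtain ⟨x, hx, rfl⟩ := Finset.mem_image.1 hc
    rw [hMf] at hx
    set P := Mf.filter fun v => κ v = κ x with hP
    have hmem : ∀ y, y ∈ P ↔ (T.within M).Reachable x y := fun y => by
      rw [hP, Finset.mem_filter, hMf]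
      constructor
      · exact fun h => (ConnectedComponent.eq.1 h.2).symm
      · exact fun h => ⟨h.mem_within hx, ConnectedComponent.eq.2 h.symm⟩
    have hclosed : ∀ a b, (T.within M).Adj a b → a ∈ (P : Set V) → b ∈ (P : Set V) :=
      fun a b hab ha => by
        rw [Finset.mem_coe, hmem] at *
        exact ha.trans hab.reachable
    have hPconn : ∀ a ∈ P, ∀ b ∈ P, (T.within P).Reachable a b := fun a ha b hb => by
      have h1 : (T.within M).Reachable a b := ((hmem a).1 ha).symm.trans ((hmem b).1 hb)
      have := h1.within_of_closed hclosed ha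
      rw [within_within] at this
      exact this.mono (within_mono le_rfl Set.inter_subset_right)
    have hsum := two_mul_card_le_sum_deg ⟨x, (hmem x).2 Reachable.rfl⟩ hPconn
    have hout : ∀ z b, (T.within M).Reachable x z → b ∉ M → (z, b).1 ∈ P ∧ (z, b).2 ∉ P :=
      fun z b hz hb => ⟨(hmem z).2 hz, fun h => hb (((hmem b).1 h).mem_within hx)⟩
    split_ifs with hcU
    · -- some edge leaves the piece, because the tree is connected
      obtain ⟨b, hb⟩ := hB
      have : ∃ z y, z ∈ P ∧ y ∉ P ∧ T.Adj z y := by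
        by_contra hno
        push Not at hno
        have := (hconn x (hMW hx) b hb.1).mem_of_closed (s := (P : Set V))
          (fun a y hay ha => by
            by_contra hy
            exact hno a y ha hy hay) ((hmem x).2 Reachable.rfl)
        exact hb.2 (((hmem b).1 this).mem_within hx)
      obtain ⟨z, y, hz, hy, hzy⟩ := this
      have := sum_deg_within_add_card_le (T := T) (c := P) (E := {(z, y)}) (by
        intro e he; rw [Finset.mem_singleton] at he; subst he; exact ⟨hz, hy, hzy⟩)
      rw [Finset.card_singleton] at this
      omega
    · obtain ⟨z, b, z', b', hz, hz', hb, hb', hzb, hzb', hne⟩ := hprune x hx (fun u hu hxu => hcU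
        (Finset.mem_image.2 ⟨u, Set.mem_toFinset.2 hu, (ConnectedComponent.eq.2 hxu).symm⟩))
      have := sum_deg_within_add_card_le (T := T) (c := P) (E := {(z, b), (z', b')}) (by
        intro e he
        rw [Finset.mem_insert, Finset.mem_singleton] at he
        rcases he with rfl | rfl
        · exact ⟨(hout z b hz hb).1, (hout z b hz hb).2, hzb⟩
        · exact ⟨(hout z' b' hz' hb').1, (hout z' b' hz' hb').2, hzb'⟩)
      rw [Finset.card_pair hne] at this
      omega
  have hsumM := Finset.sum_le_sum hpiece
  have hmaps : ∀ v ∈ Mf, κ v ∈ 𝒞 := fun v hv => Finset.mem_image_of_mem _ hv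
  rw [Finset.sum_add_distrib, Finset.sum_add_distrib, Finset.sum_fiberwise_of_maps_to hmaps,
    ← Finset.mul_sum, ← Finset.card_eq_sum_card_fiberwise hmaps, Finset.sum_const, smul_eq_mul,
    mul_one] at hsumM
  have hcount : 𝒰.card + ∑ c ∈ 𝒞, (if c ∈ 𝒰 then 0 else 1) = 𝒞.card := by
    have : ∑ c ∈ 𝒞, (if c ∈ 𝒰 then 0 else 1) = (𝒞 \ 𝒰).card := by
      rw [Finset.card_eq_sum_ones, Finset.sdiff_eq_filter, Finset.sum_filter]
      exact Finset.sum_congr rfl fun c _ => by split_ifs <;> simp_all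
    rw [this, Finset.card_sdiff_of_subset h𝒰]
    exact Nat.add_sub_cancel' (Finset.card_le_card h𝒰)
  have hsumB : Bf.card * k ≤ ∑ v ∈ Bf, T.deg v := by
    rw [← smul_eq_mul]
    exact Finset.card_nsmul_le_sum _ _ _ fun b hb => hk b ((hBf b).1 hb)
  have hdisj : Disjoint Mf Bf := Finset.disjoint_left.2 fun x hx hx' =>
    ((hBf x).1 hx').2 ((hMf x).1 hx)
  have hW : Mf ∪ Bf = W.toFinset := by
    ext x
    rw [Finset.mem_union, hMf, hBf, Set.mem_toFinset]
    by_cases hx : x ∈ M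
    · simp [hx, hMW hx]
    · simp [hx]
  have hall := sum_deg_add_two_le (T := T) (W := Mf ∪ Bf)
    (by rw [hW]; obtain ⟨b, hb⟩ := hB; exact ⟨b, Set.mem_toFinset.2 hb.1⟩)
    (by intro a b hab; rw [hW, Set.mem_toFinset]; exact hT a b hab) hac
    (by intro a ha b hb; rw [hW, Set.mem_toFinset] at *; exact hconn a ha b hb)
  rw [Finset.sum_union hdisj, Finset.card_union_of_disjoint hdisj] at hall
  obtain ⟨j, rfl⟩ := Nat.exists_eq_add_of_le h2k
  rw [Nat.add_sub_cancel_left]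
  nlinarith

/-! ### Rewiring a graph inside a vertex set -/

/-- `T'` arises from `T` by exchanging edges inside `M`, without changing which vertices of `M` are
joined inside `M`. -/
structure Rewires (T T' : SimpleGraph V) (M : Set V) : Prop where
  adj : ∀ a b, ¬(a ∈ M ∧ b ∈ M) → (T'.Adj a b ↔ T.Adj a b)
  reach : ∀ a b, (T'.within M).Reachable a b ↔ (T.within M).Reachable a b

namespace Rewires

variable {T T' : SimpleGraph V} {M M' : Set V}

theorem refl (T : SimpleGraph V) (M : Set V) : Rewires T T M :=
  ⟨fun _ _ _ => Iff.rfl, fun _ _ => Iff.rfl⟩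

theorem symm (h : Rewires T T' M) : Rewires T' T M :=
  ⟨fun a b hab => (h.adj a b hab).symm, fun a b => (h.reach a b).symm⟩

theorem reachable_of_adj (h : Rewires T T' M) (hM : M ⊆ M') {H : SimpleGraph V}
    (hH : ∀ a b, a ∈ M' → b ∈ M' → T'.Adj a b → H.Reachable a b) {a b : V} (ha : a ∈ M')
    (hb : b ∈ M') (hab : T.Adj a b) : H.Reachable a b := by
  by_cases hm : a ∈ M ∧ b ∈ M
  · have h1 : (T.within M).Adj a b := ⟨hab, hm⟩
    exact ((h.reach a b).2 h1.reachable).of_adj fun x y (hxy : (T'.within M).Adj x y) =>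
      hH x y (hM hxy.2.1) (hM hxy.2.2) hxy.1
  · exact hH a b ha hb ((h.adj a b hm).2 hab)

theorem of_reachable (hadj : ∀ a b, ¬(a ∈ M ∧ b ∈ M) → (T'.Adj a b ↔ T.Adj a b))
    (h1 : ∀ a b, a ∈ M → b ∈ M → T.Adj a b → (T'.within M).Reachable a b)
    (h2 : ∀ a b, a ∈ M → b ∈ M → T'.Adj a b → (T.within M).Reachable a b) : Rewires T T' M :=
  ⟨hadj, fun _ _ =>
    ⟨fun h => h.of_adj fun x y (hxy : (T'.within M).Adj x y) => h2 x y hxy.2.1 hxy.2.2 hxy.1,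
     fun h => h.of_adj fun x y (hxy : (T.within M).Adj x y) => h1 x y hxy.2.1 hxy.2.2 hxy.1⟩⟩

theorem mono (h : Rewires T T' M) (hM : M ⊆ M') : Rewires T T' M' :=
  of_reachable (fun a b hab => h.adj a b fun hm => hab ⟨hM hm.1, hM hm.2⟩)
    (fun _ _ ha hb hab => h.reachable_of_adj hM
      (fun _ _ hx hy hxy => hxy.reachable_within hx hy) ha hb hab)
    (fun _ _ ha hb hab => h.symm.reachable_of_adj hM
      (fun _ _ hx hy hxy => hxy.reachable_within hx hy) ha hb hab)

/-- Changing both graphs of a rewiring inside a set `C` that stays connected in both of them. -/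
theorem of_connected (h : Rewires T T' M) (hM : M ⊆ M') {C : Set V} (hC : C ⊆ M')
    {T₁ T₂ : SimpleGraph V} (h₁ : ∀ a b, ¬(a ∈ C ∧ b ∈ C) → (T₁.Adj a b ↔ T.Adj a b))
    (h₂ : ∀ a b, ¬(a ∈ C ∧ b ∈ C) → (T₂.Adj a b ↔ T'.Adj a b)) {r : V}
    (hC₁ : ∀ a ∈ C, (T₁.within M').Reachable a r)
    (hC₂ : ∀ a ∈ C, (T₂.within M').Reachable a r) : Rewires T₁ T₂ M' := by
  have aux : ∀ {T T' T₁ T₂ : SimpleGraph V}, Rewires T T' M →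
      (∀ a b, ¬(a ∈ C ∧ b ∈ C) → (T₁.Adj a b ↔ T.Adj a b)) →
      (∀ a b, ¬(a ∈ C ∧ b ∈ C) → (T₂.Adj a b ↔ T'.Adj a b)) →
      (∀ a ∈ C, (T₂.within M').Reachable a r) →
      ∀ a b, a ∈ M' → b ∈ M' → T₁.Adj a b → (T₂.within M').Reachable a b := by
    intro T T' T₁ T₂ h h₁ h₂ hC₂ a b ha hb hab
    by_cases hc : a ∈ C ∧ b ∈ C
    · exact (hC₂ a hc.1).trans (hC₂ b hc.2).symm
    · refine h.reachable_of_adj hM (fun x y hx hy hxy => ?_) ha hb ((h₁ a b hc).1 hab)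
      by_cases hc : x ∈ C ∧ y ∈ C
      · exact (hC₂ x hc.1).trans (hC₂ y hc.2).symm
      · exact Adj.reachable ⟨(h₂ x y hc).2 hxy, hx, hy⟩
  refine of_reachable (fun a b hab => ?_) (aux h h₁ h₂ hC₂) (aux h.symm h₂ h₁ hC₁)
  have hc : ¬(a ∈ C ∧ b ∈ C) := fun hc => hab ⟨hC hc.1, hC hc.2⟩
  rw [h₁ a b hc, h₂ a b hc]
  exact h.adj a b fun hm => hab ⟨hM hm.1, hM hm.2⟩

theorem deg_eq (h : Rewires T T' M) {v : V} (hv : v ∉ M) : T'.deg v = T.deg v := by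
  have : T'.neighborSet v = T.neighborSet v := by
    ext w
    exact h.adj v w fun hm => hv hm.1
  rw [deg, deg, this]

end Rewires

/-! ### Ears -/

/-- `E` is a path on `D` and one more vertex `r`, which is an end of the path. -/
structure IsPendant (G : SimpleGraph V) (D : Set V) (r : V) (E : SimpleGraph V) : Prop where
  le : E ≤ G
  mem : ∀ a b, E.Adj a b → a ∈ insert r D
  reach : ∀ x ∈ D, E.Reachable x r
  deg_le : ∀ x, E.deg x ≤ 2
  deg_root : E.deg r ≤ 1

/-- The interior vertices of a path. -/
def Walk.interior {G : SimpleGraph V} {u v : V} (Q : G.Walk u v) : Set V :=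
  {x | x ∈ Q.support ∧ x ≠ u ∧ x ≠ v}

theorem Walk.IsPath.deg_trace_le_two {G : SimpleGraph V} {u v : V} {Q : G.Walk u v} (hQ : Q.IsPath)
    (x : V) : Q.trace.deg x ≤ 2 := by
  classical
  refine (Walk.deg_trace_le hQ x).trans ?_
  split_ifs <;> omega

theorem Walk.IsPath.deg_trace_le_one {G : SimpleGraph V} {u v : V} {Q : G.Walk u v} (hQ : Q.IsPath)
    {x : V} (hx : x = u ∨ x = v) : Q.trace.deg x ≤ 1 := by
  classical
  refine (Walk.deg_trace_le hQ x).trans ?_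
  rw [if_pos hx]

theorem Walk.IsPath.exists_isPendant {G : SimpleGraph V} {u v : V} {Q : G.Walk u v} (hQ : Q.IsPath)
    (hne : u ≠ v) : ∃ E, IsPendant G Q.interior v E ∧ ∀ (T : SimpleGraph V) (W : Set V),
      T.IsAcyclic → (∀ a b, T.Adj a b → a ∈ W) → (∀ x ∈ Q.support, x ∈ W → x = u ∨ x = v) →
      (T ⊔ E).IsAcyclic := by
  cases Q with
  | nil => exact absurd rfl hne
  | cons h q =>
    rw [Walk.cons_isPath_iff] at hQ
    refine ⟨q.trace, ⟨q.trace_le, fun a b hab => ?_, fun x hx => ?_, hQ.1.deg_trace_le_two,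
      hQ.1.deg_trace_le_one (Or.inr rfl)⟩, fun T W hT hW hQW => ?_⟩
    · have ha := q.mem_support_of_trace_adj hab
      by_cases hav : a = v
      · exact Or.inl hav
      · exact Or.inr ⟨by simp [ha], fun e => hQ.2 (e ▸ ha), hav⟩
    · refine q.trace_reachable ?_
      have := hx.1
      rw [Walk.support_cons, List.mem_cons] at this
      exact this.resolve_left hx.2.1
    · refine Walk.isAcyclic_sup_trace hQ.1 hT hW fun x hx hxW => ?_
      exact (hQW x (by simp [hx]) hxW).resolve_left fun e => hQ.2 (e ▸ hx)

/-- Removing the edge of a path that leaves a given vertex. -/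
theorem Walk.IsPath.exists_deleteEdges {T : SimpleGraph V} {u v w : V} {P : T.Walk u v}
    (hP : P.IsPath) (hw : w ∈ P.support) (hne : w ≠ v) : ∃ x ∈ P.support, T.Adj w x ∧
      ∀ y ∈ P.support, (P.trace.deleteEdges {s(w, x)}).Reachable y u ∨
        (P.trace.deleteEdges {s(w, x)}).Reachable y v := by
  classical
  have hspec := P.take_spec hw
  generalize P.takeUntil w hw = P₁ at hspec
  generalize P.dropUntil w hw = P₂ at hspec
  cases P₂ with
  | nil => exact absurd rfl hne
  | @cons _ x _ h q =>
    have hnd := hP.isTrail.edges_nodup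
    rw [← hspec, Walk.edges_append, Walk.edges_cons, List.nodup_append] at hnd
    have hsub : ∀ {a b : V} (r : T.Walk a b), (∀ e ∈ r.edges, e ∈ P.edges ∧ e ≠ s(w, x)) →
        (P.trace.deleteEdges {s(w, x)}).Reachable a b := fun r hr =>
      r.reachable_of_adj fun c d hcd => Adj.reachable (by
        rw [deleteEdges_adj, Walk.trace_adj]
        exact hr _ hcd)
    refine ⟨x, by rw [← hspec]; simp [Walk.mem_support_append_iff], h, fun y hy => ?_⟩
    rw [← hspec, Walk.mem_support_append_iff, Walk.support_cons, List.mem_cons] at hy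
    have hcase : y ∈ P₁.support ∨ y ∈ q.support := by
      rcases hy with hy | rfl | hy
      · exact Or.inl hy
      · exact Or.inl P₁.end_mem_support
      · exact Or.inr hy
    rcases hcase with hy | hy
    · refine Or.inl (hsub (P₁.takeUntil y hy).reverse fun e he => ?_)
      rw [Walk.edges_reverse, List.mem_reverse] at he
      have he := P₁.edges_takeUntil_subset_edges hy he
      refine ⟨by rw [← hspec, Walk.edges_append]; exact List.mem_append_left _ he, ?_⟩
      exact hnd.2.2 e he _ (by simp)
    · refine Or.inr (hsub (q.dropUntil y hy) fun e he => ?_)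
      have he := q.edges_dropUntil_subset_edges hy he
      refine ⟨by rw [← hspec, Walk.edges_append, Walk.edges_cons]; simp [he], ?_⟩
      rintro rfl
      exact (List.nodup_cons.1 hnd.2.1).1 he

section Ear

variable {G T T₁ : SimpleGraph V} {M M' : Set V} {u v w x : V}

theorem Rewires.reachable_pendant (h : Rewires T T₁ M) (hM : M ⊆ M') (P : T.Walk u v)
    (hPM : ∀ y ∈ P.support, y ∈ M') {D : Set V} (hD : D ⊆ M') {E : SimpleGraph V}
    (hE : IsPendant G D v E) {y : V} (hy : y ∈ P.support ∨ y ∈ D) :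
    ((T₁ ⊔ E).within M').Reachable y v := by
  classical
  have hv : v ∈ M' := hPM v P.end_mem_support
  rcases hy with hy | hy
  · refine (P.dropUntil y hy).reachable_of_adj fun a b hab => ?_
    have hab := P.edges_dropUntil_subset_edges hy hab
    exact h.reachable_of_adj hM (fun x y hx hy hxy =>
        Adj.reachable_within (G := T₁ ⊔ E) (Or.inl hxy) hx hy)
      (hPM a (P.fst_mem_support_of_mem_edges hab)) (hPM b (P.snd_mem_support_of_mem_edges hab))
      (P.adj_of_mem_edges hab)
  · have hins : insert v D ⊆ M' := Set.insert_subset hv hD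
    exact (hE.reach y hy).mono fun a b hab =>
      ⟨Or.inr hab, hins (hE.mem a b hab), hins (hE.mem b a hab.symm)⟩

theorem Rewires.reachable_cycle (h : Rewires T T₁ M) (hM : M ⊆ M') (P : T.Walk u v)
    (hPM : ∀ y ∈ P.support, y ∈ M') (Q : G.Walk u v) (hQM : ∀ y ∈ Q.support, y ∈ M')
    (hw : w ∉ M)
    (hsplit : ∀ y ∈ P.support, (P.trace.deleteEdges {s(w, x)}).Reachable y u ∨
        (P.trace.deleteEdges {s(w, x)}).Reachable y v) {y : V}
    (hy : y ∈ P.support ∨ y ∈ Q.support) :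
    ((T₁.deleteEdges {s(w, x)} ⊔ Q.trace).within M').Reachable y v := by
  have hQ : ∀ y ∈ Q.support, ((T₁.deleteEdges {s(w, x)} ⊔ Q.trace).within M').Reachable y v :=
    fun y hy => (Q.trace_reachable hy).mono fun a b hab =>
      ⟨Or.inr hab, hQM a (Q.mem_support_of_trace_adj hab),
        hQM b (Q.mem_support_of_trace_adj hab.symm)⟩
  have hP : ∀ a b, (P.trace.deleteEdges {s(w, x)}).Adj a b →
      ((T₁.deleteEdges {s(w, x)} ⊔ Q.trace).within M').Reachable a b := by
    intro a b hab
    rw [deleteEdges_adj] at hab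
    have ha := hPM a (P.mem_support_of_trace_adj hab.1)
    have hb := hPM b (P.mem_support_of_trace_adj hab.1.symm)
    have hT := P.trace_le hab.1
    by_cases hm : a ∈ M ∧ b ∈ M
    · have h1 : (T.within M).Adj a b := ⟨hT, hm⟩
      refine ((h.reach a b).2 h1.reachable).mono fun c d (hcd : (T₁.within M).Adj c d) =>
        ⟨Or.inl ?_, hM hcd.2.1, hM hcd.2.2⟩
      rw [deleteEdges_adj]
      refine ⟨hcd.1, fun e => ?_⟩
      rcases Sym2.eq_iff.1 e with ⟨rfl, rfl⟩ | ⟨rfl, rfl⟩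
      · exact hw hcd.2.1
      · exact hw hcd.2.2
    · refine Adj.reachable ⟨Or.inl ?_, ha, hb⟩
      rw [deleteEdges_adj]
      exact ⟨(h.adj a b hm).2 hT, hab.2⟩
  by_cases hyQ : y ∈ Q.support
  · exact hQ y hyQ
  · rcases hsplit y (hy.resolve_right hyQ) with hr | hr
    · exact (hr.of_adj hP).trans (hQ u Q.start_mem_support)
    · exact hr.of_adj hP

end Ear

/-- The graph `T` can be rewired inside `M`, without leaving `G`, so that all degrees in `M \ S` are
at most `k`, and even less than `k` at any prescribed vertices in different components of `T[M]`. -/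
def IsLoose (G T : SimpleGraph V) (M S : Set V) (k : ℕ) : Prop :=
  ∀ F ⊆ M, (T.within M).Scattered F → ∃ T' ≤ G, Rewires T T' M ∧
    ∀ v ∈ M, v ∉ S → T'.deg v ≤ k ∧ (v ∈ F → T'.deg v + 1 ≤ k)

section Ear

variable {G T : SimpleGraph V} {W M S : Set V} {k : ℕ} {u v : V}

theorem IsPendant.deg_eq_zero {D : Set V} {r x : V} {E : SimpleGraph V} (hE : IsPendant G D r E)
    (hx : x ∉ D) (hr : x ≠ r) : E.deg x = 0 :=
  SimpleGraph.deg_eq_zero fun y hy => by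
    rcases hE.mem x y hy with h | h
    · exact hr h
    · exact hx h

/-- The degrees after rewiring `T` to `T₁` and hanging the path `E` on it at `r`, provided that `T₁`
leaves room for one more edge at `r` and at the vertices of `F` off the path. -/
theorem IsPendant.deg_sup_le [Finite V] (hk : 3 ≤ k) (hTW : ∀ a b, T.Adj a b → a ∈ W) (hMW : M ⊆ W)
    {P : T.Walk u v} (hPk : ∀ x ∈ P.support, x ∉ M → T.deg x ≤ k) {D : Set V}
    (hDW : ∀ x ∈ D, x ∉ W) {r : V} (hr : r ∈ M) {E : SimpleGraph V} (hE : IsPendant G D r E)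
    {T₁ : SimpleGraph V} (h₁ : Rewires T T₁ M) {F F₁ : Set V}
    (hdeg : ∀ x ∈ M, x ∉ S → T₁.deg x ≤ k ∧ (x ∈ F₁ → T₁.deg x + 1 ≤ k)) (hrF : r ∈ F₁)
    (hFM : ∀ x ∈ F, x ∈ M → x ∈ F₁ ∧ x ≠ r) (hFD : ∀ x ∈ F, x ∉ M → x ∈ D) {x : V}
    (hx : x ∈ M ∪ ({x | x ∈ P.support} ∪ D)) (hxS : x ∉ S) :
    (T₁ ⊔ E).deg x ≤ k ∧ (x ∈ F → (T₁ ⊔ E).deg x + 1 ≤ k) := by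
  have hsup := SimpleGraph.deg_sup_le T₁ E x
  by_cases hxM : x ∈ M
  · have hxD : x ∉ D := fun h => hDW x h (hMW hxM)
    have h1 := hdeg x hxM hxS
    by_cases hxr : x = r
    · subst hxr
      have h2 := h1.2 hrF
      have h3 := hE.deg_root
      exact ⟨by omega, fun hF => absurd rfl (hFM x hF hxM).2⟩
    · have h2 := hE.deg_eq_zero hxD hxr
      refine ⟨by omega, fun hF => ?_⟩
      have := h1.2 (hFM x hF hxM).1
      omega
  · have h1 := h₁.deg_eq hxM
    have hxr : x ≠ r := fun e => hxM (e ▸ hr)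
    by_cases hxD : x ∈ D
    · have h2 := hE.deg_le x
      have h3 : T.deg x = 0 := SimpleGraph.deg_eq_zero fun y hy => hDW x hxD (hTW x y hy)
      exact ⟨by omega, fun _ => by omega⟩
    · have hxP : x ∈ P.support := (hx.resolve_left hxM).resolve_right hxD
      have h2 := hE.deg_eq_zero hxD hxr
      have h3 := hPk x hxP hxM
      exact ⟨by omega, fun hF => absurd (hFD x hF hxM) hxD⟩

/-- Adding an ear. Let `P` be the path of `T` between two vertices `u`, `v` in different components
of `T[M]`, with all degrees at most `k` outside `M`, and `Q` a path of `G` between them whose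
interior lies off `T`. If `T` is loose on `M`, then `T` with a pendant copy of `Q` is loose on
`M ∪ P ∪ Q`: one of the edges of the cycle `P ∪ Q` can be chosen freely to be left out, so there is
slack at any one vertex of the cycle. -/
theorem IsLoose.ear [Finite V] (h : IsLoose G T M S k) (hk : 3 ≤ k)
    (hTW : ∀ a b, T.Adj a b → a ∈ W) (hMW : M ⊆ W) (hu : u ∈ M) (hv : v ∈ M)
    (hnr : ¬ (T.within M).Reachable u v) {P : T.Walk u v} (hP : P.IsPath)
    (hPk : ∀ x ∈ P.support, x ∉ M → T.deg x ≤ k) {Q : G.Walk u v} (hQ : Q.IsPath)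
    (hQW : ∀ x ∈ Q.support, x ∈ W → x = u ∨ x = v) {E : SimpleGraph V}
    (hE : IsPendant G Q.interior v E) :
    IsLoose G (T ⊔ E) (M ∪ ({x | x ∈ P.support} ∪ Q.interior)) S k := by
  have huv : u ≠ v := by rintro rfl; exact hnr Reachable.rfl
  set D := Q.interior with hD
  set C : Set V := {x | x ∈ P.support} ∪ D with hC
  set M' := M ∪ C with hM'
  have hMM : M ⊆ M' := Set.subset_union_left
  have hCM : C ⊆ M' := Set.subset_union_right
  have hPM : ∀ y ∈ P.support, y ∈ M' := fun y hy => hCM (Or.inl hy)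
  have hDM : D ⊆ M' := fun y hy => hCM (Or.inr hy)
  have hDW : ∀ x ∈ D, x ∉ W := fun x hx hxW => by
    rcases hQW x hx.1 hxW with e | e
    · exact hx.2.1 e
    · exact hx.2.2 e
  have hQC : ∀ y ∈ Q.support, y ∈ C := fun y hy => by
    by_cases h1 : y = u
    · exact Or.inl (h1 ▸ P.start_mem_support)
    by_cases h2 : y = v
    · exact Or.inl (h2 ▸ P.end_mem_support)
    · exact Or.inr ⟨hy, h1, h2⟩
  have hEC : ∀ {r : V} {E : SimpleGraph V}, r ∈ P.support → IsPendant G D r E →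
      ∀ a b, E.Adj a b → a ∈ C ∧ b ∈ C := fun {r E} hr hE a b hab => by
    have hins : insert r D ⊆ C := Set.insert_subset (Or.inl hr) Set.subset_union_right
    exact ⟨hins (hE.mem a b hab), hins (hE.mem b a hab.symm)⟩
  have hsupC : ∀ {r : V} {T E : SimpleGraph V}, r ∈ P.support → IsPendant G D r E →
      ∀ a b, ¬(a ∈ C ∧ b ∈ C) → ((T ⊔ E).Adj a b ↔ T.Adj a b) := fun hr hE a b hab =>
    ⟨fun h => h.resolve_right fun h => hab (hEC hr hE a b h), Or.inl⟩
  intro F hFM' hFs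
  have hbigC : ∀ x ∈ C, ((T ⊔ E).within M').Reachable x v := fun x hx =>
    (Rewires.refl T M).reachable_pendant hMM P hPM hDM hE hx
  have hTT : T.within M ≤ (T ⊔ E).within M' := within_mono le_sup_left hMM
  -- all but one of the prescribed vertices are outside the component of the cycle
  set F₀ : Set V := {x ∈ F | ¬ ((T ⊔ E).within M').Reachable x v} with hF₀
  have hF₀M : F₀ ⊆ M := fun x hx =>
    (hFM' hx.1).resolve_right fun hxC => hx.2 (hbigC x hxC)
  have hscat : ∀ a b, ((T ⊔ E).within M').Reachable a v → ((T ⊔ E).within M').Reachable b v →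
      (a ≠ b → ¬ (T.within M).Reachable a b) →
      (T.within M).Scattered (insert a (insert b F₀)) := by
    intro a b ha hb hab x hx y hy hxy
    have hxy' := hxy.mono hTT
    have key : ∀ {x y : V}, ((T ⊔ E).within M').Reachable x v →
        ((T ⊔ E).within M').Reachable x y → y ∉ F₀ := fun hx hxy hy => hy.2 (hxy.symm.trans hx)
    rcases hx with rfl | rfl | hx <;> rcases hy with rfl | rfl | hy
    · rfl
    · by_contra hne; exact hab hne hxy
    · exact absurd hy (key ha hxy')
    · by_contra hne; exact hab (Ne.symm hne) hxy.symm
    · rfl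
    · exact absurd hy (key hb hxy')
    · exact absurd hx (key ha hxy'.symm)
    · exact absurd hx (key hb hxy'.symm)
    · exact hFs x hx.1 y hy.1 hxy'
  have hsub : ∀ {a b : V}, a ∈ M → b ∈ M → insert a (insert b F₀) ⊆ M := fun ha hb =>
    Set.insert_subset ha (Set.insert_subset hb hF₀M)
  have hbigu := hbigC u (Or.inl P.start_mem_support)
  -- the pendant path can be kept at `v`
  have keep : ∀ a ∈ M, ((T ⊔ E).within M').Reachable a v → (a ≠ v → ¬ (T.within M).Reachable a v) →
      (∀ x ∈ F, ((T ⊔ E).within M').Reachable x v → x ∈ D ∨ x = a ∧ a ≠ v) →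
      ∃ T' ≤ G, Rewires (T ⊔ E) T' M' ∧
        ∀ x ∈ M', x ∉ S → T'.deg x ≤ k ∧ (x ∈ F → T'.deg x + 1 ≤ k) := by
    intro a ha hav hne hFa
    obtain ⟨T₁, hT₁, hrew, hdeg⟩ := h _ (hsub ha hv) (hscat a v hav Reachable.rfl hne)
    refine ⟨T₁ ⊔ E, sup_le hT₁ hE.le, hrew.of_connected hMM hCM (hsupC P.end_mem_support hE)
      (hsupC P.end_mem_support hE) hbigC fun x hx => hrew.reachable_pendant hMM P hPM hDM hE hx,
      fun x hx hxS => hE.deg_sup_le hk hTW hMW hPk hDW hv hrew hdeg (by simp) (fun x hx hxM => ?_)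
        (fun x hx hxM => ?_) hx hxS⟩
    · by_cases hxv : ((T ⊔ E).within M').Reachable x v
      · rcases hFa x hx hxv with hxD | ⟨rfl, hxv⟩
        · exact absurd (hMW hxM) (hDW x hxD)
        · exact ⟨by simp, hxv⟩
      · refine ⟨Or.inr (Or.inr ⟨hx, hxv⟩), ?_⟩
        rintro rfl
        exact hxv Reachable.rfl
    · by_cases hxv : ((T ⊔ E).within M').Reachable x v
      · rcases hFa x hx hxv with hxD | ⟨rfl, -⟩
        · exact hxD
        · exact absurd ha hxM
      · exact absurd (hF₀M ⟨hx, hxv⟩) hxM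
  by_cases hw : ∃ w ∈ F, ((T ⊔ E).within M').Reachable w v
  swap
  · push Not at hw
    exact keep v hv Reachable.rfl (fun h => absurd rfl h) fun x hx hxv => absurd hxv (hw x hx)
  obtain ⟨w, hwF, hwv⟩ := hw
  have huniq : ∀ x ∈ F, ((T ⊔ E).within M').Reachable x v → x = w := fun x hx hxv =>
    hFs x hx w hwF (hxv.trans hwv.symm)
  by_cases hwD : w ∈ D
  · exact keep v hv Reachable.rfl (fun h => absurd rfl h) fun x hx hxv =>
      Or.inl (huniq x hx hxv ▸ hwD)
  by_cases hwM : w ∈ M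
  · by_cases hwr : (T.within M).Reachable w v
    · -- the pendant path is moved to `u`
      have hwu : ¬ (T.within M).Reachable w u := fun hr => hnr (hr.symm.trans hwr)
      have hwu' : w ≠ u := by rintro rfl; exact hwu Reachable.rfl
      have hint : Q.reverse.interior = D := by
        ext x
        simp only [Walk.interior, Walk.support_reverse, List.mem_reverse, hD]
        exact ⟨fun h => ⟨h.1, h.2.2, h.2.1⟩, fun h => ⟨h.1, h.2.2, h.2.1⟩⟩
      obtain ⟨E₂, hE₂, -⟩ := hQ.reverse.exists_isPendant huv.symm
      rw [hint] at hE₂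
      obtain ⟨T₁, hT₁, hrew, hdeg⟩ := h _ (hsub hwM hu) (hscat w u hwv hbigu fun _ => hwu)
      have hE₂u : ∀ x ∈ C, ((T₁ ⊔ E₂).within M').Reachable x u := fun x hx =>
        hrew.reachable_pendant hMM P.reverse (fun y hy => hPM y (by simpa using hy)) hDM hE₂
          (hx.imp_left fun h => by simpa using h)
      refine ⟨T₁ ⊔ E₂, sup_le hT₁ hE₂.le, hrew.of_connected hMM hCM (hsupC P.end_mem_support hE)
        (hsupC P.start_mem_support hE₂) hbigC fun x hx =>
          (hE₂u x hx).trans (hE₂u v (Or.inl P.end_mem_support)).symm, fun x hx hxS =>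
        hE₂.deg_sup_le hk hTW hMW hPk hDW hu hrew hdeg (by simp) (fun x hx hxM => ?_)
        (fun x hx hxM => ?_) hx hxS⟩
      · by_cases hxv : ((T ⊔ E).within M').Reachable x v
        · obtain rfl := huniq x hx hxv
          exact ⟨by simp, hwu'⟩
        · refine ⟨Or.inr (Or.inr ⟨hx, hxv⟩), ?_⟩
          rintro rfl
          exact hxv hbigu
      · by_cases hxv : ((T ⊔ E).within M').Reachable x v
        · obtain rfl := huniq x hx hxv
          exact absurd hwM hxM
        · exact absurd (hF₀M ⟨hx, hxv⟩) hxM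
    · exact keep w hwM hwv (fun _ => hwr) fun x hx hxv => Or.inr ⟨huniq x hx hxv, by
        rintro rfl
        exact hwr Reachable.rfl⟩
  -- the cycle is opened at `w`
  have hwP : w ∈ P.support := ((hFM' hwF).resolve_left hwM).resolve_right hwD
  have hwv' : w ≠ v := fun e => hwM (e ▸ hv)
  have hwu' : w ≠ u := fun e => hwM (e ▸ hu)
  obtain ⟨x₀, hx₀P, hwx₀, hsplit⟩ := hP.exists_deleteEdges hwP hwv'
  obtain ⟨T₁, hT₁, hrew, hdeg⟩ := h _ (hsub hu hv) (hscat u v hbigu Reachable.rfl fun _ => hnr)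
  have hdel : T₁.deleteEdges {s(w, x₀)} ≤ T₁ := deleteEdges_le _
  refine ⟨T₁.deleteEdges {s(w, x₀)} ⊔ Q.trace, sup_le (hdel.trans hT₁) Q.trace_le,
    hrew.of_connected hMM hCM (hsupC P.end_mem_support hE) (fun a b hab => ?_) hbigC
      (fun x hx => hrew.reachable_cycle hMM P hPM Q (fun y hy => hCM (hQC y hy)) hwM hsplit
        (hx.imp_right fun h => h.1)), fun x hx hxS => ?_⟩
  · rw [sup_adj, deleteEdges_adj]
    constructor
    · rintro (h1 | h1)
      · exact h1.1
      · exact absurd ⟨hQC a (Q.mem_support_of_trace_adj h1),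
          hQC b (Q.mem_support_of_trace_adj h1.symm)⟩ hab
    · refine fun h1 => Or.inl ⟨h1, fun e => hab ?_⟩
      rcases Sym2.eq_iff.1 e with ⟨rfl, rfl⟩ | ⟨rfl, rfl⟩
      · exact ⟨Or.inl hwP, Or.inl hx₀P⟩
      · exact ⟨Or.inl hx₀P, Or.inl hwP⟩
  · have hsup := SimpleGraph.deg_sup_le (T₁.deleteEdges {s(w, x₀)}) Q.trace x
    have hle := deg_mono hdel x
    have hQdeg : x ∉ D → x ≠ u → x ≠ v → Q.trace.deg x = 0 := fun h1 h2 h3 =>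
      SimpleGraph.deg_eq_zero fun y hy => h1 ⟨Q.mem_support_of_trace_adj hy, h2, h3⟩
    by_cases hxM : x ∈ M
    · have hxD : x ∉ D := fun hxD => hDW x hxD (hMW hxM)
      have hd := hdeg x hxM hxS
      by_cases hxuv : x = u ∨ x = v
      · have h1 := hd.2 (by rcases hxuv with rfl | rfl <;> simp)
        have h2 := hQ.deg_trace_le_one hxuv
        refine ⟨by omega, fun hxF => ?_⟩
        have hxw : x = w := huniq x hxF (by
          rcases hxuv with rfl | rfl
          · exact hbigu
          · exact Reachable.rfl)
        exact absurd (hxw ▸ hxM) hwM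
      · push Not at hxuv
        have h2 := hQdeg hxD hxuv.1 hxuv.2
        refine ⟨by omega, fun hxF => ?_⟩
        have hxv : ¬ ((T ⊔ E).within M').Reachable x v := fun hr => hwM (huniq x hxF hr ▸ hxM)
        have := hd.2 (Or.inr (Or.inr ⟨hxF, hxv⟩))
        omega
    · have h1 := hrew.deg_eq hxM
      by_cases hxD : x ∈ D
      · have h3 : T.deg x = 0 := SimpleGraph.deg_eq_zero fun y hy => hDW x hxD (hTW x y hy)
        have h2 := hQ.deg_trace_le_two x
        exact ⟨by omega, fun _ => by omega⟩
      · have hxP : x ∈ P.support := (hx.resolve_left hxM).resolve_right hxD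
        have h2 := hQdeg hxD (fun e => hxM (e ▸ hu)) (fun e => hxM (e ▸ hv))
        have h3 := hPk x hxP hxM
        refine ⟨by omega, fun hxF => ?_⟩
        have hxw : x = w := huniq x hxF (hbigC x (Or.inl hxP))
        subst hxw
        have h4 : T₁.Adj x x₀ := (hrew.adj x x₀ fun h => hxM h.1).2 hwx₀
        have h5 := deg_lt_of_le hdel h4 (by rw [deleteEdges_adj]; simp)
        omega

end Ear

/-! ### Steiner trees of small degree and their blocking sets -/

/-- A partial solution of the degree-constrained Steiner tree problem for the terminals `U`: a tree
`T` on a set `W` that contains `U`, and a set `M` inside which `T` is loose. Only the vertices of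
`W \ M` may have too large a degree. -/
structure LooseTree (G : SimpleGraph V) (S U : Set V) (k : ℕ) where
  W : Set V
  M : Set V
  T : SimpleGraph V
  le : T ≤ G
  supp : ∀ a b, T.Adj a b → a ∈ W
  conn : ∀ a ∈ W, ∀ b ∈ W, T.Reachable a b
  acyc : T.IsAcyclic
  terminals : U ⊆ W
  sub : M ⊆ W
  exempt : S ∩ W ⊆ M
  loose : IsLoose G T M S k

namespace LooseTree

variable {G : SimpleGraph V} {S U : Set V} {k : ℕ}

section Potential

variable [Fintype V]

open Classical in
/-- The total excess of the degrees over `k` outside the loose part. -/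
noncomputable def excess (c : LooseTree G S U k) : ℕ :=
  ∑ v, if v ∈ c.W \ c.M then c.T.deg v - k else 0

/-- The excess, with the number of vertices outside the loose part to break ties. -/
noncomputable def potential (c : LooseTree G S U k) : ℕ :=
  c.excess * (Fintype.card V + 1) + (c.W \ c.M).ncard

theorem ncard_le (c : LooseTree G S U k) : (c.W \ c.M).ncard ≤ Fintype.card V := by
  rw [← Nat.card_eq_fintype_card, ← Set.ncard_univ]
  exact Set.ncard_le_ncard (Set.subset_univ _) (Set.toFinite _)

theorem potential_lt_of_excess_lt {c c' : LooseTree G S U k} (h : c'.excess < c.excess) :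
    c'.potential < c.potential := by
  have := c'.ncard_le
  unfold potential
  nlinarith

theorem potential_lt_of_ncard_lt {c c' : LooseTree G S U k} (h : c'.excess ≤ c.excess)
    (h' : (c'.W \ c'.M).ncard < (c.W \ c.M).ncard) : c'.potential < c.potential := by
  unfold potential
  nlinarith

theorem excess_le {c c' : LooseTree G S U k}
    (h : ∀ v ∈ c'.W \ c'.M, k < c'.T.deg v → v ∈ c.W \ c.M ∧ c'.T.deg v ≤ c.T.deg v) :
    c'.excess ≤ c.excess := by
  refine Finset.sum_le_sum fun v _ => ?_
  by_cases hv : v ∈ c'.W \ c'.M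
  · by_cases hk : k < c'.T.deg v
    · have := h v hv hk
      rw [if_pos hv, if_pos this.1]
      omega
    · rw [if_pos hv]; omega
  · rw [if_neg hv]; omega

theorem excess_lt {c c' : LooseTree G S U k}
    (h : ∀ v ∈ c'.W \ c'.M, k < c'.T.deg v → v ∈ c.W \ c.M ∧ c'.T.deg v ≤ c.T.deg v)
    {b : V} (hb : b ∈ c.W \ c.M) (hbk : k < c.T.deg b)
    (hb' : b ∈ c'.W \ c'.M → c'.T.deg b < c.T.deg b) :
    c'.excess < c.excess := by
  refine Finset.sum_lt_sum (fun v _ => ?_) ⟨b, Finset.mem_univ _, ?_⟩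
  · by_cases hv : v ∈ c'.W \ c'.M
    · by_cases hk : k < c'.T.deg v
      · have := h v hv hk
        rw [if_pos hv, if_pos this.1]
        omega
      · rw [if_pos hv]; omega
    · rw [if_neg hv]; omega
  · rw [if_pos hb]
    by_cases hv : b ∈ c'.W \ c'.M
    · have := hb' hv
      rw [if_pos hv]; omega
    · rw [if_neg hv]; omega

/-- A vertex of small degree can be added to the loose part. -/
theorem exists_insert (c : LooseTree G S U k) {b : V} (hb : b ∈ c.W \ c.M)
    (hk : c.T.deg b + 1 ≤ k) : ∃ c' : LooseTree G S U k, c'.potential < c.potential := by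
  have hM : c.M ⊆ insert b c.M := Set.subset_insert _ _
  refine ⟨⟨c.W, insert b c.M, c.T, c.le, c.supp, c.conn, c.acyc, c.terminals,
    Set.insert_subset hb.1 c.sub, c.exempt.trans hM, fun F hF hFs => ?_⟩,
    potential_lt_of_ncard_lt (excess_le fun v hv _ => ⟨⟨hv.1, fun h => hv.2 (hM h)⟩, le_rfl⟩) ?_⟩
  · obtain ⟨T', hT', hrew, hdeg⟩ := c.loose (F \ {b})
      (fun x hx => (hF hx.1).resolve_left hx.2)
      (hFs.anti (within_mono le_rfl hM) Set.sdiff_subset)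
    refine ⟨T', hT', hrew.mono hM, fun v hv hvS => ?_⟩
    rcases hv with rfl | hv
    · rw [hrew.deg_eq hb.2]
      exact ⟨by omega, fun _ => hk⟩
    · exact ⟨(hdeg v hv hvS).1, fun hvF => (hdeg v hv hvS).2
        ⟨hvF, fun e => hb.2 (e ▸ hv)⟩⟩
  · refine Set.ncard_lt_ncard ⟨fun x hx => ⟨hx.1, fun h => hx.2 (hM h)⟩, fun h => ?_⟩
      (Set.toFinite _)
    exact (h hb).2 (Set.mem_insert _ _)

end Potential

/-- A component of the loose part that contains no terminal and hangs on a single edge of the tree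
can be removed. -/
theorem exists_prune [Fintype V] (c : LooseTree G S U k) (hmin : ∀ c' : LooseTree G S U k,
    c.potential ≤ c'.potential) (hU : U.Nonempty) {x : V} (hx : x ∈ c.M)
    (hxU : ∀ u ∈ U ∩ c.M, ¬ (c.T.within c.M).Reachable x u) : ∃ z b z' b',
      (c.T.within c.M).Reachable x z ∧ (c.T.within c.M).Reachable x z' ∧ b ∉ c.M ∧ b' ∉ c.M ∧
      c.T.Adj z b ∧ c.T.Adj z' b' ∧ (z, b) ≠ (z', b') := by
  classical
  by_contra hno
  set p : Set V := {y | (c.T.within c.M).Reachable x y} with hp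
  have hpM : p ⊆ c.M := fun y hy => Reachable.mem_within hy hx
  have hxp : x ∈ p := Reachable.rfl
  have hUp : ∀ u ∈ U, u ∉ p := fun u hu hup => hxU u ⟨hu, hpM hup⟩ hup
  have hout : ∀ {z b}, z ∈ p → b ∉ p → c.T.Adj z b → b ∉ c.M := fun {z b} hz hb hzb hbM => by
    have h1 : (c.T.within c.M).Adj z b := ⟨hzb, hpM hz, hbM⟩
    exact hb (Reachable.trans hz h1.reachable)
  -- the only edge that leaves the component
  have hex : ∃ z b, z ∈ p ∧ b ∉ p ∧ c.T.Adj z b := by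
    by_contra hno'
    push Not at hno'
    obtain ⟨u, hu⟩ := hU
    refine hUp u hu ((c.conn x (c.sub hx) u (c.terminals hu)).mem_of_closed (fun a b hab ha => ?_)
      hxp)
    by_contra hb
    exact hno' a b ha hb hab
  obtain ⟨z, b, hz, hb, hzb⟩ := hex
  have huniq : ∀ z' b', z' ∈ p → b' ∉ p → c.T.Adj z' b' → b' = b := fun z' b' hz' hb' hzb' => by
    by_contra hne
    exact hno ⟨z, b, z', b', hz, hz', hout hz hb hzb, hout hz' hb' hzb', hzb, hzb', fun e =>
      hne (congrArg Prod.snd e).symm⟩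
  have hbM := hout hz hb hzb
  have hbW : b ∈ c.W := c.supp b z hzb.symm
  have hclosed : ∀ {H : SimpleGraph V}, Rewires c.T H c.M →
      ∀ a b, (H.within c.M).Adj a b → a ∈ pᶜ → b ∈ pᶜ := fun {H} hH a b hab ha hb' => by
    have h1 : (H.within c.M).Reachable b a := hab.symm.reachable
    exact ha (Reachable.trans hb' ((hH.reach _ _).1 h1))
  have hww : ∀ H : SimpleGraph V, (H.within pᶜ).within (c.M \ p) = H.within (c.M \ p) := fun H => by
    rw [within_within, Set.inter_eq_right.2 fun y hy => hy.2]
  have hreach : ∀ {H : SimpleGraph V}, Rewires c.T H c.M → ∀ {a b}, a ∉ p →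
      (H.within c.M).Reachable a b → (H.within (c.M \ p)).Reachable a b := fun {H} hH a b ha hab => by
    have := hab.within_of_closed (hclosed hH) ha
    rwa [within_within] at this
  let c' : LooseTree G S U k :=
    { W := c.W \ p
      M := c.M \ p
      T := c.T.within pᶜ
      le := (within_le _ _).trans c.le
      supp := fun a b hab => ⟨c.supp a b hab.1, hab.2.1⟩
      conn := fun a ha b' hb' => by
        -- retract the component to the other end of its only edge
        have := (c.conn a ha.1 b' hb'.1).induction_on'
          (r := fun y y' => (c.T.within pᶜ).Reachable (if y ∈ p then b else y)
            (if y' ∈ p then b else y'))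
          (fun _ => Reachable.rfl) (fun _ _ _ => Reachable.trans) (fun y y' hyy' => by
            split_ifs with h1 h2 h2
            · exact Reachable.rfl
            · rw [huniq y y' h1 h2 hyy']
            · rw [huniq y' y h2 h1 hyy'.symm]
            · exact hyy'.reachable_within h1 h2)
        rwa [if_neg ha.2, if_neg hb'.2] at this
      acyc := c.acyc.anti (within_le _ _)
      terminals := fun u hu => ⟨c.terminals hu, hUp u hu⟩
      sub := Set.sdiff_subset_sdiff_left c.sub
      exempt := fun y hy => ⟨c.exempt ⟨hy.1, hy.2.1⟩, hy.2.2⟩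
      loose := fun F hF hFs => by
        obtain ⟨T', hT', hrew, hdeg⟩ := c.loose F (fun y hy => (hF hy).1) (fun y hy y' hy' h => by
          refine hFs y hy y' hy' ?_
          rw [hww]
          exact hreach (Rewires.refl _ _) (hF hy).2 h)
        refine ⟨T'.within pᶜ, (within_le _ _).trans hT', Rewires.of_reachable ?_ ?_ ?_,
          fun v hv hvS => ?_⟩
        · intro a b hab
          by_cases hm : a ∈ c.M ∧ b ∈ c.M
          · rw [within_adj, within_adj]
            have : ¬ (a ∈ pᶜ ∧ b ∈ pᶜ) := fun h => hab ⟨⟨hm.1, h.1⟩, ⟨hm.2, h.2⟩⟩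
            tauto
          · rw [within_adj, within_adj, hrew.adj a b hm]
        · intro a b ha hb hab
          rw [hww]
          exact hreach hrew ha.2 ((hrew.reach a b).2 (hab.1.reachable_within ha.1 hb.1))
        · intro a b ha hb hab
          rw [hww]
          exact hreach (Rewires.refl _ _) ha.2
            ((hrew.reach a b).1 (hab.1.reachable_within ha.1 hb.1))
        · have hle := deg_mono (within_le T' pᶜ) v
          have := hdeg v hv.1 hvS
          exact ⟨by omega, fun hvF => by have := this.2 hvF; omega⟩ }
  have hdiff : c'.W \ c'.M = c.W \ c.M := by
    ext y
    simp only [c', Set.mem_sdiff]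
    have := @hpM y
    tauto
  have hle : ∀ v ∈ c'.W \ c'.M, k < c'.T.deg v → v ∈ c.W \ c.M ∧ c'.T.deg v ≤ c.T.deg v :=
    fun v hv _ => ⟨hdiff ▸ hv, deg_mono (within_le _ _) v⟩
  have hlt : c'.T.deg b < c.T.deg b :=
    deg_lt_of_le (within_le _ _) hzb.symm fun h => h.2.2 hz
  by_cases hbk : k < c.T.deg b
  · exact absurd (hmin c') (not_le.2 (potential_lt_of_excess_lt
      (excess_lt hle ⟨hbW, hbM⟩ hbk fun _ => hlt)))
  · obtain ⟨c'', hc''⟩ := c'.exists_insert (b := b) (hdiff ▸ ⟨hbW, hbM⟩) (by omega)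
    have h1 : c'.potential ≤ c.potential := by
      unfold potential
      rw [hdiff]
      have := excess_le hle
      gcongr
    exact absurd (hmin c'') (by omega)

/-- In a loose tree of least potential, no path off the tree joins two components of the loose
part. -/
theorem reachable_of_path [Fintype V] (hk : 3 ≤ k) (c : LooseTree G S U k)
    (hmin : ∀ c' : LooseTree G S U k, c.potential ≤ c'.potential) {u v : V} (hu : u ∈ c.M)
    (hv : v ∈ c.M) {Q : G.Walk u v} (hQ : Q.IsPath)
    (hQW : ∀ x ∈ Q.support, x ∈ c.W → x = u ∨ x = v) : (c.T.within c.M).Reachable u v := by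
  classical
  by_contra hnr
  have huv : u ≠ v := by rintro rfl; exact hnr Reachable.rfl
  obtain ⟨P, hP⟩ := (c.conn u (c.sub hu) v (c.sub hv)).exists_isPath
  have hPW : ∀ y ∈ P.support, y ∈ c.W := fun y hy => by
    exact ((P.takeUntil y hy).reachable).mem_of_closed (fun a b hab _ => c.supp b a hab.symm)
      (c.sub hu)
  have hDW : ∀ x ∈ Q.interior, x ∉ c.W := fun x hx hxW => by
    rcases hQW x hx.1 hxW with e | e
    · exact hx.2.1 e
    · exact hx.2.2 e
  by_cases hPk : ∀ x ∈ P.support, x ∉ c.M → c.T.deg x ≤ k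
  · -- the path can be added to the loose part
    obtain ⟨E, hE, hEac⟩ := hQ.exists_isPendant huv
    have hint : insert v Q.interior ⊆ c.W ∪ Q.interior :=
      Set.insert_subset (Or.inl (c.sub hv)) Set.subset_union_right
    have hconn : ∀ y ∈ c.W ∪ Q.interior, (c.T ⊔ E).Reachable y v := by
      rintro y (hy | hy)
      · exact (c.conn y hy v (c.sub hv)).mono le_sup_left
      · exact (hE.reach y hy).mono le_sup_right
    let c' : LooseTree G S U k :=
      { W := c.W ∪ Q.interior
        M := c.M ∪ ({x | x ∈ P.support} ∪ Q.interior)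
        T := c.T ⊔ E
        le := sup_le c.le hE.le
        supp := fun a b hab => hab.elim (fun h => Or.inl (c.supp a b h)) fun h => hint (hE.mem a b h)
        conn := fun a ha b hb => (hconn a ha).trans (hconn b hb).symm
        acyc := hEac c.T c.W c.acyc c.supp hQW
        terminals := c.terminals.trans Set.subset_union_left
        sub := Set.union_subset (c.sub.trans Set.subset_union_left)
          (Set.union_subset (fun y hy => Or.inl (hPW y hy)) Set.subset_union_right)
        exempt := fun y hy => hy.2.elim (fun h => Or.inl (c.exempt ⟨hy.1, h⟩))
          fun h => Or.inr (Or.inr h)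
        loose := c.loose.ear hk c.supp c.sub hu hv hnr hP hPk hQ hQW hE }
    have hdiff : c'.W \ c'.M ⊆ c.W \ c.M := fun y hy =>
      ⟨hy.1.resolve_right fun h => hy.2 (Or.inr (Or.inr h)), fun h => hy.2 (Or.inl h)⟩
    have hdeg : ∀ y ∈ c'.W \ c'.M, c'.T.deg y ≤ c.T.deg y := fun y hy => by
      have h1 := SimpleGraph.deg_sup_le c.T E y
      have h2 : E.deg y = 0 := hE.deg_eq_zero (fun h => hy.2 (Or.inr (Or.inr h)))
        fun e => hy.2 (Or.inl (e ▸ hv))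
      change (c.T ⊔ E).deg y ≤ _
      omega
    refine absurd (hmin c') (not_le.2 (potential_lt_of_ncard_lt
      (excess_le fun y hy _ => ⟨hdiff hy, hdeg y hy⟩)
      (Set.ncard_lt_ncard ⟨hdiff, fun h => ?_⟩ (Set.toFinite _))))
    -- the path `P` leaves the loose part
    refine hnr (P.reachable_of_adj fun a b hab => ?_)
    have hPM : ∀ y ∈ P.support, y ∈ c.M := fun y hy => by
      by_contra hyM
      exact (h ⟨hPW y hy, hyM⟩).2 (Or.inr (Or.inl hy))
    exact (P.adj_of_mem_edges hab).reachable_within (hPM a (P.fst_mem_support_of_mem_edges hab))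
      (hPM b (P.snd_mem_support_of_mem_edges hab))
  · -- an edge at a vertex of too large degree is exchanged for the path
    push Not at hPk
    obtain ⟨b, hbP, hbM, hbk⟩ := hPk
    have hbv : b ≠ v := fun e => hbM (e ▸ hv)
    have hbu : b ≠ u := fun e => hbM (e ▸ hu)
    obtain ⟨x₀, hx₀P, hbx₀, hsplit⟩ := hP.exists_deleteEdges hbP hbv
    obtain ⟨T₁, hT₁, hrew, hdeg⟩ := c.loose {u, v} (by rintro x (rfl | rfl) <;> assumption) (by
      rintro x (rfl | rfl) y (rfl | rfl) hxy
      · rfl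
      · exact absurd hxy hnr
      · exact absurd hxy.symm hnr
      · rfl)
    set T₂ := T₁.deleteEdges {s(b, x₀)} ⊔ Q.trace with hT₂
    have hdel : T₁.deleteEdges {s(b, x₀)} ≤ T₁ := deleteEdges_le _
    have hcyc : ∀ y, y ∈ P.support ∨ y ∈ Q.support → T₂.Reachable y v := fun y hy => by
      have := hrew.reachable_cycle (Set.subset_univ _) P (fun _ _ => Set.mem_univ _) Q
        (fun _ _ => Set.mem_univ _) hbM hsplit hy
      rwa [within_univ] at this
    have hTr : ∀ y y', c.T.Adj y y' → T₂.Reachable y y' := fun y y' hyy' => by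
      refine hrew.reachable_of_adj (Set.subset_univ _) (fun a a' _ _ haa' => ?_) (Set.mem_univ _)
        (Set.mem_univ _) hyy'
      by_cases he : s(a, a') = s(b, x₀)
      · rcases Sym2.eq_iff.1 he with ⟨rfl, rfl⟩ | ⟨rfl, rfl⟩
        · exact (hcyc _ (Or.inl hbP)).trans (hcyc _ (Or.inl hx₀P)).symm
        · exact (hcyc _ (Or.inl hx₀P)).trans (hcyc _ (Or.inl hbP)).symm
      · exact Adj.reachable (Or.inl ((deleteEdges_adj).2 ⟨haa', he⟩))
    obtain ⟨T₃, hT₃, hac, hreach⟩ := exists_isAcyclic_reachable_eq_le (G := T₂)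
    have hconn : ∀ y ∈ c.W ∪ Q.interior, T₃.Reachable y v := by
      intro y hy
      rw [hreach]
      rcases hy with hy | hy
      · exact (c.conn y hy v (c.sub hv)).of_adj hTr
      · exact hcyc y (Or.inr hy.1)
    have hT₁W : ∀ a a', T₁.Adj a a' → a ∈ c.W := fun a a' haa' => by
      by_cases hm : a ∈ c.M ∧ a' ∈ c.M
      · exact c.sub hm.1
      · exact c.supp a a' ((hrew.adj a a' hm).1 haa')
    have hQsup : ∀ y ∈ Q.support, y ∈ c.W ∪ Q.interior := fun y hy => by
      by_cases h1 : y = u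
      · exact Or.inl (h1 ▸ c.sub hu)
      by_cases h2 : y = v
      · exact Or.inl (h2 ▸ c.sub hv)
      · exact Or.inr ⟨hy, h1, h2⟩
    let c' : LooseTree G S U k :=
      { W := c.W ∪ Q.interior
        M := {y ∈ c.W ∪ Q.interior | T₃.deg y + 1 ≤ k ∨ y ∈ S}
        T := T₃
        le := hT₃.trans (sup_le (hdel.trans hT₁) Q.trace_le)
        supp := fun a a' haa' => (hT₃ haa').elim (fun h => Or.inl (hT₁W a a' (hdel h)))
          fun h => hQsup a (Q.mem_support_of_trace_adj h)
        conn := fun a ha a' ha' => (hconn a ha).trans (hconn a' ha').symm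
        acyc := hac
        terminals := c.terminals.trans Set.subset_union_left
        sub := fun y hy => hy.1
        exempt := fun y hy => ⟨hy.2, Or.inr hy.1⟩
        loose := fun F _ _ => ⟨T₃, hT₃.trans (sup_le (hdel.trans hT₁) Q.trace_le),
          Rewires.refl _ _, fun y hy hyS => by
            have := hy.2.resolve_right hyS
            exact ⟨by omega, fun _ => this⟩⟩ }
    have hQdeg : ∀ y, y ∉ Q.interior → y ≠ u → y ≠ v → Q.trace.deg y = 0 := fun y h1 h2 h3 =>
      SimpleGraph.deg_eq_zero fun y' hy => h1 ⟨Q.mem_support_of_trace_adj hy, h2, h3⟩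
    have hdeg₃ : ∀ y, T₃.deg y ≤ (T₁.deleteEdges {s(b, x₀)}).deg y + Q.trace.deg y := fun y =>
      (deg_mono hT₃ y).trans (SimpleGraph.deg_sup_le _ _ y)
    have hb' : T₃.deg b < c.T.deg b := by
      have h1 := hdeg₃ b
      have h2 := hQdeg b (fun h => hDW b h (hPW b hbP)) hbu hbv
      have h3 := hrew.deg_eq hbM
      have h4 : T₁.Adj b x₀ := (hrew.adj b x₀ fun h => hbM h.1).2 hbx₀
      have h5 := deg_lt_of_le hdel h4 (by rw [deleteEdges_adj]; simp)
      omega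
    refine absurd (hmin c') (not_le.2 (potential_lt_of_excess_lt (excess_lt (fun y hy hyk => ?_)
      ⟨hPW b hbP, hbM⟩ hbk fun _ => hb')))
    have hyS : y ∉ S := fun h => hy.2 ⟨hy.1, Or.inr h⟩
    have h1 := hdeg₃ y
    have h2 := deg_mono hdel y
    have h6 := hQ.deg_trace_le_two y
    change k < T₃.deg y at hyk
    change y ∈ c.W \ c.M ∧ T₃.deg y ≤ c.T.deg y
    by_cases hyD : y ∈ Q.interior
    · have h3 : T₁.deg y = 0 := SimpleGraph.deg_eq_zero fun y' h => hDW y hyD (hT₁W y y' h)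
      omega
    have hyW : y ∈ c.W := hy.1.resolve_right hyD
    by_cases hyM : y ∈ c.M
    · have h3 := hdeg y hyM hyS
      by_cases hyuv : y = u ∨ y = v
      · have h4 := h3.2 hyuv
        have h5 := hQ.deg_trace_le_one hyuv
        omega
      · push Not at hyuv
        have h5 := hQdeg y hyD hyuv.1 hyuv.2
        omega
    · have h3 := hrew.deg_eq hyM
      have h5 := hQdeg y hyD (fun e => hyM (e ▸ hu)) (fun e => hyM (e ▸ hv))
      exact ⟨⟨hyW, hyM⟩, by omega⟩

/-- In a loose tree of least potential, the components of the loose part are separated in `G` by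
the rest of the tree. -/
theorem reachable_of_reachable_compl [Fintype V] (hk : 3 ≤ k) (c : LooseTree G S U k)
    (hmin : ∀ c' : LooseTree G S U k, c.potential ≤ c'.potential) {u v : V} (hu : u ∈ c.M)
    (hv : v ∈ c.M) (h : (G.within (c.W \ c.M)ᶜ).Reachable u v) :
    (c.T.within c.M).Reachable u v := by
  classical
  obtain ⟨Q⟩ := h
  induction hn : Q.length using Nat.strong_induction_on generalizing u v with
  | _ n ih =>
  by_cases hQ : Q.IsPath
  swap
  · refine ih Q.bypass.length ?_ hu hv Q.bypass rfl
    rw [← hn]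
    exact lt_of_le_of_ne Q.length_bypass_le_length fun e =>
      hQ ((Q.bypass_eq_self_of_length_le_length_bypass e.ge) ▸ Q.bypass_isPath)
  by_cases hQW : ∀ x ∈ Q.support, x ∈ c.W → x = u ∨ x = v
  · refine c.reachable_of_path hk hmin hu hv (Q := Q.mapLe (within_le _ _)) (hQ.mapLe _) ?_
    simpa using hQW
  · push Not at hQW
    obtain ⟨x, hx, hxW, hxu, hxv⟩ := hQW
    have hxB : x ∈ (c.W \ c.M)ᶜ :=
      Reachable.mem_within (Q.takeUntil x hx).reachable fun h => h.2 hu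
    have hxM : x ∈ c.M := by
      by_contra hxM
      exact hxB ⟨hxW, hxM⟩
    have hlen : (Q.takeUntil x hx).length + (Q.dropUntil x hx).length = Q.length := by
      rw [← Walk.length_append, Walk.take_spec]
    have h1 : (Q.takeUntil x hx).length ≠ 0 := fun h => hxu (Walk.eq_of_length_eq_zero h).symm
    have h2 : (Q.dropUntil x hx).length ≠ 0 := fun h => hxv (Walk.eq_of_length_eq_zero h)
    exact (ih _ (by omega) hu hxM (Q.takeUntil x hx) rfl).trans
      (ih _ (by omega) hxM hv (Q.dropUntil x hx) rfl)

end LooseTree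

/-- `G` has spanning connected graphs on `A` that have degree at most `k` off `S`, and even less
than `k` at any one prescribed vertex. -/
def IsFlexible (G : SimpleGraph V) (S : Set V) (k : ℕ) (A : Set V) : Prop :=
  ∀ w ∈ A, ∃ T ≤ G, (∀ a b, T.Adj a b → a ∈ A) ∧ (∀ a ∈ A, ∀ b ∈ A, T.Reachable a b) ∧
    ∀ v ∈ A, v ∉ S → T.deg v ≤ k ∧ (v = w → T.deg v + 1 ≤ k)

/-- **A form of the theorem of Fürer and Raghavachari.** For every set `U` of terminals there is a
set `B` that cuts off more than `(k - 2) |B|` of the terminals from each other, unless it is empty,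
and such that the terminals in each component of `G - B` are joined by a Steiner tree of degree at
most `k`. The vertices of `S` are exempt from the bound on the degrees. -/
theorem exists_blocker [Fintype V] {G : SimpleGraph V} (hG : G.Connected) (S : Set V) {U : Set V}
    (hU : U.Nonempty) {k : ℕ} (hk : 3 ≤ k) :
    ∃ (B : Set V) (A : V → Set V), Disjoint B S ∧
      (B.Nonempty → ∃ R : Finset V, (R : Set V) ⊆ U \ B ∧ (G.within Bᶜ).Scattered R ∧
        (k - 2) * B.ncard + 2 ≤ R.card) ∧
      ∀ u ∈ U \ B, u ∈ A u ∧ A u ⊆ {x | (G.within Bᶜ).Reachable u x} ∧ IsFlexible G S k (A u) ∧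
        ∀ u' ∈ U \ B, (G.within Bᶜ).Reachable u u' → A u = A u' := by
  classical
  obtain ⟨T₀, hT₀, htree⟩ := hG.exists_isTree_le
  let c₀ : LooseTree G S U k :=
    { W := Set.univ
      M := {y | y ∈ S}
      T := T₀
      le := hT₀
      supp := fun _ _ _ => Set.mem_univ _
      conn := fun a _ b _ => htree.1.preconnected a b
      acyc := htree.2
      terminals := Set.subset_univ _
      sub := Set.subset_univ _
      exempt := fun y hy => hy.1
      loose := fun F _ _ => ⟨T₀, hT₀, Rewires.refl _ _, fun y hy hyS => absurd hy hyS⟩ }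
  obtain ⟨c, hmin⟩ : ∃ c : LooseTree G S U k, ∀ c' : LooseTree G S U k,
      c.potential ≤ c'.potential := by
    have hex : ∃ n, ∃ c : LooseTree G S U k, c.potential = n := ⟨_, c₀, rfl⟩
    obtain ⟨c, hc⟩ := Nat.find_spec hex
    exact ⟨c, fun c' => hc ▸ Nat.find_min' hex ⟨c', rfl⟩⟩
  have hTG : c.T.within c.M ≤ G.within (c.W \ c.M)ᶜ := fun a b hab =>
    ⟨c.le hab.1, fun h => h.2 hab.2.1, fun h => h.2 hab.2.2⟩
  have hUM : ∀ u ∈ U \ (c.W \ c.M), u ∈ c.M := fun u hu => by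
    by_contra h
    exact hu.2 ⟨c.terminals hu.1, h⟩
  refine ⟨c.W \ c.M, fun u => {x | (c.T.within c.M).Reachable u x}, ?_, fun hB => ?_,
    fun u hu => ⟨Reachable.rfl, fun x hx => Reachable.mono hTG hx, fun w hw => ?_,
      fun u' hu' huu' => ?_⟩⟩
  · exact Set.disjoint_left.2 fun x hx hxS => hx.2 (c.exempt ⟨hxS, hx.1⟩)
  · obtain ⟨R, hRU, hRs, hRc⟩ := exists_scattered_of_tree (U := U) (k := k) c.supp c.acyc c.conn
      c.sub hB (fun b hb => by
        by_contra hlt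
        obtain ⟨c', hc'⟩ := c.exists_insert hb (by omega)
        exact absurd (hmin c') (by omega)) (by omega)
      (fun x hx hxU => c.exists_prune hmin hU hx hxU)
    refine ⟨R, fun x hx => ⟨(hRU hx).1, fun h => h.2 (hRU hx).2⟩, fun a ha b hb hab => ?_, hRc⟩
    exact hRs a ha b hb (c.reachable_of_reachable_compl hk hmin (hRU ha).2 (hRU hb).2 hab)
  · have huM := hUM u hu
    obtain ⟨T', hT', hrew, hdeg⟩ := c.loose {w} (by
      rintro x rfl; exact Reachable.mem_within hw huM) (by
      rintro a rfl b rfl _; rfl)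
    set A : Set V := {x | (c.T.within c.M).Reachable u x}
    refine ⟨T'.within A, (within_le _ _).trans hT', fun a b hab => hab.2.1, fun a ha b hb => ?_,
      fun v hv hvS => ?_⟩
    · have h1 : (T'.within c.M).Reachable a b := (hrew.reach a b).2 (Reachable.trans
        (Reachable.symm ha) hb)
      have := h1.within_of_closed (s := A) (fun x y hxy hx =>
        Reachable.trans hx ((hrew.reach x y).1 hxy.reachable)) ha
      rw [within_within] at this
      exact this.mono (within_mono le_rfl Set.inter_subset_right)
    · have h1 := deg_mono (within_le T' A) v
      have h2 := hdeg v (Reachable.mem_within hv huM) hvS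
      exact ⟨by omega, fun e => by have := h2.2 e; omega⟩
  · have h1 := c.reachable_of_reachable_compl hk hmin (hUM u hu) (hUM u' hu') huu'
    ext x
    exact ⟨fun hx => h1.symm.trans hx, fun hx => h1.trans hx⟩

/-! ### Toughness -/

theorem Reachable.exists_adj_within_compl {H : SimpleGraph V} {r x : V} (h : H.Reachable r x)
    (hne : r ≠ x) : ∃ y, H.Adj x y ∧ (H.within {x}ᶜ).Reachable r y := by
  obtain ⟨p⟩ := h
  induction p with
  | nil => exact absurd rfl hne
  | @cons a b c hab p ih =>
    by_cases hbc : b = c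
    · subst hbc
      exact ⟨a, hab.symm, Reachable.rfl⟩
    · obtain ⟨y, hy, hr⟩ := ih hbc
      exact ⟨y, hy, (hab.reachable_within hne hbc).trans hr⟩

/-- Removing the set `X` from a graph that is connected on `A` leaves few components. -/
theorem card_add_card_le_of_scattered [Finite V] {T : SimpleGraph V} {A : Set V}
    (hT : ∀ a ∈ A, ∀ b ∈ A, (T.within A).Reachable a b) (X R : Finset V)
    (hR : (R : Set V) ⊆ A \ X) (hXA : (X : Set V) ⊆ A) (hs : (T.within (A \ X)).Scattered R) :
    R.card + X.card ≤ ∑ x ∈ X, T.deg x + 1 := by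
  classical
  induction X using Finset.induction_on generalizing R with
  | empty =>
    have : R.card ≤ 1 := Finset.card_le_one.2 fun a ha b hb => hs a ha b hb (by
      rw [Finset.coe_empty, Set.sdiff_empty]
      exact hT a (hR ha).1 b (hR hb).1)
    simpa using this
  | @insert x X hx ih =>
    set H := T.within (A \ X) with hH
    have hH' : H.within {x}ᶜ = T.within (A \ (insert x X : Finset V)) := by
      rw [hH, within_within]
      congr 1
      ext y
      simp only [Set.mem_inter_iff, Set.mem_sdiff, Finset.mem_coe, Set.mem_compl_iff,
        Set.mem_singleton_iff, Finset.mem_insert]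
      tauto
    rw [← hH'] at hs
    have hxA : x ∈ A := hXA (by simp)
    have hRx : ∀ r ∈ R, r ≠ x := fun r hr e => (hR hr).2 (by simp [e])
    have hRX : ∀ r ∈ R, r ∈ A \ (X : Set V) := fun r hr =>
      ⟨(hR hr).1, fun h => (hR hr).2 (by
        rw [Finset.mem_coe] at h ⊢; exact Finset.mem_insert_of_mem h)⟩
    set R₁ := R.filter fun r => H.Reachable r x with hR₁
    set R₂ := R.filter fun r => ¬ H.Reachable r x with hR₂
    have hx₂ : x ∉ R₂ := fun h => (Finset.mem_filter.1 h).2 Reachable.rfl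
    -- the representatives in the component of `x` are charged to the neighbours of `x`
    have h₁ : R₁.card ≤ T.deg x := by
      have hex : ∀ r ∈ R₁, ∃ y, H.Adj x y ∧ (H.within {x}ᶜ).Reachable r y := fun r hr =>
        (Finset.mem_filter.1 hr).2.exists_adj_within_compl (hRx r (Finset.mem_filter.1 hr).1)
      have : Nonempty V := ⟨x⟩
      choose! y hy hry using hex
      have hinj : Set.InjOn y R₁ := fun a ha b hb hab => by
        refine hs a (Finset.mem_filter.1 ha).1 b (Finset.mem_filter.1 hb).1 ((hry a ha).trans ?_)
        rw [hab]
        exact (hry b hb).symm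
      rw [← Finset.card_image_of_injOn hinj, ← Set.ncard_coe_finset]
      refine Set.ncard_le_ncard (fun z hz => ?_) (Set.toFinite _)
      obtain ⟨a, ha, rfl⟩ := Finset.mem_image.1 (Finset.mem_coe.1 hz)
      exact (hy a ha).1
    have h₂ := ih (insert x R₂) (by
        intro r hr
        rcases Finset.mem_insert.1 (Finset.mem_coe.1 hr) with rfl | hr
        · exact ⟨hxA, by simpa using hx⟩
        · exact hRX r (Finset.mem_filter.1 hr).1)
      (fun y hy => hXA (by rw [Finset.mem_coe] at hy ⊢; exact Finset.mem_insert_of_mem hy)) (by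
        intro a ha b hb hab
        rcases Finset.mem_insert.1 (Finset.mem_coe.1 ha) with rfl | ha <;>
          rcases Finset.mem_insert.1 (Finset.mem_coe.1 hb) with rfl | hb
        · rfl
        · exact absurd hab.symm (Finset.mem_filter.1 hb).2
        · exact absurd hab (Finset.mem_filter.1 ha).2
        · have hax := (Finset.mem_filter.1 ha).2
          refine hs a (Finset.mem_filter.1 ha).1 b (Finset.mem_filter.1 hb).1 ?_
          refine (hab.within_of_closed (s := {z | ¬ H.Reachable z x})
            (fun y z hyz hy hz => hy (hyz.reachable.trans hz)) hax).mono
            (within_mono le_rfl fun z hz => ?_)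
          rintro rfl
          exact hz Reachable.rfl)
    rw [Finset.card_insert_of_notMem hx₂] at h₂
    have h₃ : R₁.card + R₂.card = R.card := Finset.card_filter_add_card_filter_not _
    rw [Finset.sum_insert hx, Finset.card_insert_of_notMem hx]
    omega

theorem IsFlexible.reachable_within {G : SimpleGraph V} {S A : Set V} {k : ℕ}
    (h : IsFlexible G S k A) {a b : V} (ha : a ∈ A) (hb : b ∈ A) :
    (G.within A).Reachable a b := by
  obtain ⟨T, hTG, hT, hc, -⟩ := h a ha
  exact (hc a ha b hb).mono fun x y hxy => ⟨hTG hxy, hT x y hxy, hT y x hxy.symm⟩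

/-- Removing a nonempty set `X` from a flexible set leaves at most `(k - 1) |X|` components: the
tree can be chosen with degree less than `k` at one vertex of `X`. -/
theorem IsFlexible.card_le_of_scattered [Finite V] {G : SimpleGraph V} {A : Set V} {k : ℕ}
    (h : IsFlexible G ∅ (k + 1) A) {X R : Finset V} (hX : X.Nonempty) (hXA : (X : Set V) ⊆ A)
    (hR : (R : Set V) ⊆ A \ X) (hs : (G.within (A \ X)).Scattered R) :
    R.card ≤ k * X.card := by
  classical
  obtain ⟨w, hw⟩ := hX
  obtain ⟨T, hTG, hT, hc, hdeg⟩ := h w (hXA hw)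
  have hTA : T.within A = T := by
    ext a b
    exact ⟨fun h => h.1, fun h => ⟨h, hT a b h, hT b a h.symm⟩⟩
  have h1 := card_add_card_le_of_scattered (by rw [hTA]; exact hc) X R hR hXA
    (hs.anti (within_mono hTG le_rfl) le_rfl)
  have h2 : ∑ x ∈ X, T.deg x + 1 ≤ X.card * (k + 1) := by
    rw [← Finset.add_sum_erase X _ hw, ← Finset.card_erase_add_one hw]
    have h3 : ∑ x ∈ X.erase w, T.deg x ≤ (X.erase w).card * (k + 1) := by
      rw [← smul_eq_mul]
      exact Finset.sum_le_card_nsmul _ _ _ fun x hx =>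
        (hdeg x (hXA (Finset.mem_of_mem_erase hx)) (Set.notMem_empty x)).1
    have h4 := (hdeg w (hXA hw) (Set.notMem_empty w)).2 rfl
    nlinarith
  nlinarith

/-! ### The hierarchy of a rank function -/

/-- The component of `v` among the vertices that do not rank above `v`. -/
def lower (G : SimpleGraph V) (ℓ : V → ℕ) (v : V) : Set V :=
  {x | (G.within {y | ℓ y ≤ ℓ v}).Reachable v x}

section lower

variable {G : SimpleGraph V} {ℓ : V → ℕ} {u v w : V}

theorem mem_lower_self : v ∈ G.lower ℓ v := Reachable.rfl

theorem rank_le_of_mem_lower (h : v ∈ G.lower ℓ w) : ℓ v ≤ ℓ w :=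
  Reachable.mem_within (s := {y | ℓ y ≤ ℓ w}) h (show ℓ w ≤ ℓ w from le_rfl)

theorem mem_lower_trans (h : u ∈ G.lower ℓ v) (h' : v ∈ G.lower ℓ w) : u ∈ G.lower ℓ w :=
  Reachable.trans h' (Reachable.mono
    (within_mono le_rfl fun _ hy => le_trans hy (rank_le_of_mem_lower h')) h)

theorem mem_lower_of_mem_lower (h : u ∈ G.lower ℓ v) (h' : u ∈ G.lower ℓ w) (hvw : ℓ v ≤ ℓ w) :
    v ∈ G.lower ℓ w :=
  Reachable.trans h' (Reachable.mono
    (within_mono le_rfl fun _ hy => le_trans hy hvw) (Reachable.symm h))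

theorem mem_lower_of_adj (h : u ∈ G.lower ℓ w) (huv : G.Adj u v) (hv : ℓ v ≤ ℓ w) :
    v ∈ G.lower ℓ w :=
  Reachable.trans h (huv.reachable_within (rank_le_of_mem_lower h) hv)

theorem lower_subset (h : u ∈ G.lower ℓ v) : G.lower ℓ u ⊆ G.lower ℓ v :=
  fun _ hx => mem_lower_trans hx h

theorem lower_eq (h : u ∈ G.lower ℓ v) (huv : ℓ v ≤ ℓ u) : G.lower ℓ u = G.lower ℓ v :=
  (lower_subset h).antisymm (lower_subset (mem_lower_of_mem_lower h mem_lower_self huv))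

theorem reachable_within_lower {x y : V} (hx : x ∈ G.lower ℓ v) (hy : y ∈ G.lower ℓ v) :
    (G.within (G.lower ℓ v)).Reachable x y := by
  have h : (G.within {y | ℓ y ≤ ℓ v}).Reachable x y := Reachable.trans (Reachable.symm hx) hy
  have := h.within_of_closed (s := G.lower ℓ v)
    (fun a b (hab : (G.within {y | ℓ y ≤ ℓ v}).Adj a b) ha =>
      mem_lower_of_adj ha hab.1 hab.2.2) hx
  rw [within_within] at this
  exact this.mono (within_mono le_rfl Set.inter_subset_right)

end lower

/-- Two vertices belong to the same part if they have the same rank and are joined by a path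
along which the rank is never higher. -/
def rankSetoid (G : SimpleGraph V) (ℓ : V → ℕ) : Setoid V where
  r v w := ℓ v = ℓ w ∧ v ∈ G.lower ℓ w
  iseqv :=
    { refl := fun _ => ⟨rfl, mem_lower_self⟩
      symm := fun h => ⟨h.1.symm, mem_lower_of_mem_lower h.2 mem_lower_self h.1.ge⟩
      trans := fun h h' => ⟨h.1.trans h'.1, mem_lower_trans h.2 h'.2⟩ }

section Hierarchy

variable (G : SimpleGraph V) (ℓ : V → ℕ)

/-- The vertices that rank above `v` and have `v` in their lower set. -/
def above (v : V) : Set V := {w | ℓ v < ℓ w ∧ v ∈ G.lower ℓ w}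

open Classical in
/-- A vertex of least rank above `v`, or `v` if there is none. -/
noncomputable def lowestAbove (v : V) : V :=
  if h : (G.above ℓ v).Nonempty then Function.argminOn ℓ (G.above ℓ v) h else v

/-- The part of a vertex in the hierarchy of a rank function. -/
def rankPart (v : V) : Quotient (G.rankSetoid ℓ) := Quotient.mk _ v

/-- The parent of a part is the part of a vertex of least rank above it. -/
noncomputable def rankParent (x : Quotient (G.rankSetoid ℓ)) : Quotient (G.rankSetoid ℓ) :=
  G.rankPart ℓ (G.lowestAbove ℓ x.out)

variable {G ℓ}

theorem rankPart_eq {v w : V} : G.rankPart ℓ v = G.rankPart ℓ w ↔ ℓ v = ℓ w ∧ v ∈ G.lower ℓ w :=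
  Quotient.eq

theorem rankPart_out (x : Quotient (G.rankSetoid ℓ)) : G.rankPart ℓ x.out = x := Quotient.out_eq x

theorem lowestAbove_mem {v : V} (h : (G.above ℓ v).Nonempty) : G.lowestAbove ℓ v ∈ G.above ℓ v := by
  rw [lowestAbove, dif_pos h]
  exact Function.argminOn_mem _ _ _

theorem lowestAbove_le {v w : V} (h : w ∈ G.above ℓ v) : ℓ (G.lowestAbove ℓ v) ≤ ℓ w := by
  rw [lowestAbove, dif_pos ⟨w, h⟩]
  exact Function.argminOn_le _ _ h

theorem mem_lower_lowestAbove (v : V) : v ∈ G.lower ℓ (G.lowestAbove ℓ v) := by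
  by_cases h : (G.above ℓ v).Nonempty
  · exact (lowestAbove_mem h).2
  · rw [lowestAbove, dif_neg h]
    exact mem_lower_self

theorem mem_lower_of_iterate_rankParent (k : ℕ) : ∀ {v w : V},
    (G.rankParent ℓ)^[k] (G.rankPart ℓ v) = G.rankPart ℓ w → v ∈ G.lower ℓ w := by
  induction k with
  | zero => exact fun h => (rankPart_eq.1 h).2
  | succ k ih =>
    intro v w h
    rw [Function.iterate_succ_apply] at h
    have h1 := rankPart_eq.1 (rankPart_out (G.rankPart ℓ v)).symm
    exact mem_lower_trans h1.2 (mem_lower_trans (mem_lower_lowestAbove _) (ih h))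

theorem exists_iterate_rankParent {v w : V} (h : v ∈ G.lower ℓ w) :
    ∃ k, k + ℓ v ≤ ℓ w ∧ (G.rankParent ℓ)^[k] (G.rankPart ℓ v) = G.rankPart ℓ w := by
  induction hn : ℓ w - ℓ v using Nat.strong_induction_on generalizing v with
  | _ n ih =>
  have hle := rank_le_of_mem_lower h
  rcases hle.eq_or_lt with heq | hlt
  · exact ⟨0, by omega, rankPart_eq.2 ⟨heq, h⟩⟩
  · set v' := (G.rankPart ℓ v).out with hv'
    have h1 := rankPart_eq.1 (rankPart_out (G.rankPart ℓ v))
    rw [← hv'] at h1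
    have hw : w ∈ G.above ℓ v' := ⟨by omega, mem_lower_trans h1.2 h⟩
    have hmem := lowestAbove_mem ⟨w, hw⟩
    have hmw := mem_lower_of_mem_lower hmem.2 hw.2 (lowestAbove_le hw)
    have := hmem.1
    obtain ⟨k, hk, hk'⟩ := ih _ (by omega) hmw rfl
    exact ⟨k + 1, by omega, by rwa [Function.iterate_succ_apply]⟩

variable (G ℓ) in
/-- The hierarchy of a rank function with a vertex `r` that ranks highest. -/
noncomputable def rankHierarchy (r : V) (hr : ∀ v, v ∈ G.lower ℓ r) : Hierarchy V where
  Node := Quotient (G.rankSetoid ℓ)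
  comp := G.rankPart ℓ
  comp_surjective := Quotient.mk_surjective
  root := G.rankPart ℓ r
  parent := G.rankParent ℓ
  parent_root := by
    have h1 := rankPart_eq.1 (rankPart_out (G.rankPart ℓ r))
    have : ¬ (G.above ℓ (G.rankPart ℓ r).out).Nonempty := fun ⟨w, hw⟩ => by
      have := rank_le_of_mem_lower (hr w)
      have := hw.1
      omega
    rw [rankParent, lowestAbove, dif_neg this, rankPart_out]
  reaches_root x := by
    obtain ⟨v, rfl⟩ := Quotient.mk_surjective x
    obtain ⟨k, -, hk⟩ := exists_iterate_rankParent (hr v)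
    exact ⟨k, hk⟩

variable {r : V} {hr : ∀ v, v ∈ G.lower ℓ r}

theorem rankHierarchy_le {v w : V} : (G.rankHierarchy ℓ r hr).Le (G.rankPart ℓ v) (G.rankPart ℓ w) ↔
    v ∈ G.lower ℓ w :=
  ⟨fun ⟨k, hk⟩ => mem_lower_of_iterate_rankParent k hk, fun h =>
    (exists_iterate_rankParent h).imp fun _ => And.right⟩

theorem rankHierarchy_sub (w : V) :
    (G.rankHierarchy ℓ r hr).sub (G.rankPart ℓ w) = G.lower ℓ w := by
  ext v
  exact rankHierarchy_le

theorem rankHierarchy_isRespectful [Fintype V]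
    (hheight : (ℓ r : ℝ) + 1 ≤ max 1 (Real.logb 2 (Fintype.card V))) :
    (G.rankHierarchy ℓ r hr).IsRespectful G where
  height x := by
    obtain ⟨v, rfl⟩ := Quotient.mk_surjective x
    obtain ⟨k, hk, hk'⟩ := exists_iterate_rankParent (hr v)
    refine ⟨k, hk', le_trans ?_ hheight⟩
    have : k ≤ ℓ r := by omega
    have : (k : ℝ) ≤ ℓ r := by exact_mod_cast this
    linarith
  no_lateral a b hab := by
    rcases le_total (ℓ a) (ℓ b) with h | h
    · have h1 : a ∈ G.lower ℓ b := mem_lower_of_adj mem_lower_self hab.symm h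
      by_cases he : G.rankPart ℓ a = G.rankPart ℓ b
      · exact Or.inr ⟨0, he.symm⟩
      · exact Or.inl ⟨rankHierarchy_le.2 h1, he⟩
    · exact Or.inr (rankHierarchy_le.2 (mem_lower_of_adj mem_lower_self hab h))
  connected x := by
    obtain ⟨v, rfl⟩ := Quotient.mk_surjective x
    change (G.induce ((G.rankHierarchy ℓ r hr).sub (G.rankPart ℓ v))).Connected
    rw [rankHierarchy_sub]
    exact connected_induce_iff_within.2 ⟨⟨v, mem_lower_self⟩, fun a ha b hb =>
      reachable_within_lower ha hb⟩
  child_edge y x hyx := by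
    obtain ⟨hy, rfl⟩ := hyx
    set v := Quotient.out y with hv
    have hyv : y = G.rankPart ℓ v := (rankPart_out y).symm
    have hne : (G.above ℓ v).Nonempty := by
      by_contra hno
      have hle := rank_le_of_mem_lower (hr v)
      rcases hle.eq_or_lt with heq | hlt
      · exact hy (hyv.trans (rankPart_eq.2 ⟨heq, hr v⟩))
      · exact hno ⟨r, hlt, hr v⟩
    have hu := lowestAbove_mem hne
    set u := G.lowestAbove ℓ v with hu'
    have hex : ∃ a b, a ∈ G.lower ℓ v ∧ b ∉ G.lower ℓ v ∧ G.Adj a b ∧ ℓ b ≤ ℓ u := by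
      by_contra hno
      push Not at hno
      have hvu : (G.within {y | ℓ y ≤ ℓ u}).Reachable v u := Reachable.symm hu.2
      have := hvu.mem_of_closed (s := G.lower ℓ v) (fun a b hab ha => by
        by_contra hb
        exact absurd (hno a b ha hb hab.1) (not_lt.2 hab.2.2)) mem_lower_self
      exact absurd (rank_le_of_mem_lower this) (not_le.2 hu.1)
    obtain ⟨a, b, ha, hb, hab, hbu⟩ := hex
    have hvb : ℓ v < ℓ b := not_le.1 fun h => hb (mem_lower_of_adj ha hab h)
    have hau : a ∈ G.lower ℓ u := mem_lower_trans ha hu.2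
    have hbu' : b ∈ G.lower ℓ u := mem_lower_of_adj hau hab hbu
    have hab' : a ∈ G.lower ℓ b :=
      mem_lower_of_adj mem_lower_self hab.symm ((rank_le_of_mem_lower ha).trans hvb.le)
    have hub : ℓ u ≤ ℓ b :=
      lowestAbove_le ⟨hvb, mem_lower_of_mem_lower ha hab' hvb.le⟩
    refine ⟨b, ?_, a, ?_, hab.symm⟩
    · change G.rankPart ℓ b = G.rankPart ℓ u
      exact rankPart_eq.2 ⟨le_antisymm hbu hub, hbu'⟩
    · rw [hyv, rankHierarchy_sub]
      exact ha

end Hierarchy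

/-! ### Iterated blocking sets -/

/-- Each vertex `v` has a flexible set `A v` (a Steiner tree of small degree that contains it); for
two vertices of the same rank, these sets coincide as soon as they meet each other or the lower set
of the other vertex. -/
structure IsSteinerRanking (G : SimpleGraph V) (ℓ : V → ℕ) (A : V → Set V) : Prop where
  mem : ∀ v, v ∈ A v
  flexible : ∀ v, IsFlexible G ∅ 4 (A v)
  eq_of_mem : ∀ u v x, ℓ u = ℓ v → x ∈ A u ∪ G.lower ℓ u → x ∈ A v ∪ G.lower ℓ v → A u = A v

/-- Blocking the whole vertex set, then the blocking set, and so on, until nothing is left to be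
blocked. The number of steps is at most logarithmic, because every blocking set is less than half
as large as the one before. -/
theorem exists_isSteinerRanking [Fintype V] {G : SimpleGraph V} (hG : G.Connected) :
    ∃ (ℓ : V → ℕ) (A : V → Set V) (p : ℕ), IsSteinerRanking G ℓ A ∧ (∀ v, ℓ v < p) ∧
      (p = 1 ∨ 9 * 2 ^ p ≤ 4 * Fintype.card V + 16) := by
  classical
  have hstep := fun U : {U : Set V // U.Nonempty} =>
    exists_blocker (G := G) hG ∅ U.2 (k := 4) (by norm_num)
  choose B A _hS hBR hA using hstep
  let nxt : Set V → Set V := fun U => if h : U.Nonempty then B ⟨U, h⟩ else ∅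
  let Bs : ℕ → Set V := fun i => nxt^[i] Set.univ
  have hB0 : Bs 0 = Set.univ := rfl
  have hBs : ∀ i, Bs (i + 1) = nxt (Bs i) := fun i => Function.iterate_succ_apply' _ _ _
  have hBne : ∀ i (h : (Bs i).Nonempty), Bs (i + 1) = B ⟨Bs i, h⟩ := fun i h => by
    rw [hBs]; exact dif_pos h
  have hBe : ∀ i, Bs i = ∅ → Bs (i + 1) = ∅ := fun i h => by
    rw [hBs, h]; exact dif_neg Set.not_nonempty_empty
  -- the sizes of the blocking sets
  have hR : ∀ i, (Bs (i + 1)).Nonempty →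
      ∃ R : Finset V, (R : Set V) ⊆ Bs i \ Bs (i + 1) ∧ 2 * (Bs (i + 1)).ncard + 2 ≤ R.card := by
    intro i h
    have hi : (Bs i).Nonempty := by
      by_contra hne
      rw [hBe i (Set.not_nonempty_iff_eq_empty.1 hne)] at h
      exact Set.not_nonempty_empty h
    rw [hBne i hi] at h ⊢
    obtain ⟨R, hRs, -, hRc⟩ := hBR ⟨Bs i, hi⟩ h
    exact ⟨R, hRs, hRc⟩
  have hhalf : ∀ i, (Bs (i + 1)).Nonempty → 2 * (Bs (i + 1)).ncard + 2 ≤ (Bs i).ncard :=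
    fun i h => by
      obtain ⟨R, hRs, hRc⟩ := hR i h
      refine hRc.trans ?_
      rw [← Set.ncard_coe_finset]
      exact Set.ncard_le_ncard (hRs.trans Set.sdiff_subset) (Set.toFinite _)
  have hthird : (Bs 1).Nonempty → 3 * (Bs 1).ncard + 2 ≤ Fintype.card V := fun h => by
    obtain ⟨R, hRs, hRc⟩ := hR 0 h
    have h1 : (R : Set V).ncard + (Bs 1).ncard ≤ Fintype.card V := by
      rw [← Set.ncard_union_eq (Set.disjoint_left.2 fun x hx => (hRs hx).2) (Set.toFinite _)
        (Set.toFinite _), ← Nat.card_eq_fintype_card, ← Set.ncard_univ]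
      exact Set.ncard_le_ncard (Set.subset_univ _) (Set.toFinite _)
    rw [Set.ncard_coe_finset] at h1
    simp only [zero_add] at hRc
    omega
  have hex : ∃ p, Bs p = ∅ := by
    by_contra hno
    push Not at hno
    have : ∀ i, (Bs i).ncard + i ≤ (Bs 0).ncard := fun i => by
      induction i with
      | zero => rfl
      | succ i ih =>
        have := hhalf i (hno (i + 1))
        omega
    have h1 := this ((Bs 0).ncard)
    have h2 := (Set.ncard_pos (Set.toFinite _)).2 (hno ((Bs 0).ncard))
    omega
  set p := Nat.find hex with hp
  have hpe : Bs p = ∅ := Nat.find_spec hex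
  have hlt : ∀ i < p, (Bs i).Nonempty := fun i hi =>
    Set.nonempty_iff_ne_empty.2 (Nat.find_min hex hi)
  have hge : ∀ i, p ≤ i → Bs i = ∅ := fun i hi => by
    induction i, hi using Nat.le_induction with
    | base => exact hpe
    | succ i _ ih => exact hBe i ih
  let ℓ : V → ℕ := fun v => Nat.findGreatest (fun i => v ∈ Bs i) p
  have hℓ : ∀ v, v ∈ Bs (ℓ v) := fun v =>
    Nat.findGreatest_spec (P := fun i => v ∈ Bs i) (Nat.zero_le p) (by rw [hB0]; trivial)
  have hℓ' : ∀ v i, ℓ v < i → v ∉ Bs i := fun v i hi => by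
    by_cases hip : i ≤ p
    · exact Nat.findGreatest_is_greatest hi hip
    · rw [hge i (by omega)]; exact Set.notMem_empty v
  have hℓp : ∀ v, ℓ v < p := fun v => by
    by_contra hle
    have := hℓ v
    rw [hge _ (not_lt.1 hle)] at this
    exact this
  let Γ : V → Set V := fun v => {x | (G.within (Bs (ℓ v + 1))ᶜ).Reachable v x}
  have hne : ∀ v, (Bs (ℓ v)).Nonempty := fun v => ⟨v, hℓ v⟩
  have hmem : ∀ v, v ∈ Bs (ℓ v) \ B ⟨Bs (ℓ v), hne v⟩ := fun v =>
    ⟨hℓ v, by rw [← hBne]; exact hℓ' v _ (Nat.lt_succ_self _)⟩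
  have hAv := fun v => hA ⟨Bs (ℓ v), hne v⟩ v (hmem v)
  have hsub : ∀ v, A ⟨Bs (ℓ v), hne v⟩ v ∪ G.lower ℓ v ⊆ Γ v := by
    rintro v x (hx | hx)
    · have := (hAv v).2.1 hx
      rw [← hBne] at this
      exact this
    · refine Reachable.mono (within_mono le_rfl fun y hy => ?_) hx
      exact hℓ' y _ (Nat.lt_succ_of_le hy)
  refine ⟨ℓ, fun v => A ⟨Bs (ℓ v), hne v⟩ v, p, ⟨fun v => (hAv v).1, fun v => (hAv v).2.2.1,
    fun u v x huv hxu hxv => ?_⟩, hℓp, ?_⟩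
  · have hu := hsub u hxu
    have hv := hsub v hxv
    have huv' : (G.within (Bs (ℓ u + 1))ᶜ).Reachable u v := by
      refine Reachable.trans hu (Reachable.symm ?_)
      rw [huv]
      exact hv
    have hidx : (⟨Bs (ℓ u), hne u⟩ : {U : Set V // U.Nonempty}) = ⟨Bs (ℓ v), hne v⟩ :=
      Subtype.ext (congrArg Bs huv)
    have := (hAv u).2.2.2 v (hidx ▸ hmem v) (by rw [← hBne]; exact huv')
    change A ⟨Bs (ℓ u), hne u⟩ u = A ⟨Bs (ℓ v), hne v⟩ v
    rw [this, hidx]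
  · have hp1 : 1 ≤ p := by
      obtain ⟨v⟩ := hG.nonempty
      have := hℓp v
      omega
    rcases hp1.eq_or_lt with h | h
    · exact Or.inl h.symm
    right
    have hpow : ∀ j, j + 2 ≤ p → 3 * 2 ^ j ≤ (Bs (p - 1 - j)).ncard + 2 := fun j => by
      induction j with
      | zero =>
        intro _
        have := (Set.ncard_pos (Set.toFinite _)).2 (hlt (p - 1 - 0) (by omega))
        omega
      | succ j ih =>
        intro hj
        have h1 := ih (by omega)
        have h2 := hhalf (p - 1 - (j + 1)) (by
          have : p - 1 - (j + 1) + 1 = p - 1 - j := by omega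
          rw [this]; exact hlt _ (by omega))
        have h3 : p - 1 - (j + 1) + 1 = p - 1 - j := by omega
        rw [h3] at h2
        rw [pow_succ]
        omega
    have h1 := hpow (p - 2) (by omega)
    have h2 : p - 1 - (p - 2) = 1 := by omega
    rw [h2] at h1
    have h3 := hthird (hlt 1 h)
    have h4 : 2 ^ p = 2 ^ (p - 2) * 4 := by
      rw [show p = p - 2 + 2 by omega, pow_add, Nat.add_sub_cancel]; rfl
    omega

/-- The parts of the hierarchy of a Steiner ranking are spanned by Steiner trees of maximum degree
at most `4`. -/
theorem IsSteinerRanking.isDuanPettie [Fintype V] {G : SimpleGraph V} {ℓ : V → ℕ} {A : V → Set V}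
    (h : IsSteinerRanking G ℓ A) {r : V} {hr : ∀ v, v ∈ G.lower ℓ r}
    (hheight : (ℓ r : ℝ) + 1 ≤ max 1 (Real.logb 2 (Fintype.card V))) :
    (G.rankHierarchy ℓ r hr).IsDuanPettie G where
  toIsRespectful := rankHierarchy_isRespectful hheight
  steiner x := by
    obtain ⟨v, rfl⟩ := Quotient.mk_surjective x
    obtain ⟨T, hTG, hT, hc, hdeg⟩ := h.flexible v v (h.mem v)
    obtain ⟨T', hT', hac, hreach⟩ := exists_isAcyclic_reachable_eq_le (G := T)
    have hcoe : ∀ (S : G.Subgraph), S.verts = A v → (∀ a b, S.Adj a b ↔ T'.Adj a b) →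
        S.coe = T'.induce S.verts := fun S _ hS => by
      ext a b
      exact hS a b
    have hW : T'.within (A v) = T' := by
      ext a b
      exact ⟨fun h => h.1, fun h => ⟨h, hT a b (hT' h), hT b a (hT' h.symm)⟩⟩
    refine ⟨⟨A v, T'.Adj, fun hab => hTG (hT' hab), fun hab => hT _ _ (hT' hab),
      T'.symm⟩, ?_, ?_, ?_⟩
    · rw [hcoe _ rfl fun _ _ => Iff.rfl]
      refine ⟨connected_induce_iff_within.2 ⟨⟨v, h.mem v⟩, fun a ha b hb => ?_⟩, hac.induce _⟩
      rw [hW, hreach]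
      exact hc a ha b hb
    · intro u hu
      have hu := rankPart_eq.1 hu
      change u ∈ A v
      rw [← h.eq_of_mem u v u hu.1 (Or.inl (h.mem u)) (Or.inr hu.2)]
      exact h.mem u
    · intro u hu
      exact (deg_mono hT' u).trans (hdeg u hu (Set.notMem_empty u)).1

/-! ### Contracting a hierarchy onto some of its parts -/

section Contract

variable (G : SimpleGraph V) (ℓ : V → ℕ) (keep : Set V)

open Classical in
/-- A vertex of least rank among those in `keep` that have `v` in their lower set. -/
noncomputable def keptAbove (v : V) : V :=
  if h : {w | w ∈ keep ∧ v ∈ G.lower ℓ w}.Nonempty then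
    Function.argminOn ℓ {w | w ∈ keep ∧ v ∈ G.lower ℓ w} h else v

/-- The rank function of the contracted hierarchy, in which every part that is not in `keep` is
merged into its parent. -/
noncomputable def contractRank (v : V) : ℕ := ℓ (G.keptAbove ℓ keep v)

variable {G ℓ keep} {r : V}

theorem keptAbove_mem (hr : ∀ v, v ∈ G.lower ℓ r) (hrk : r ∈ keep) (v : V) :
    G.keptAbove ℓ keep v ∈ keep ∧ v ∈ G.lower ℓ (G.keptAbove ℓ keep v) := by
  have h : {w | w ∈ keep ∧ v ∈ G.lower ℓ w}.Nonempty := ⟨r, hrk, hr v⟩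
  rw [keptAbove, dif_pos h]
  exact Function.argminOn_mem ℓ _ h

theorem contractRank_le (hr : ∀ v, v ∈ G.lower ℓ r) (hrk : r ∈ keep)
    {v w : V} (hw : w ∈ keep) (hv : v ∈ G.lower ℓ w) :
    G.contractRank ℓ keep v ≤ ℓ w := by
  have h : {w | w ∈ keep ∧ v ∈ G.lower ℓ w}.Nonempty := ⟨r, hrk, hr v⟩
  rw [contractRank, keptAbove, dif_pos h]
  exact Function.argminOn_le ℓ {w | w ∈ keep ∧ v ∈ G.lower ℓ w} (show w ∈ _ from ⟨hw, hv⟩)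

theorem le_contractRank (hr : ∀ v, v ∈ G.lower ℓ r) (hrk : r ∈ keep) (v : V) :
    ℓ v ≤ G.contractRank ℓ keep v :=
  rank_le_of_mem_lower (keptAbove_mem hr hrk v).2

theorem contractRank_eq (hr : ∀ v, v ∈ G.lower ℓ r) (hrk : r ∈ keep)
    {v : V} (hv : v ∈ keep) : G.contractRank ℓ keep v = ℓ v :=
  (contractRank_le hr hrk hv mem_lower_self).antisymm (le_contractRank hr hrk v)

theorem lower_contractRank (hr : ∀ v, v ∈ G.lower ℓ r) (hrk : r ∈ keep) (v : V) :
   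
    G.lower (G.contractRank ℓ keep) v = G.lower ℓ (G.keptAbove ℓ keep v) := by
  have hv := keptAbove_mem hr hrk v
  refine Set.Subset.antisymm (fun x hx => ?_) fun x hx => ?_
  · have hx : (G.within {y | G.contractRank ℓ keep y ≤ G.contractRank ℓ keep v}).Reachable v x := hx
    exact hx.mem_of_closed (fun a b (hab : (G.within _).Adj a b) ha =>
      mem_lower_of_adj ha hab.1 ((le_contractRank hr hrk b).trans hab.2.2)) hv.2
  · exact (reachable_within_lower hv.2 hx).mono (within_mono le_rfl fun y hy =>
      contractRank_le hr hrk hv.1 hy)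

theorem mem_lower_contractRank (hr : ∀ v, v ∈ G.lower ℓ r) (hrk : r ∈ keep)
    {v w : V} (h : v ∈ G.lower ℓ w) :
    v ∈ G.lower (G.contractRank ℓ keep) w := by
  rw [lower_contractRank hr hrk]
  exact mem_lower_trans h (keptAbove_mem hr hrk w).2

theorem mem_lower_contractRank_root (hr : ∀ v, v ∈ G.lower ℓ r) (hrk : r ∈ keep) (v : V) :
    v ∈ G.lower (G.contractRank ℓ keep) r :=
  mem_lower_contractRank hr hrk (hr v)

theorem rankPart_contractRank_eq (hr : ∀ v, v ∈ G.lower ℓ r) (hrk : r ∈ keep)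
    {v w : V} (h : ℓ v = ℓ w ∧ v ∈ G.lower ℓ w) :
    G.rankPart (G.contractRank ℓ keep) v = G.rankPart (G.contractRank ℓ keep) w := by
  refine rankPart_eq.2 ⟨le_antisymm ?_ ?_, mem_lower_contractRank hr hrk h.2⟩
  · exact contractRank_le hr hrk (keptAbove_mem hr hrk w).1
      (mem_lower_trans h.2 (keptAbove_mem hr hrk w).2)
  · exact contractRank_le hr hrk (keptAbove_mem hr hrk v).1
      (mem_lower_trans (mem_lower_of_mem_lower h.2 mem_lower_self h.1.ge)
        (keptAbove_mem hr hrk v).2)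

/-- A part that is not kept is merged with its parent. -/
theorem rankPart_lowestAbove (hr : ∀ v, v ∈ G.lower ℓ r) (hrk : r ∈ keep)
    {v : V} (hkeep : ∀ u v, ℓ u = ℓ v → u ∈ G.lower ℓ v → v ∈ keep → u ∈ keep)
    (hv : v ∉ keep) : G.rankPart (G.contractRank ℓ keep) (G.lowestAbove ℓ v) =
      G.rankPart (G.contractRank ℓ keep) v := by
  have hτ := keptAbove_mem hr hrk v
  have hlt : ℓ v < ℓ (G.keptAbove ℓ keep v) :=
    (rank_le_of_mem_lower hτ.2).lt_of_ne fun e => hv (hkeep _ _ e hτ.2 hτ.1)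
  have hmem := lowestAbove_mem ⟨_, hlt, hτ.2⟩
  have hle := lowestAbove_le (G := G) (v := v) (w := G.keptAbove ℓ keep v) ⟨hlt, hτ.2⟩
  have h1 : G.lowestAbove ℓ v ∈ G.lower ℓ (G.keptAbove ℓ keep v) :=
    mem_lower_of_mem_lower hmem.2 hτ.2 hle
  have h2 : v ∈ G.lower ℓ (G.keptAbove ℓ keep (G.lowestAbove ℓ v)) :=
    mem_lower_trans hmem.2 (keptAbove_mem hr hrk _).2
  refine (rankPart_eq.2 ⟨le_antisymm ?_ ?_, mem_lower_contractRank hr hrk hmem.2⟩).symm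
  · exact contractRank_le hr hrk (keptAbove_mem hr hrk _).1 h2
  · exact contractRank_le hr hrk hτ.1 h1

theorem rankHierarchy_isCoarsening (hr : ∀ v, v ∈ G.lower ℓ r) (hrk : r ∈ keep)
    (hkeep : ∀ u v, ℓ u = ℓ v → u ∈ G.lower ℓ v → v ∈ keep → u ∈ keep) :
    (G.rankHierarchy (G.contractRank ℓ keep) r (mem_lower_contractRank_root hr hrk)).IsCoarsening
      (G.rankHierarchy ℓ r hr) := by
  let q : Quotient (G.rankSetoid ℓ) → Quotient (G.rankSetoid (G.contractRank ℓ keep)) :=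
    fun x => G.rankPart (G.contractRank ℓ keep) x.out
  have hq : ∀ v, q (G.rankPart ℓ v) = G.rankPart (G.contractRank ℓ keep) v := fun v =>
    rankPart_contractRank_eq hr hrk (rankPart_eq.1 (rankPart_out _))
  have hqp : ∀ x, q (G.rankParent ℓ x) =
      G.rankPart (G.contractRank ℓ keep) (G.lowestAbove ℓ x.out) := fun x => hq _
  refine ⟨q, fun v => (hq v).symm, hq r, fun (x : Quotient (G.rankSetoid ℓ)) hx => ?_, fun y => ?_⟩
  · change G.rankParent (G.contractRank ℓ keep) (q x) = q (G.rankParent ℓ x)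
    change q (G.rankParent ℓ x) ≠ q x at hx
    rw [hqp] at hx ⊢
    set v := x.out with hv
    have hvk : v ∈ keep := by
      by_contra hvk
      exact hx (rankPart_lowestAbove hr hrk hkeep hvk)
    have hne : (G.above ℓ v).Nonempty := by
      by_contra hne
      rw [lowestAbove, dif_neg hne] at hx
      exact hx rfl
    have hw := lowestAbove_mem hne
    set w := G.lowestAbove ℓ v
    have hv' := rankPart_eq.1 (rankPart_out (q x))
    set v' := (q x).out
    have hvr := contractRank_eq hr hrk hvk
    have hwr := le_contractRank (keep := keep) hr hrk w
    have hvv' : v ∈ G.lower (G.contractRank ℓ keep) v' :=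
      mem_lower_of_mem_lower hv'.2 mem_lower_self hv'.1.ge
    have hw' : w ∈ G.above (G.contractRank ℓ keep) v' :=
      ⟨by rw [hv'.1, hvr]; exact hw.1.trans_le hwr,
        mem_lower_trans hv'.2 (mem_lower_contractRank hr hrk hw.2)⟩
    have hu := lowestAbove_mem ⟨w, hw'⟩
    have hle := lowestAbove_le hw'
    change G.rankPart (G.contractRank ℓ keep) (G.lowestAbove (G.contractRank ℓ keep) v') = _
    set u := G.lowestAbove (G.contractRank ℓ keep) v'
    have hvu : v ∈ G.lower ℓ (G.keptAbove ℓ keep u) := by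
      rw [← lower_contractRank hr hrk]
      exact mem_lower_trans hvv' hu.2
    have hlt : ℓ v < ℓ (G.keptAbove ℓ keep u) := by
      have := hu.1
      rw [hv'.1, hvr] at this
      exact this
    have hwu : w ∈ G.lower ℓ (G.keptAbove ℓ keep u) :=
      mem_lower_of_mem_lower hw.2 hvu (lowestAbove_le ⟨hlt, hvu⟩)
    exact rankPart_eq.2 ⟨le_antisymm hle (contractRank_le hr hrk (keptAbove_mem hr hrk u).1 hwu),
      mem_lower_of_mem_lower hu.2 hw'.2 hle⟩
  · -- every part is joined to the top part of its class by a path of parents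
    obtain ⟨z, rfl⟩ := Quotient.mk_surjective y
    let 𝒯 : SimpleGraph (Quotient (G.rankSetoid ℓ)) := fromRel fun x y => G.rankParent ℓ x = y
    change (𝒯.induce {x | q x = G.rankPart (G.contractRank ℓ keep) z}).Connected
    set s : Set (Quotient (G.rankSetoid ℓ)) := {x | q x = G.rankPart (G.contractRank ℓ keep) z}
    set t := G.keptAbove ℓ keep z
    have hz := keptAbove_mem hr hrk z
    have ht : ∀ v, G.rankPart ℓ v ∈ s → v ∈ G.lower ℓ t ∧ G.contractRank ℓ keep v = ℓ t :=
      fun v hv => by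
        have hv := rankPart_eq.1 ((hq v).symm.trans hv)
        refine ⟨?_, hv.1⟩
        have := hv.2
        rwa [lower_contractRank hr hrk] at this
    have hts : G.rankPart ℓ t ∈ s := by
      change q _ = _
      rw [hq]
      refine (rankPart_eq.2 ⟨?_, mem_lower_contractRank hr hrk hz.2⟩).symm
      rw [contractRank_eq hr hrk hz.1]
      rfl
    have key : ∀ x, x ∈ s → (𝒯.within s).Reachable x (G.rankPart ℓ t) := by
      intro x hx
      induction hn : ℓ t - ℓ x.out using Nat.strong_induction_on generalizing x with
      | _ n ih =>
      have hxo := rankPart_out x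
      have h1 := ht x.out (by rw [hxo]; exact hx)
      have hle := rank_le_of_mem_lower h1.1
      by_cases hk : x.out ∈ keep
      · rw [contractRank_eq hr hrk hk] at h1
        have : G.rankPart ℓ x.out = G.rankPart ℓ t := rankPart_eq.2 ⟨h1.2, h1.1⟩
        exact hxo ▸ this ▸ Reachable.rfl
      · have hlt : ℓ x.out < ℓ t := hle.lt_of_ne fun e => hk (hkeep _ _ e h1.1 hz.1)
        have ha := lowestAbove_mem ⟨t, hlt, h1.1⟩
        have hps : G.rankParent ℓ x ∈ s := by
          change q _ = _
          rw [hqp, rankPart_lowestAbove hr hrk hkeep hk]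
          exact hx
        have hpo := (rankPart_eq.1 (rankPart_out (G.rankParent ℓ x))).1
        have h2 := rank_le_of_mem_lower (ht _ (by rw [rankPart_out]; exact hps)).1
        have h3 := ha.1
        refine Reachable.trans ?_ (ih _ (by omega) _ hps rfl)
        refine Adj.reachable_within ?_ hx hps
        refine (fromRel_adj _ _ _).2 ⟨fun e => ?_, Or.inl rfl⟩
        have h4 : ℓ (G.rankParent ℓ x).out = ℓ x.out := by rw [← e]
        omega
    exact connected_induce_iff_within.2 ⟨⟨_, hts⟩, fun a ha b hb => (key a ha).trans (key b hb).symm⟩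

/-- In the hierarchy of a rank function, the outer neighbours of a lower set belong to ancestors. -/
theorem rankHierarchy_lt_of_mem_outerNbrs {hr : ∀ v, v ∈ G.lower ℓ r} {z v : V}
    (hv : v ∈ (G.rankHierarchy ℓ r hr).outerNbrs G (G.rankPart ℓ z)) :
    (G.rankHierarchy ℓ r hr).Lt (G.rankPart ℓ z) (G.rankPart ℓ v) := by
  obtain ⟨hv, w, hw, hwv⟩ := hv
  rw [rankHierarchy_sub] at hv hw
  have hlt : ℓ z < ℓ v := not_le.1 fun h => hv (mem_lower_of_adj hw hwv h)
  have h1 : w ∈ G.lower ℓ v :=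
    mem_lower_of_adj mem_lower_self hwv.symm ((rank_le_of_mem_lower hw).trans hlt.le)
  exact ⟨rankHierarchy_le.2 (mem_lower_of_mem_lower hw h1 hlt.le), fun e =>
    hlt.ne (rankPart_eq.1 e).1⟩

end Contract

/-! ### Routes and the choice of the parts to be merged -/

/-- The paths `p 0, …, p m` inside `L`, given as pairs `(m, p)`, that start in `a`, end in `E`, and
meet `a` at their start only. -/
def routes (G : SimpleGraph V) (a L E : Set V) : Set (ℕ × (ℕ → V)) :=
  {q | q.2 0 ∈ a ∧ q.2 q.1 ∈ E ∧ (∀ i ≤ q.1, q.2 i ∈ L) ∧ (∀ i ≤ q.1, 0 < i → q.2 i ∉ a) ∧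
    (∀ i ≤ q.1, ∀ j ≤ q.1, q.2 i = q.2 j → i = j) ∧ ∀ i < q.1, G.Adj (q.2 i) (q.2 (i + 1))}

theorem routes_nonempty {G : SimpleGraph V} {a L E : Set V}
    (hL : ∀ x ∈ L, ∀ y ∈ L, (G.within L).Reachable x y) (ha : (a ∩ L).Nonempty)
    (hE : (E ∩ L).Nonempty) : (G.routes a L E).Nonempty := by
  classical
  obtain ⟨v, hva, hvL⟩ := ha
  obtain ⟨x, hxE, hxL⟩ := hE
  obtain ⟨Q, hQ⟩ := (hL v hvL x hxL).exists_isPath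
  -- the part of the path after its last vertex in `a`
  set i₀ := Nat.findGreatest (fun i => Q.getVert i ∈ a) Q.length
  have hspec : Q.getVert i₀ ∈ a :=
    Nat.findGreatest_spec (P := fun i => Q.getVert i ∈ a) (Nat.zero_le _) (by simpa using hva)
  have hle : i₀ ≤ Q.length := Nat.findGreatest_le _
  have hmemL : ∀ i, Q.getVert i ∈ L := fun i =>
    Reachable.mem_within (Q.takeUntil _ (Q.getVert_mem_support i)).reachable hvL
  refine ⟨(Q.length - i₀, fun j => Q.getVert (i₀ + j)), hspec, ?_, fun i _ => hmemL _, ?_, ?_, ?_⟩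
  · change Q.getVert (i₀ + (Q.length - i₀)) ∈ E
    rw [Nat.add_sub_cancel' hle, Walk.getVert_length]
    exact hxE
  · intro i hi h0
    simp only at hi
    exact Nat.findGreatest_is_greatest (P := fun i => Q.getVert i ∈ a) (n := Q.length)
      (by omega) (by omega)
  · intro i hi j hj hij
    simp only at hi hj
    have := hQ.getVert_injOn (by rw [Set.mem_ofPred_eq]; omega) (by rw [Set.mem_ofPred_eq]; omega) hij
    omega
  · intro i hi
    simp only at hi
    exact (Q.adj_getVert_succ (i := i₀ + i) (by omega)).1

section Routing

variable (G : SimpleGraph V) (ℓ : V → ℕ) (A : V → Set V) (S : Set V)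

/-- The vertices of the lower set of `v` at which it is cut away from something that should be kept
in one part: a flexible set, an edge to a vertex of `S`, or the route of a higher vertex. -/
def exits (D : V → Option (ℕ × (ℕ → V))) (v : V) : Set V :=
  {x ∈ G.lower ℓ v | (∃ w, x ∈ A w ∧ ¬ A w ⊆ G.lower ℓ v) ∨
    (∃ s ∈ S, s ∉ G.lower ℓ v ∧ G.Adj x s) ∨
    ∃ w, ℓ v < ℓ w ∧ v ∈ G.lower ℓ w ∧ ∃ q ∈ D w, ∃ i ≤ q.1, q.2 i = x}

/-- A choice, for every part that has exits, of a route from its flexible set to an exit. Parts with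
a route are going to be merged with their parents. -/
structure IsRouting (D : V → Option (ℕ × (ℕ → V))) : Prop where
  mem_routes : ∀ v, ∀ q ∈ D v, q ∈ G.routes (A v) (G.lower ℓ v) (G.exits ℓ A S D v)
  exits_eq : ∀ v, D v = none → G.exits ℓ A S D v = ∅
  congr : ∀ u v, ℓ u = ℓ v → u ∈ G.lower ℓ v → D u = D v

variable {G ℓ A}

open Classical in
theorem IsSteinerRanking.exists_isRouting [Finite V] (h : IsSteinerRanking G ℓ A) :
    ∃ D, IsRouting G ℓ A S D := by
  have hwf : WellFounded fun w v : V => ℓ v < ℓ w := by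
    have : IsTrans V fun w v : V => ℓ v < ℓ w := ⟨fun a b c hab hbc => lt_trans hbc hab⟩
    have : Std.Irrefl fun w v : V => ℓ v < ℓ w := ⟨fun a => lt_irrefl _⟩
    exact Finite.wellFounded_of_trans_of_irrefl _
  let pick : Set (ℕ × (ℕ → V)) → Option (ℕ × (ℕ → V)) := fun s =>
    if h : s.Nonempty then some h.some else none
  let F : ∀ v, (∀ w, ℓ v < ℓ w → Option (ℕ × (ℕ → V))) → Option (ℕ × (ℕ → V)) := fun v prev =>
    pick (G.routes (A v) (G.lower ℓ v)
      (G.exits ℓ A S (fun w => if h : ℓ v < ℓ w then prev w h else none) v))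
  let D : V → Option (ℕ × (ℕ → V)) := hwf.fix F
  have hD : ∀ v, D v = pick (G.routes (A v) (G.lower ℓ v) (G.exits ℓ A S D v)) := fun v => by
    have h1 : D v = F v fun w _ => D w := hwf.fix_eq F v
    rw [h1]
    have h2 : G.exits ℓ A S (fun w => if ℓ v < ℓ w then D w else none) v = G.exits ℓ A S D v := by
      ext x
      refine and_congr Iff.rfl (or_congr Iff.rfl (or_congr Iff.rfl (exists_congr fun w => ?_)))
      refine and_congr_right fun hw => ?_
      simp only [if_pos hw]
    change pick (G.routes (A v) (G.lower ℓ v)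
      (G.exits ℓ A S (fun w => if ℓ v < ℓ w then D w else none) v)) = _
    rw [h2]
  refine ⟨D, fun v q hq => ?_, fun v hv => ?_, fun u v huv hu => ?_⟩
  · rw [hD] at hq
    simp only [pick] at hq
    split_ifs at hq with hne
    · rw [Option.mem_def, Option.some.injEq] at hq
      rw [← hq]
      exact hne.some_mem
    · exact absurd hq (by simp)
  · by_contra hne
    obtain ⟨x, hx⟩ := Set.nonempty_iff_ne_empty.2 hne
    have hr : (G.routes (A v) (G.lower ℓ v) (G.exits ℓ A S D v)).Nonempty :=
      routes_nonempty (fun x hx y hy => reachable_within_lower hx hy)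
        ⟨v, h.mem v, mem_lower_self⟩ ⟨x, hx, hx.1⟩
    rw [hD] at hv
    simp only [pick] at hv
    rw [dif_pos hr] at hv
    exact absurd hv (by simp)
  · have hA : A u = A v := h.eq_of_mem u v u huv (Or.inl (h.mem u)) (Or.inr hu)
    have hl : G.lower ℓ u = G.lower ℓ v := lower_eq hu huv.ge
    have hE : G.exits ℓ A S D u = G.exits ℓ A S D v := by
      have hw : ∀ w, u ∈ G.lower ℓ w ↔ v ∈ G.lower ℓ w := fun w =>
        ⟨fun h => mem_lower_trans (mem_lower_of_mem_lower hu mem_lower_self huv.ge) h,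
          fun h => mem_lower_trans hu h⟩
      simp only [exits, hl, huv, hw]
    rw [hD, hD v, hA, hl, hE]

end Routing

section Core

variable {G : SimpleGraph V} {ℓ : V → ℕ} {A : V → Set V} {S : Set V}
  {D : V → Option (ℕ × (ℕ → V))}

variable (G ℓ D) in
/-- The part of `t` after merging every part that has a route with its parent. -/
def core (t : V) : Set V :=
  {x ∈ G.lower ℓ t | ∀ s, D s = none → x ∈ G.lower ℓ s → ℓ t ≤ ℓ s}

theorem IsRouting.root_eq_none (hD : IsRouting G ℓ A S D) {r : V} (hr : ∀ v, v ∈ G.lower ℓ r) :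
    D r = none := by
  rw [Option.eq_none_iff_forall_not_mem]
  intro q hq
  rcases (hD.mem_routes r q hq).2.1.2 with ⟨w, -, hw⟩ | ⟨s, -, hs, -⟩ | ⟨w, hw, -⟩
  · exact hw fun x _ => hr x
  · exact hs (hr s)
  · exact absurd (rank_le_of_mem_lower (hr w)) (not_le.2 hw)

theorem IsRouting.subset_lower (hD : IsRouting G ℓ A S D) {t w x : V} (ht : D t = none)
    (hxA : x ∈ A w) (hx : x ∈ G.lower ℓ t) : A w ⊆ G.lower ℓ t := by
  by_contra hno
  have : x ∈ G.exits ℓ A S D t := ⟨hx, Or.inl ⟨w, hxA, hno⟩⟩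
  rw [hD.exits_eq t ht] at this
  exact this

theorem IsRouting.not_adj (hD : IsRouting G ℓ A S D) {t s x : V} (ht : D t = none) (hs : s ∈ S)
    (hst : s ∉ G.lower ℓ t) (hx : x ∈ G.lower ℓ t) : ¬ G.Adj x s := fun hadj => by
  have : x ∈ G.exits ℓ A S D t := ⟨hx, Or.inr (Or.inl ⟨s, hs, hst, hadj⟩)⟩
  rw [hD.exits_eq t ht] at this
  exact this

theorem IsRouting.route_subset_lower (hD : IsRouting G ℓ A S D) {t w : V} (ht : D t = none)
    {q : ℕ × (ℕ → V)} (hq : q ∈ D w) {i : ℕ} (hi : i ≤ q.1) (hx : q.2 i ∈ G.lower ℓ t) {j : ℕ}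
    (hj : j ≤ q.1) : q.2 j ∈ G.lower ℓ t := by
  have hroute := hD.mem_routes w q hq
  rcases le_or_gt (ℓ w) (ℓ t) with hle | hlt
  · exact mem_lower_trans (hroute.2.2.1 j hj) (mem_lower_of_mem_lower (hroute.2.2.1 i hi) hx hle)
  · have : q.2 i ∈ G.exits ℓ A S D t := ⟨hx, Or.inr (Or.inr ⟨w, hlt,
      mem_lower_of_mem_lower hx (hroute.2.2.1 i hi) hlt.le, q, hq, i, hi, rfl⟩)⟩
    rw [hD.exits_eq t ht] at this
    exact absurd this (Set.notMem_empty _)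

theorem IsRouting.subset_core (hD : IsRouting G ℓ A S D) {t w x : V} (ht : D t = none)
    (hxA : x ∈ A w) (hx : x ∈ G.core ℓ D t) : A w ⊆ G.core ℓ D t := fun _ hy =>
  ⟨hD.subset_lower ht hxA hx.1 hy, fun s hs hys => hx.2 s hs (hD.subset_lower hs hy hys hxA)⟩

theorem IsRouting.route_mem_core (hD : IsRouting G ℓ A S D) {t w : V} (ht : D t = none)
    {q : ℕ × (ℕ → V)} (hq : q ∈ D w) {i : ℕ} (hi : i ≤ q.1) (hx : q.2 i ∈ G.core ℓ D t) {j : ℕ}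
    (hj : j ≤ q.1) : q.2 j ∈ G.core ℓ D t :=
  ⟨hD.route_subset_lower ht hq hi hx.1 hj, fun s hs hjs =>
    hx.2 s hs (hD.route_subset_lower hs hq hj hjs hi)⟩

theorem IsRouting.mem_core_of_adj (hD : IsRouting G ℓ A S D) {t e s x : V} (ht : D t = none)
    (hx : x ∈ G.core ℓ D t) (hxe : x ∈ G.lower ℓ e) (hs : s ∈ S) (hse : s ∉ G.lower ℓ e)
    (hadj : G.Adj x s) : s ∈ G.core ℓ D t := by
  have hlt : ℓ e < ℓ s := not_le.1 fun h => hse (mem_lower_of_adj hxe hadj h)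
  have hxe' := rank_le_of_mem_lower hxe
  refine ⟨by_contra fun hst => hD.not_adj ht hs hst hx.1 hadj, fun σ hσ hsσ => ?_⟩
  refine hx.2 σ hσ (mem_lower_of_adj hsσ hadj.symm ?_)
  have := rank_le_of_mem_lower hsσ
  omega

section Chase

variable {t : V} {X C : Set V}

theorem IsRouting.subset_of_disjoint (hD : IsRouting G ℓ A S D) (hA : IsSteinerRanking G ℓ A)
    (ht : D t = none) (hC : C ⊆ G.core ℓ D t)
    (hclosed : ∀ a b, G.Adj a b → a ∈ C → b ∈ G.core ℓ D t → b ∉ X → b ∈ C) {w x : V}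
    (hxA : x ∈ A w) (hx : x ∈ C) (hX : Disjoint (A w) X) : A w ⊆ C := fun _ hy =>
  ((hA.flexible w).reachable_within hxA hy).mem_of_closed (fun a b (hab : (G.within (A w)).Adj a b) ha =>
    hclosed a b hab.1 ha (hD.subset_core ht hxA (hC hx) hab.2.2)
      (Set.disjoint_left.1 hX hab.2.2)) hx

/-- A component `C` of a part minus `X` that is contained in a lower set with a route, and whose
flexible sets avoid `X`, sends a route into `X`: following a route from a vertex of `C`, one either
runs into `X`, or stays in `C` up to an exit of the route, from which a higher route can be
followed. -/
theorem IsRouting.exists_route_into (hD : IsRouting G ℓ A S D) (hA : IsSteinerRanking G ℓ A)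
    {p : ℕ} (hp : ∀ v, ℓ v < p) (ht : D t = none) (hC : C ⊆ G.core ℓ D t)
    (hclosed : ∀ a b, G.Adj a b → a ∈ C → b ∈ G.core ℓ D t → b ∉ X → b ∈ C) (hXS : Disjoint X S)
    (hAX : ∀ w, (A w ∩ C).Nonempty → Disjoint (A w) X) {d : V} (hCd : C ⊆ G.lower ℓ d)
    {q : ℕ × (ℕ → V)} (hq : q ∈ D d) {i : ℕ} (hi : i ≤ q.1) (hqi : q.2 i ∈ C) :
    ∃ d', ∃ q' ∈ D d', ∃ l < q'.1, q'.2 l ∈ C ∧ q'.2 (l + 1) ∈ X := by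
  induction hn : p - ℓ d using Nat.strong_induction_on generalizing d q i with
  | _ n ih =>
  by_cases hX : ∃ l, i ≤ l ∧ l < q.1 ∧ q.2 l ∈ C ∧ q.2 (l + 1) ∈ X
  · obtain ⟨l, -, hl, h1, h2⟩ := hX
    exact ⟨d, q, hq, l, hl, h1, h2⟩
  push Not at hX
  obtain ⟨-, hend, -, -, -, hadj⟩ := hD.mem_routes d q hq
  have hall : ∀ j, i ≤ j → j ≤ q.1 → q.2 j ∈ C := fun j hij => by
    induction j, hij using Nat.le_induction with
    | base => exact fun _ => hqi
    | succ j hij ih' =>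
      intro hj
      have h1 := ih' (by omega)
      exact hclosed _ _ (hadj j (by omega)) h1 (hD.route_mem_core ht hq hi (hC hqi) hj)
        (hX j hij (by omega) h1)
  have hlast := hall q.1 hi le_rfl
  rcases hend.2 with ⟨w, hw, hwd⟩ | ⟨s, hs, hsd, hxs⟩ | ⟨w, hdw, hdw', q', hq', i', hi', he⟩
  · exact absurd ((hD.subset_of_disjoint hA ht hC hclosed hw hlast
      (hAX w ⟨_, hw, hlast⟩)).trans hCd) hwd
  · have hsK := hD.mem_core_of_adj ht (hC hlast) (hCd hlast) hs hsd hxs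
    exact absurd (hCd (hclosed _ _ hxs hlast hsK fun hsX =>
      Set.disjoint_left.1 hXS hsX hs)) hsd
  · have h1 := hp w
    exact ih _ (by omega) (hCd.trans (lower_subset hdw')) hq' hi' (by rw [he]; exact hlast) rfl

end Chase

/-- **Toughness of the merged parts.** Removing a set `X` that avoids `S` from a merged part leaves
at most `3 p |X| + 1` components, where `p` is the number of ranks. -/
theorem IsRouting.card_le [Fintype V] (hD : IsRouting G ℓ A S D) (hA : IsSteinerRanking G ℓ A)
    {p : ℕ} (hp : ∀ v, ℓ v < p) {t : V} (ht : D t = none) {X R : Finset V}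
    (hXS : Disjoint (X : Set V) S) (hR : (R : Set V) ⊆ G.core ℓ D t \ X)
    (hs : (G.within (G.core ℓ D t \ X)).Scattered R) : R.card ≤ 3 * p * X.card + 1 := by
  classical
  set H := G.within (G.core ℓ D t \ X) with hH
  let C : V → Set V := fun r => {x | H.Reachable r x}
  have hCs : ∀ r ∈ R, C r ⊆ G.core ℓ D t \ X := fun r hr x hx => Reachable.mem_within hx (hR hr)
  have hclosed : ∀ r a b, r ∈ R → G.Adj a b → a ∈ C r → b ∈ G.core ℓ D t → b ∉ (X : Set V) →
      b ∈ C r := fun r a b hr hab ha hb hbX =>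
    Reachable.trans ha (hab.reachable_within (hCs r hr ha) ⟨hb, hbX⟩)
  have huniq : ∀ r ∈ R, ∀ r' ∈ R, ∀ x, x ∈ C r → x ∈ C r' → r = r' := fun r hr r' hr' x hx hx' =>
    hs r hr r' hr' (Reachable.trans hx (Reachable.symm hx'))
  -- three kinds of components
  let hit : ℕ → V → Prop := fun i r =>
    ∃ w, ℓ w = i ∧ ¬ Disjoint (A w) (X : Set V) ∧ (A w ∩ C r).Nonempty
  let route : ℕ → V → Prop := fun i r =>
    ∃ d, ℓ d = i ∧ ∃ q ∈ D d, ∃ l < q.1, q.2 l ∈ C r ∧ q.2 (l + 1) ∈ (X : Set V)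
  have hkind : ∀ r ∈ R, A t ⊆ C r ∨ ∃ i < p, hit i r ∨ route i r := by
    intro r hr
    by_cases hh : ∃ i < p, hit i r
    · obtain ⟨i, hi, h⟩ := hh
      exact Or.inr ⟨i, hi, Or.inl h⟩
    have hAX : ∀ w, (A w ∩ C r).Nonempty → Disjoint (A w) (X : Set V) := fun w hw => by
      by_contra hd
      exact hh ⟨ℓ w, hp w, w, rfl, hd, hw⟩
    have hCK : C r ⊆ G.core ℓ D t := (hCs r hr).trans Set.sdiff_subset
    -- the component lies in the lower set of its highest vertex `e`
    obtain ⟨e, he, hmax⟩ := Set.exists_max_image (C r) ℓ (Set.toFinite _) ⟨r, Reachable.rfl⟩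
    have hCe : C r ⊆ G.lower ℓ e := fun x hx => by
      have h1 : H.Reachable e x := Reachable.trans (Reachable.symm he) hx
      exact (h1.within_of_closed (s := C r) (fun a b hab ha => Reachable.trans ha hab.reachable)
        he).mono (within_mono (within_le _ _) fun y hy => hmax y hy)
    have hAe : A e ⊆ C r := hD.subset_of_disjoint hA ht hCK (hclosed r · · hr) (hA.mem e) he
      (hAX e ⟨e, hA.mem e, he⟩)
    cases hDe : D e with
    | none =>
      left
      have h1 := (hCK he).2 e hDe mem_lower_self
      have h2 := rank_le_of_mem_lower (hCK he).1
      rw [← hA.eq_of_mem e t e (le_antisymm h2 h1) (Or.inl (hA.mem e)) (Or.inr (hCK he).1)]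
      exact hAe
    | some q =>
      right
      obtain ⟨d', q', hq', l, hl, h1, h2⟩ := hD.exists_route_into hA hp ht hCK (hclosed r · · hr)
        hXS hAX hCe (q := q) (i := 0) (by rw [hDe]; rfl) (Nat.zero_le _)
        (hAe (hD.mem_routes e q (by rw [hDe]; rfl)).1)
      exact ⟨ℓ d', hp d', Or.inr ⟨d', rfl, q', hq', l, hl, h1, h2⟩⟩
  let X₁ : ℕ → Finset V := fun i => X.filter fun x => ∃ w, ℓ w = i ∧ x ∈ A w
  -- components that meet a flexible set hit by `X`
  have h₁ : ∀ i, (R.filter (hit i)).card ≤ 3 * (X₁ i).card := by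
    intro i
    have hex : ∀ r ∈ R.filter (hit i), ∃ w, ℓ w = i ∧ ¬ Disjoint (A w) (X : Set V) ∧
        (A w ∩ C r).Nonempty := fun r hr => (Finset.mem_filter.1 hr).2
    by_cases hemp : R.filter (hit i) = ∅
    · rw [hemp]; simp
    obtain ⟨r₀, -⟩ := Finset.nonempty_iff_ne_empty.2 hemp
    have : Nonempty V := ⟨r₀⟩
    choose! w hwi hwX hwC using hex
    choose! x hx using hwC
    let 𝒜 : Finset (Set V) := (R.filter (hit i)).image fun r => A (w r)
    have hmaps : ∀ r ∈ R.filter (hit i), A (w r) ∈ 𝒜 := fun r hr =>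
      Finset.mem_image_of_mem (fun r => A (w r)) hr
    rw [Finset.card_eq_sum_card_fiberwise (f := fun r => A (w r)) (t := 𝒜) hmaps]
    have hfib : ∀ B ∈ 𝒜, ((R.filter (hit i)).filter fun r => A (w r) = B).card ≤
        3 * (X.filter (· ∈ B)).card := by
      intro B hB
      obtain ⟨r₁, hr₁, rfl⟩ := Finset.mem_image.1 hB
      set P := (R.filter (hit i)).filter fun r => A (w r) = A (w r₁) with hP
      have hPR : ∀ r ∈ P, r ∈ R := fun r hr =>
        (Finset.mem_filter.1 (Finset.mem_filter.1 hr).1).1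
      have hPx : ∀ r ∈ P, x r ∈ A (w r₁) ∧ x r ∈ C r := fun r hr => by
        have h1 := hx r (Finset.mem_filter.1 hr).1
        have h2 := (Finset.mem_filter.1 hr).2
        exact ⟨h2 ▸ h1.1, h1.2⟩
      have hinj : Set.InjOn x P := fun a ha b hb hab =>
        huniq a (hPR a ha) b (hPR b hb) (x a) (hPx a ha).2 (hab ▸ (hPx b hb).2)
      have hsubK : A (w r₁) ⊆ G.core ℓ D t := hD.subset_core ht (hx r₁ hr₁).1
        (hCs r₁ (Finset.mem_filter.1 hr₁).1 (hx r₁ hr₁).2).1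
      have hle : G.within (A (w r₁) \ (X.filter (· ∈ A (w r₁)) : Finset V)) ≤ H :=
        within_mono le_rfl fun y hy => ⟨hsubK hy.1, fun hyX => hy.2 (by
          rw [Finset.mem_coe] at hyX ⊢
          exact Finset.mem_filter.2 ⟨hyX, hy.1⟩)⟩
      rw [← Finset.card_image_of_injOn hinj]
      refine (hA.flexible (w r₁)).card_le_of_scattered ?_ ?_ ?_ ?_
      · obtain ⟨y, hyA, hyX⟩ := Set.not_disjoint_iff.1 (hwX r₁ hr₁)
        exact ⟨y, Finset.mem_filter.2 ⟨hyX, hyA⟩⟩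
      · intro y hy
        exact (Finset.mem_filter.1 (Finset.mem_coe.1 hy)).2
      · intro y hy
        obtain ⟨r, hr, rfl⟩ := Finset.mem_image.1 (Finset.mem_coe.1 hy)
        exact ⟨(hPx r hr).1, fun h => (hCs r (hPR r hr) (hPx r hr).2).2
          (Finset.mem_filter.1 (Finset.mem_coe.1 h)).1⟩
      · intro a ha b hb hab
        obtain ⟨r, hr, rfl⟩ := Finset.mem_image.1 (Finset.mem_coe.1 ha)
        obtain ⟨r', hr', rfl⟩ := Finset.mem_image.1 (Finset.mem_coe.1 hb)
        have h1 : x r' ∈ C r := Reachable.trans (hPx r hr).2 (hab.mono hle)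
        rw [huniq r (hPR r hr) r' (hPR r' hr') (x r') h1 (hPx r' hr').2]
    refine (Finset.sum_le_sum hfib).trans ?_
    rw [← Finset.mul_sum]
    refine Nat.mul_le_mul_left _ ?_
    rw [← Finset.card_biUnion]
    · refine Finset.card_le_card fun y hy => ?_
      obtain ⟨B, hB, hy⟩ := Finset.mem_biUnion.1 hy
      obtain ⟨r, hr, rfl⟩ := Finset.mem_image.1 hB
      exact Finset.mem_filter.2 ⟨(Finset.mem_filter.1 hy).1, w r, hwi r hr,
        (Finset.mem_filter.1 hy).2⟩
    · intro B hB B' hB' hne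
      obtain ⟨r, hr, rfl⟩ := Finset.mem_image.1 hB
      obtain ⟨r', hr', rfl⟩ := Finset.mem_image.1 hB'
      refine Finset.disjoint_left.2 fun y hy hy' => hne ?_
      exact hA.eq_of_mem _ _ y ((hwi r hr).trans (hwi r' hr').symm)
        (Or.inl (Finset.mem_filter.1 hy).2) (Or.inl (Finset.mem_filter.1 hy').2)
  -- components that send a route into `X`
  have h₂ : ∀ i, (R.filter (route i)).card ≤
      (X.filter fun x => ¬ ∃ w, ℓ w = i ∧ x ∈ A w).card := by
    intro i
    have hex : ∀ r ∈ R.filter (route i), ∃ d q l, ℓ d = i ∧ q ∈ D d ∧ l < q.1 ∧ q.2 l ∈ C r ∧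
        q.2 (l + 1) ∈ (X : Set V) := fun r hr => by
      obtain ⟨d, hd, q, hq, l, hl, h1, h2⟩ := (Finset.mem_filter.1 hr).2
      exact ⟨d, q, l, hd, hq, hl, h1, h2⟩
    by_cases hemp : R.filter (route i) = ∅
    · rw [hemp]; simp
    obtain ⟨r₀, -⟩ := Finset.nonempty_iff_ne_empty.2 hemp
    have : Nonempty V := ⟨r₀⟩
    choose! d q l hdi hq hl hlC hlX using hex
    refine Finset.card_le_card_of_injOn (fun r => (q r).2 (l r + 1)) (fun r hr => ?_)
      fun r hr r' hr' he => ?_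
    · have hrt := hD.mem_routes (d r) (q r) (hq r hr)
      refine Finset.mem_coe.2 (Finset.mem_filter.2 ⟨hlX r hr, ?_⟩)
      rintro ⟨w, hw, hy⟩
      have h1 := hl r hr
      have h2 := hA.eq_of_mem w (d r) _ (hw.trans (hdi r hr).symm) (Or.inl hy)
        (Or.inr (hrt.2.2.1 (l r + 1) (by omega)))
      exact hrt.2.2.2.1 (l r + 1) (by omega) (by omega) (h2 ▸ hy)
    · simp only at he
      have hrt := hD.mem_routes (d r) (q r) (hq r hr)
      have hrt' := hD.mem_routes (d r') (q r') (hq r' hr')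
      have h1 := hl r hr
      have h2 := hl r' hr'
      -- the vertex and the rank determine the route, hence the vertex before it
      have hdd : ℓ (d r) = ℓ (d r') := (hdi r hr).trans (hdi r' hr').symm
      have h3 := hrt.2.2.1 (l r + 1) (by omega)
      have h4 := hrt'.2.2.1 (l r' + 1) (by omega)
      rw [← he] at h4
      have h5 := hD.congr _ _ hdd (mem_lower_of_mem_lower h3 h4 hdd.le)
      have h6 := hq r hr
      rw [h5, Option.mem_def, Option.mem_def.1 (hq r' hr'), Option.some.injEq] at h6
      rw [← h6] at h1 he
      have h7 := hrt'.2.2.2.2.1 (l r + 1) (by omega) (l r' + 1) (by omega) he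
      have h8 : l r = l r' := by omega
      have h9 := hlC r hr
      rw [← h6, h8] at h9
      exact huniq r (Finset.mem_filter.1 hr).1 r' (Finset.mem_filter.1 hr').1 _ h9 (hlC r' hr')
  have h₃ : (R.filter fun r => A t ⊆ C r).card ≤ 1 := Finset.card_le_one.2 fun a ha b hb =>
    huniq a (Finset.mem_filter.1 ha).1 b (Finset.mem_filter.1 hb).1 t
      ((Finset.mem_filter.1 ha).2 (hA.mem t)) ((Finset.mem_filter.1 hb).2 (hA.mem t))
  have hlevel : ∀ i, (R.filter (hit i) ∪ R.filter (route i)).card ≤ 3 * X.card := fun i => by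
    have h4 := Finset.card_union_le (R.filter (hit i)) (R.filter (route i))
    have h5 : (X₁ i).card + (X.filter fun x => ¬ ∃ w, ℓ w = i ∧ x ∈ A w).card = X.card :=
      Finset.card_filter_add_card_filter_not _
    have h6 := h₁ i
    have h7 := h₂ i
    omega
  have hsub : R ⊆ (R.filter fun r => A t ⊆ C r) ∪
      (Finset.range p).biUnion fun i => R.filter (hit i) ∪ R.filter (route i) := fun r hr => by
    rcases hkind r hr with h | ⟨i, hi, h⟩
    · exact Finset.mem_union_left _ (Finset.mem_filter.2 ⟨hr, h⟩)
    · refine Finset.mem_union_right _ (Finset.mem_biUnion.2 ⟨i, Finset.mem_range.2 hi, ?_⟩)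
      exact Finset.mem_union.2 (h.imp (fun h => Finset.mem_filter.2 ⟨hr, h⟩)
        fun h => Finset.mem_filter.2 ⟨hr, h⟩)
  have hbi : ((Finset.range p).biUnion fun i => R.filter (hit i) ∪ R.filter (route i)).card ≤
      p * (3 * X.card) := by
    refine Finset.card_biUnion_le.trans ?_
    refine (Finset.sum_le_card_nsmul _ _ _ fun i _ => hlevel i).trans_eq ?_
    rw [Finset.card_range, smul_eq_mul]
  have := (Finset.card_le_card hsub).trans (Finset.card_union_le _ _)
  have h8 : p * (3 * X.card) = 3 * p * X.card := by ring
  omega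

end Core

/-! ### Spanning trees of the merged parts -/

theorem deg_lt_card [Finite V] (T : SimpleGraph V) (v : V) : T.deg v < Nat.card V := by
  rw [← Set.ncard_univ]
  exact Set.ncard_lt_ncard ⟨Set.subset_univ _, fun h => T.irrefl (h (Set.mem_univ v))⟩
    (Set.toFinite _)

/-- A set that is tough off `S` has a spanning tree of small degree off `S`. -/
theorem exists_isTree_of_tough [Fintype V] {G : SimpleGraph V} {K S : Set V} {p : ℕ} (hp : 1 ≤ p)
    (hne : K.Nonempty) (htough : ∀ X R : Finset V, Disjoint (X : Set V) S → (R : Set V) ⊆ K \ X →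
      (G.within (K \ X)).Scattered R → R.card ≤ 3 * p * X.card + 1) :
    ∃ T ≤ G.induce K, T.IsTree ∧ ∀ v : K, (v : V) ∉ S → T.deg v ≤ 3 * p + 2 := by
  classical
  have hconn : (G.induce K).Connected := by
    refine connected_induce_iff_within.2 ⟨hne, fun a ha b hb => ?_⟩
    by_contra hab
    have hne : a ≠ b := by rintro rfl; exact hab Reachable.rfl
    have := htough ∅ {a, b} (by simp) (by
      intro x hx
      rw [Finset.coe_pair] at hx
      rcases hx with rfl | rfl <;> simpa) (by
      intro x hx y hy hxy
      simp only [Finset.coe_empty, Set.sdiff_empty] at hxy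
      rw [Finset.coe_pair] at hx hy
      rcases hx with rfl | rfl <;> rcases hy with rfl | rfl
      · rfl
      · exact absurd hxy hab
      · exact absurd hxy.symm hab
      · rfl)
    rw [Finset.card_pair hne] at this
    simp at this
  have : Nonempty K := hne.to_subtype
  obtain ⟨B, A, hBS, hBR, hA⟩ := exists_blocker hconn {v : K | (v : V) ∈ S} Set.univ_nonempty
    (k := 3 * p + 2) (by omega)
  have hB : B = ∅ := by
    by_contra hB
    obtain ⟨R, hRB, hRs, hRc⟩ := hBR (Set.nonempty_iff_ne_empty.2 hB)
    set X : Finset V := B.toFinset.map (Function.Embedding.subtype _) with hX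
    have hmemX : ∀ x : K, (x : V) ∈ (X : Set V) ↔ x ∈ B := fun x => by
      rw [hX, Finset.mem_coe, Finset.mem_map]
      constructor
      · rintro ⟨y, hy, hyx⟩
        rw [← Subtype.ext hyx]
        exact Set.mem_toFinset.1 hy
      · exact fun hx => ⟨x, Set.mem_toFinset.2 hx, rfl⟩
    have hRX : ∀ r ∈ R, (r : V) ∈ K \ (X : Set V) := fun r hr =>
      ⟨r.2, fun h => (hRB hr).2 ((hmemX r).1 h)⟩
    have := htough X (R.map (Function.Embedding.subtype _)) (by
      rw [Set.disjoint_left]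
      intro x hx hxS
      obtain ⟨y, hy, rfl⟩ := Finset.mem_map.1 (Finset.mem_coe.1 hx)
      exact Set.disjoint_left.1 hBS (Set.mem_toFinset.1 hy) hxS) (by
      intro x hx
      obtain ⟨y, hy, rfl⟩ := Finset.mem_map.1 (Finset.mem_coe.1 hx)
      exact hRX y hy) (by
      intro a ha b hb hab
      obtain ⟨a, ha', rfl⟩ := Finset.mem_map.1 (Finset.mem_coe.1 ha)
      obtain ⟨b, hb', rfl⟩ := Finset.mem_map.1 (Finset.mem_coe.1 hb)
      refine congrArg _ (hRs a ha' b hb' ?_)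
      have h1 := (reachable_induce_iff (hRX a ha') (hRX b hb')).2 hab
      exact h1.map (⟨fun x => ⟨x, x.2.1⟩, fun {x y} hxy =>
        ⟨hxy, fun h => x.2.2 ((hmemX ⟨x, x.2.1⟩).2 h), fun h => y.2.2 ((hmemX ⟨y, y.2.1⟩).2 h)⟩⟩ :
        G.induce (K \ (X : Set V)) →g (G.induce K).within Bᶜ))
    rw [Finset.card_map, hX, Finset.card_map, ← Set.ncard_eq_toFinset_card'] at this
    have h2 : 3 * p + 2 - 2 = 3 * p := by omega
    rw [h2] at hRc
    omega
  subst hB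
  obtain ⟨u⟩ := this
  obtain ⟨huA, -, hflex, hAu⟩ := hA u ⟨Set.mem_univ _, Set.notMem_empty _⟩
  have hall : ∀ v, v ∈ A u := fun v => by
    have hv : v ∈ (Set.univ : Set K) \ ∅ := ⟨Set.mem_univ _, Set.notMem_empty _⟩
    rw [hAu v hv (by rw [Set.compl_empty, within_univ]; exact hconn.preconnected u v)]
    exact (hA v hv).1
  obtain ⟨T, hT, -, hc, hdeg⟩ := hflex u huA
  have : Nonempty K := ⟨u⟩
  obtain ⟨T', hT', htree⟩ :=
    (Connected.mk fun a b => hc a (hall a) b (hall b) : T.Connected).exists_isTree_le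
  exact ⟨T', hT'.trans hT, htree, fun v hv => (deg_mono hT' v).trans (hdeg v (hall v) hv).1⟩

/-- The parts of the contracted hierarchy are the sets `core`. -/
theorem rankPart_contractRank_eq_core {G : SimpleGraph V} {ℓ : V → ℕ}
    {D : V → Option (ℕ × (ℕ → V))} {r : V} (hr : ∀ v, v ∈ G.lower ℓ r) (hrk : D r = none) (z : V) :
    {x | G.rankPart (G.contractRank ℓ {v | D v = none}) x =
      G.rankPart (G.contractRank ℓ {v | D v = none}) z} =
      G.core ℓ D (G.keptAbove ℓ {v | D v = none} z) := by
  have hrk' : r ∈ {v | D v = none} := hrk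
  have hz := keptAbove_mem hr hrk' z
  ext x
  rw [Set.mem_ofPred_eq, rankPart_eq, lower_contractRank hr hrk']
  constructor
  · rintro ⟨h1, h2⟩
    refine ⟨h2, fun s hs hxs => ?_⟩
    have := contractRank_le hr hrk' (show s ∈ {v | D v = none} from hs) hxs
    rw [h1] at this
    exact this
  · rintro ⟨h1, h2⟩
    have hx := keptAbove_mem hr hrk' x
    exact ⟨le_antisymm (contractRank_le hr hrk' hz.1 h1) (h2 _ hx.1 hx.2), h1⟩

end SimpleGraph

/-! ### Colourings -/

section Colouring

open Finset

variable {V : Type u} [Fintype V]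

open Classical in
theorem card_colourings_avoiding (f : ℕ) (N : Finset V) (i : Fin (f + 1)) :
    #{c : V → Fin (f + 1) | ∀ x ∈ N, c x ≠ i} = f ^ #N * (f + 1) ^ (Fintype.card V - #N) := by
  have : ({c : V → Fin (f + 1) | ∀ x ∈ N, c x ≠ i} : Finset _) =
      Fintype.piFinset fun x => if x ∈ N then univ.erase i else univ := by
    ext c
    simp only [mem_filter, mem_univ, true_and, Fintype.mem_piFinset]
    refine forall_congr' fun x => ?_
    split_ifs with h <;> simp [h]
  rw [this, Fintype.card_piFinset]
  have : ∀ x : V, #(if x ∈ N then univ.erase i else univ : Finset (Fin (f + 1))) =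
      if x ∈ N then f else f + 1 := fun x => by
    split_ifs <;> simp
  simp only [this]
  rw [prod_ite, prod_const, prod_const, filter_mem_eq_inter, univ_inter]
  congr 2
  rw [filter_not, filter_mem_eq_inter, univ_inter, ← compl_eq_univ_sdiff, card_compl]

/-- The union bound: a set of `m` vertices misses one of the `f + 1` colours with probability less
than `1 / n`. -/
theorem mul_pow_lt_pow {n f m : ℕ} (hf : 1 ≤ f) (hfn : f + 1 ≤ n)
    (hm : 6 * (f : ℝ) * Real.logb 2 n < m) : n * (f + 1) * f ^ m < (f + 1) ^ m := by
  have hn : (2 : ℝ) ≤ n := by exact_mod_cast (by omega : 2 ≤ n)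
  have hf1 : (0 : ℝ) < f + 1 := by positivity
  have hlog : 0 < Real.log n := Real.log_pos (by linarith)
  have hlogb : Real.log n ≤ Real.logb 2 n := by
    rw [Real.logb, le_div_iff₀ (Real.log_pos one_lt_two)]
    have := Real.log_two_lt_d9
    nlinarith
  have hm' : 3 * Real.log n < m / (f + 1) := by
    rw [lt_div_iff₀ hf1]
    have hf' : (1 : ℝ) ≤ f := by exact_mod_cast hf
    nlinarith
  have hexp : ((f : ℝ) / (f + 1)) ^ m ≤ Real.exp (-(m / (f + 1))) := by
    have h1 : (f : ℝ) / (f + 1) ≤ Real.exp (-(1 / (f + 1))) := by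
      have := Real.one_sub_le_exp_neg (1 / ((f : ℝ) + 1))
      have h2 : (f : ℝ) / (f + 1) = 1 - 1 / (f + 1) := by field_simp; ring
      rw [h2]
      exact this
    calc ((f : ℝ) / (f + 1)) ^ m ≤ Real.exp (-(1 / (f + 1))) ^ m := by gcongr
      _ = Real.exp (-(m / (f + 1))) := by rw [← Real.exp_nat_mul]; congr 1; ring
  have hn3 : Real.exp (3 * Real.log n) = (n : ℝ) ^ 3 := by
    rw [show (3 : ℝ) * Real.log n = ((3 : ℕ) : ℝ) * Real.log n by norm_num, Real.exp_nat_mul,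
      Real.exp_log (by linarith)]
  have hlt : ((f : ℝ) / (f + 1)) ^ m * (n : ℝ) ^ 3 < 1 := by
    calc ((f : ℝ) / (f + 1)) ^ m * (n : ℝ) ^ 3
        ≤ Real.exp (-(m / (f + 1))) * Real.exp (3 * Real.log n) := by
          rw [hn3]; gcongr
      _ = Real.exp (3 * Real.log n - m / (f + 1)) := by rw [← Real.exp_add]; congr 1; ring
      _ < 1 := by rw [Real.exp_lt_one_iff]; linarith
  rw [div_pow, div_mul_eq_mul_div, div_lt_one (by positivity)] at hlt
  have hfn' : ((f : ℝ) + 1) ≤ n := by exact_mod_cast hfn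
  have hfinal : (n : ℝ) * (f + 1) * f ^ m < (f + 1) ^ m := by
    refine lt_of_le_of_lt ?_ hlt
    have h1 : (n : ℝ) * (f + 1) ≤ n ^ 3 := by
      calc (n : ℝ) * (f + 1) ≤ n * n := by gcongr
        _ ≤ n * n * n := le_mul_of_one_le_right (by positivity) (by linarith)
        _ = n ^ 3 := by ring
    calc (n : ℝ) * (f + 1) * f ^ m ≤ n ^ 3 * f ^ m := by gcongr
      _ = f ^ m * n ^ 3 := mul_comm _ _
  exact_mod_cast hfinal

/-- A random colouring with `f + 1` colours uses all of them on every large set of a family of `n`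
sets. -/
theorem exists_colouring (N : V → Finset V) (hN : ∀ w, #(N w) < Fintype.card V) (f : ℕ) :
    ∃ c : V → Fin (f + 1), ∀ w i, (∀ x ∈ N w, c x ≠ i) →
      (#(N w) : ℝ) ≤ 6 * f * Real.logb 2 (Fintype.card V) := by
  classical
  set n := Fintype.card V with hn
  rcases Nat.eq_zero_or_pos f with rfl | hf
  · refine ⟨fun _ => 0, fun w i hi => ?_⟩
    have : N w = ∅ := eq_empty_of_forall_notMem fun x hx => hi x hx (Subsingleton.elim (α := Fin 1) _ _)
    simp [this]
  by_contra! hno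
  have hlog : ∀ w, #(N w) ≠ 0 → (1 : ℝ) ≤ Real.logb 2 n := fun w hw => by
    have := hN w
    rw [Real.le_logb_iff_rpow_le one_lt_two (by exact_mod_cast (by omega : 0 < n)), Real.rpow_one]
    exact_mod_cast (by omega : 2 ≤ n)
  have hlog0 : 0 ≤ Real.logb 2 n := by
    rcases Nat.eq_zero_or_pos n with h | h
    · simp [h]
    · exact Real.logb_nonneg one_lt_two (by exact_mod_cast h)
  -- with more colours than vertices, the bound holds trivially
  have hfn : f + 1 ≤ n := by
    by_contra hlt
    obtain ⟨w, i, -, hw⟩ := hno fun _ => 0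
    have h0 : #(N w) ≠ 0 := by
      intro h
      rw [h] at hw
      have : 0 ≤ 6 * (f : ℝ) * Real.logb 2 n := by positivity
      simp only [Nat.cast_zero] at hw
      linarith
    have h1 := hlog w h0
    have h2 := hN w
    have h3 : (#(N w) : ℝ) ≤ f := by exact_mod_cast (by omega : #(N w) ≤ f)
    have h4 : (0 : ℝ) ≤ f := Nat.cast_nonneg f
    nlinarith
  let bad : Finset V := {w | 6 * (f : ℝ) * Real.logb 2 n < #(N w)}
  have hcover : (univ : Finset (V → Fin (f + 1))) ⊆
      (bad ×ˢ univ).biUnion fun e => {c : V → Fin (f + 1) | ∀ x ∈ N e.1, c x ≠ e.2} := fun c _ => by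
    obtain ⟨w, i, hc, hw⟩ := hno c
    exact mem_biUnion.2 ⟨(w, i), mem_product.2 ⟨mem_filter.2 ⟨mem_univ _, hw⟩, mem_univ _⟩,
      mem_filter.2 ⟨mem_univ _, hc⟩⟩
  have hterm : ∀ e ∈ bad ×ˢ (univ : Finset (Fin (f + 1))),
      n * (f + 1) * #{c : V → Fin (f + 1) | ∀ x ∈ N e.1, c x ≠ e.2} < (f + 1) ^ n := by
    intro e he
    have hm := (mem_filter.1 (mem_product.1 he).1).2
    rw [card_colourings_avoiding, ← mul_assoc]
    have hle : #(N e.1) ≤ n := (hN e.1).le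
    calc n * (f + 1) * f ^ #(N e.1) * (f + 1) ^ (n - #(N e.1))
        < (f + 1) ^ #(N e.1) * (f + 1) ^ (n - #(N e.1)) :=
          Nat.mul_lt_mul_of_pos_right (mul_pow_lt_pow hf hfn hm) (by positivity)
      _ = (f + 1) ^ n := by rw [← pow_add, Nat.add_sub_cancel' hle]
  have hcard := (card_le_card hcover).trans card_biUnion_le
  rw [card_univ, Fintype.card_fun, Fintype.card_fin, ← hn] at hcard
  set P := bad ×ˢ (univ : Finset (Fin (f + 1))) with hP
  have hPcard : #P ≤ n * (f + 1) := by
    rw [hP, card_product, card_univ, Fintype.card_fin]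
    exact Nat.mul_le_mul_right _ (card_le_univ _)
  have hPne : P.Nonempty := by
    rw [nonempty_iff_ne_empty]
    intro h
    rw [h, sum_empty] at hcard
    have : 0 < (f + 1) ^ n := by positivity
    omega
  have hsum : n * (f + 1) * ∑ e ∈ P, #{c : V → Fin (f + 1) | ∀ x ∈ N e.1, c x ≠ e.2} <
      #P * (f + 1) ^ n := by
    rw [mul_sum, ← smul_eq_mul (#P), ← sum_const]
    exact sum_lt_sum_of_nonempty hPne hterm
  have h1 := Nat.mul_le_mul_left (n * (f + 1)) hcard
  have h2 := Nat.mul_le_mul_right ((f + 1) ^ n) hPcard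
  omega

end Colouring

/-! ### The numbers of ranks and of vertices -/

theorem natCast_le_mul_logb {a k n : ℕ} (hn : 0 < n) (h : 2 ^ a ≤ n ^ k) :
    (a : ℝ) ≤ k * Real.logb 2 n := by
  have hn' : (0 : ℝ) < n := by exact_mod_cast hn
  have h1 : (2 : ℝ) ^ a ≤ (n : ℝ) ^ k := by exact_mod_cast h
  rw [← Real.logb_pow, Real.le_logb_iff_rpow_le one_lt_two (by positivity), Real.rpow_natCast]
  exact h1

theorem natCast_le_max_logb {n p : ℕ} (hn : 0 < n) (hp : p = 1 ∨ 9 * 2 ^ p ≤ 4 * n + 16) :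
    (p : ℝ) ≤ max 1 (Real.logb 2 n) := by
  by_cases hp1 : p ≤ 1
  · exact le_max_of_le_left (by exact_mod_cast hp1)
  · refine le_max_of_le_right ?_
    have h1 : 2 ^ 2 ≤ 2 ^ p := Nat.pow_le_pow_right (by norm_num) (by omega)
    have h2 := natCast_le_mul_logb (a := p) (k := 1) hn (by rw [pow_one]; omega)
    simpa using h2

theorem natCast_le_three_mul_logb {n p d : ℕ} (hp : p = 1 ∨ 9 * 2 ^ p ≤ 4 * n + 16)
    (hd : d < n) (hd' : d ≤ 3 * p + 2) : (d : ℝ) ≤ 3 * Real.logb 2 n := by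
  refine natCast_le_mul_logb (k := 3) (by omega) ?_
  -- for `n ≤ 8`, the trivial bound `n - 1` is good enough
  rcases Nat.lt_or_ge n 9 with hn | hn
  · refine (Nat.pow_le_pow_right (by norm_num) (Nat.le_sub_one_of_lt hd)).trans ?_
    interval_cases n <;> omega
  · refine (Nat.pow_le_pow_right (by norm_num) hd').trans ?_
    by_cases hp2 : p ≤ 2
    · calc 2 ^ (3 * p + 2) ≤ 2 ^ 8 := Nat.pow_le_pow_right (by norm_num) (by omega)
        _ ≤ 9 ^ 3 := by norm_num
        _ ≤ n ^ 3 := Nat.pow_le_pow_left hn 3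
    · have h1 : 2 ^ 3 ≤ 2 ^ p := Nat.pow_le_pow_right (by norm_num) (by omega)
      have h2 : 7 * 2 ^ p ≤ 4 * n := by omega
      have h3 := Nat.pow_le_pow_left h2 3
      rw [mul_pow, mul_pow] at h3
      have h4 : 2 ^ (3 * p + 2) = 4 * (2 ^ p) ^ 3 := by rw [pow_add, mul_comm 3 p, pow_mul]; ring
      rw [h4]
      omega

open SimpleGraph in
theorem theorem5 :
    ∃ C : ℝ, 0 < C ∧
      ∀ (V : Type u) [Fintype V] (G : SimpleGraph V), G.Connected →
        ∃ H₀ : Hierarchy V, H₀.IsDuanPettie G ∧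
          ∀ f : ℕ, ∃ S : Fin (f + 1) → Set V,
            Pairwise (fun i j => Disjoint (S i) (S j)) ∧
            (⋃ i, S i) = Set.univ ∧
            (∀ F : Finset V, F.card ≤ f → ∃ i, S i ∩ (F : Set V) = ∅) ∧
            ∀ i, ∃ H : Hierarchy V,
              H.IsCoarsening H₀ ∧
              H.IsRespectful G ∧
              (∀ K, ∃ T : SimpleGraph (H.part K), T ≤ G.induce (H.part K) ∧ T.IsTree ∧
                ∀ v : H.part K, (v : V) ∉ S i →
                  ((T.neighborSet v).ncard : ℝ) ≤ 3 * Real.logb 2 (Fintype.card V)) ∧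
              (∀ K, ∀ v ∈ H.outerNbrs G K, H.Lt K (H.comp v)) ∧
              (∀ K, ((H.outerNbrs G K).ncard : ℝ) ≤
                C * f * Real.logb 2 (Fintype.card V)) := by
  classical
  -- `6` is what the union bound of `exists_colouring` needs
  refine ⟨6, by norm_num, fun V _ G hG => ?_⟩
  obtain ⟨ℓ, A, p, hA, hℓp, hp⟩ := exists_isSteinerRanking hG
  have : Nonempty V := hG.nonempty
  have hn : 0 < Fintype.card V := Fintype.card_pos
  obtain ⟨r, hr⟩ := Finite.exists_max ℓ
  have hr' : ∀ v, v ∈ G.lower ℓ r := fun v => by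
    have h1 : {y | ℓ y ≤ ℓ r} = Set.univ := Set.eq_univ_of_forall hr
    change (G.within {y | ℓ y ≤ ℓ r}).Reachable r v
    rw [h1, within_univ]
    exact hG.preconnected r v
  have hheight : (ℓ r : ℝ) + 1 ≤ max 1 (Real.logb 2 (Fintype.card V)) := by
    have h1 : ((ℓ r + 1 : ℕ) : ℝ) ≤ p := by exact_mod_cast hℓp r
    push_cast at h1
    exact h1.trans (natCast_le_max_logb hn hp)
  refine ⟨G.rankHierarchy ℓ r hr', hA.isDuanPettie hheight, fun f => ?_⟩
  let N : V → Finset V := fun w => {v | v ∉ G.lower ℓ w ∧ ∃ y ∈ G.lower ℓ w, G.Adj y v}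
  have hN : ∀ w, (N w).card < Fintype.card V := fun w =>
    Finset.card_lt_univ_of_notMem (x := w) fun h => (Finset.mem_filter.1 h).2.1 mem_lower_self
  obtain ⟨c, hc⟩ := exists_colouring N hN f
  refine ⟨fun i => {v | c v = i}, fun i j hij => ?_, ?_, fun F hF => ?_, fun i => ?_⟩
  · exact Set.disjoint_left.2 fun v hi hj => hij (Eq.trans (Eq.symm hi) hj)
  · exact Set.eq_univ_of_forall fun v => Set.mem_iUnion.2 ⟨c v, rfl⟩
  · have h1 : (F.image c).card < Fintype.card (Fin (f + 1)) := by
      rw [Fintype.card_fin]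
      exact Nat.lt_succ_of_le (Finset.card_image_le.trans hF)
    obtain ⟨i, hi⟩ : ∃ i, i ∉ F.image c := by
      by_contra! hall
      rw [Finset.eq_univ_of_forall hall, Finset.card_univ] at h1
      exact lt_irrefl _ h1
    refine ⟨i, Set.eq_empty_of_forall_notMem fun v hv => hi ?_⟩
    exact Finset.mem_image.2 ⟨v, hv.2, hv.1⟩
  set S : Set V := {v | c v = i}
  obtain ⟨D, hD⟩ := hA.exists_isRouting S
  have hrk : r ∈ {v | D v = none} := hD.root_eq_none hr'
  have hkeep : ∀ u v, ℓ u = ℓ v → u ∈ G.lower ℓ v → v ∈ {v | D v = none} → u ∈ {v | D v = none} :=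
    fun u v huv hu hv => (hD.congr u v huv hu).trans hv
  have hroot : (G.contractRank ℓ {v | D v = none} r : ℝ) + 1 ≤
      max 1 (Real.logb 2 (Fintype.card V)) := by
    rw [contractRank_eq hr' hrk hrk]
    exact hheight
  refine ⟨G.rankHierarchy (G.contractRank ℓ {v | D v = none}) r
    (mem_lower_contractRank_root hr' hrk), rankHierarchy_isCoarsening hr' hrk hkeep,
    rankHierarchy_isRespectful hroot, fun K => ?_, fun K v hv => ?_, fun K => ?_⟩
  · obtain ⟨z, rfl⟩ := Quotient.mk_surjective K
    have hz := keptAbove_mem hr' hrk z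
    have hpart := rankPart_contractRank_eq_core hr' hrk z
    obtain ⟨T, hT, htree, hdeg⟩ := exists_isTree_of_tough (G := G) (S := S)
      (K := {x | G.rankPart (G.contractRank ℓ {v | D v = none}) x =
        G.rankPart (G.contractRank ℓ {v | D v = none}) z})
      (Nat.one_le_of_lt (hℓp r)) ⟨z, rfl⟩
      (by rw [hpart]; exact fun X R => hD.card_le hA hℓp hz.1)
    refine ⟨T, hT, htree, fun v hv => natCast_le_three_mul_logb hp ?_ (hdeg v hv)⟩
    refine (deg_lt_card T v).trans_le ?_
    rw [← Nat.card_eq_fintype_card]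
    exact Nat.card_le_card_of_injective _ Subtype.val_injective
  · obtain ⟨z, rfl⟩ := Quotient.mk_surjective K
    exact rankHierarchy_lt_of_mem_outerNbrs hv
  · obtain ⟨z, rfl⟩ := Quotient.mk_surjective K
    have hz := keptAbove_mem hr' hrk z
    set t := G.keptAbove ℓ {v | D v = none} z
    have hsub : (G.rankHierarchy (G.contractRank ℓ {v | D v = none}) r
        (mem_lower_contractRank_root hr' hrk)).sub
          (G.rankPart (G.contractRank ℓ {v | D v = none}) z) = G.lower ℓ t := by
      rw [rankHierarchy_sub, lower_contractRank hr' hrk]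
    have hout : (G.rankHierarchy (G.contractRank ℓ {v | D v = none}) r
        (mem_lower_contractRank_root hr' hrk)).outerNbrs G
          (G.rankPart (G.contractRank ℓ {v | D v = none}) z) = (N t : Set V) := by
      unfold Hierarchy.outerNbrs
      rw [hsub]
      ext v
      simp [N]
    have := hc t i fun v hv hvi => by
      obtain ⟨hvt, y, hy, hyv⟩ := (Finset.mem_filter.1 hv).2
      exact hD.not_adj hz.1 hvi hvt hy hyv
    rw [← Set.ncard_coe_finset, ← hout] at this
    exact this
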